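/- **Conventions.** The Yangian $Y(\mathfrak{gl}_n)$ is the unital associative $\mathbb C$-algebra generated by $(T^a_b)^{\{s\}}$, $1\le a,b\le n$, $s\ge 1$; with $T^a_b(u)=\delta_{ab}+\sum_{s\ge1}(T^a_b)^{\{s\}}u^{-s}$ its defining relations are $(u-v)[T^a_b(u),T^c_d(v)]=T^a_d(u)T^c_b(v)-T^a_d(v)T^c_b(u)$. Let $e_{ab}$ be the standard generators of $\mathfrak{gl}_n$. For a $\mathfrak{gl}_n$-module $V$ and $x\in\mathbb C$, the evaluation module $V(x)$ is $V$ with $Y(\mathfrak{gl}_n)$ acting through $T^a_b(u)\mapsto\delta_{ab}+e_{ba}(u-x)^{-1}$, expanded in powers of $u^{-1}$ (the composition of $\rho_x\colon T(u)\mapsto T(u-x)$ and $\epsilon\colon T^a_b(u)\mapsto\delta_{ab}+e_{ba}u^{-1}$). Take $n=4$, nonnegative integers $\xi_1,\xi_2,\xi_3$, and formal variables $\boldsymbol t^a=(t^a_1,\dots,t^a_{\xi_a})$, $a=1,2,3$; put $\xi^0=0$, $\xi^a=\xi_1+\dots+\xi_a$, and let $R(u)=1+u^{-1}\sum_{a,b}E_{ab}\otimes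 E_{ba}$. In $(\mathbb C^4)^{\otimes\xi^3}$, with superscripts in parentheses indicating the tensor factors acted on, set $$\mathbb T^{[a]}=T^{(\xi^{a-1}+1)}(t^a_1)\cdots T^{(\xi^{a-1}+\xi_a)}(t^a_{\xi_a}),\qquad \mathbb R^{[a,b]}=\prod^{\rightarrow}_{1\le i\le\xi_a}\ \prod^{\leftarrow}_{1\le l\le\xi_b}R^{(\xi^{a-1}+i,\,\xi^{b-1}+l)}(t^a_i-t^b_l),$$ where $\prod^{\rightarrow}$ ($\prod^{\leftarrow}$) means that the factors are ordered from left to right by increasing (decreasing) index. Let $\mathbb B_{\boldsymbol\xi}(\boldsymbol t)$ be the entry of $\mathbb T^{[1]}\mathbb T^{[2]}\mathbb T^{[3]}\mathbb R^{[3,2]}\mathbb R^{[3,1]}\mathbb R^{[2,1]}$ in the row $(1^{\xi_1},2^{\xi_2},3^{\xi_3})$ and the column $(2^{\xi_1},3^{\xi_2},4^{\xi_3})$. For $\boldsymbol t=(t_1,\dots,t_\xi)$ put $\overline{\mathrm{Sym}}_{\boldsymbol t}f(\boldsymbol t)=\sum_{\sigma\in S_\xi}(fQ_\xi)(t_{\sigma(1)},\dots,t_{\sigma(\xi)})$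 with $Q_\xi(\boldsymbol t)=\prod_{i<j}\frac{t_i-t_j-1}{t_i-t_j}$. For $\boldsymbol z=(z_1,\dots,z_k)$ and $I=\{i_1<\dots<i_{|I|}\}\subset\{1,\dots,k\}$, $|I|\le\xi$, put $$V_I(\boldsymbol t,\boldsymbol z,y)=\frac1{(\xi-|I|)!}\overline{\mathrm{Sym}}_{\boldsymbol t}\prod_{a=1}^{|I|}\Bigl(\frac{t_a-y}{t_a-z_{i_a}}\prod_{m=i_a+1}^k\frac{t_a-z_m+1}{t_a-z_m}\Bigr),$$ $$\widetilde V_I(\boldsymbol t,\boldsymbol z,y)=\frac1{(\xi-|I|)!}\overline{\mathrm{Sym}}_{\boldsymbol t}\prod_{a=1}^{|I|}\Bigl(\frac{t_{\xi-a+1}-y}{z_{i_a}-t_{\xi-a+1}}\prod_{m=i_a+1}^k\frac{z_m-t_{\xi-a+1}+1}{z_m-t_{\xi-a+1}}\Bigr).$$ Let $\mathcal S_{p,q,r,k}$ be the set of pairs $(I,J)$ of subsets of $\{1,\dots,k\}$ with $|I|=p$, $|J|=q$, $|I\cap J|=r$. **Proposition.** Let $V$ be a $\mathfrak{gl}_4$-module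 and $v\in V$ a singular vector of weight $(\Lambda^1,\dots,\Lambda^4)$, that is, $e_{ab}v=0$ for $a<b$ and $e_{aa}v=\Lambda^av$. Let $x\in\mathbb C$ and let $\xi_1,\xi_2,\xi_3$ be nonnegative integers. Then in $V(x)$ $$\mathbb B_{\boldsymbol\xi}(\boldsymbol t)v=\prod_{a=1}^3\prod_{i=1}^{\xi_a}\frac1{t^a_i-x}\ \sum_{p=0}^{\min(\xi_2,\xi_3)}\ \sum_{q=0}^{\min(\xi_2,\xi_1)}\ \sum_{r=\max(0,p+q-\xi_2)}^{\min(p,q)}\Bigl(\sum_{(I,J)\in\mathcal S_{p,q,r,\xi_2}}\widetilde V_J(\boldsymbol t^1,\boldsymbol t^2,x-\Lambda^2)\,V_I(\boldsymbol t^3,\boldsymbol t^2,x-\Lambda^3)\Bigr)\,e_{32}^{\xi_2-p-q+r}e_{31}^{q-r}e_{42}^{p-r}e_{41}^{r}e_{21}^{\xi_1-q}e_{43}^{\xi_3-p}\,v,$$ where both sides are expanded as formal Laurent series in the $(t^a_i)^{-1}$ with coefficients in $V$, by one and the same lexicographic order of the variables. -/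

import Mathlib

open scoped Kronecker Nat

/- The bracket of an associative ring is the commutator; so `gl_n` is the type of matrices. -/
attribute [local instance] LieRing.ofAssociativeRing

noncomputable section

namespace YangianGl

/-! ### The Yangian of `gl_n` -/

/-- The coefficient `(T^a_b)^{s}` of `u^{-s}` in the free algebra on the generators
`(T^a_b)^{s}`, `s ≥ 1` (the generator `(a, b, s)` of the free algebra stands for
`(T^a_b)^{s + 1}`), with `(T^a_b)^{0} = δ_{ab}`. -/
def freeT {n : ℕ} (a b : Fin n) : ℕ → FreeAlgebra ℂ (Fin n × Fin n × ℕ)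
  | 0 => if a = b then 1 else 0
  | s + 1 => FreeAlgebra.ι ℂ (a, b, s)

/-- The defining relations of the Yangian: the coefficients of `u^{-r} v^{-s}`, `r, s ≥ 0`, in
`(u - v) [T^a_b(u), T^c_d(v)] = T^a_d(u) T^c_b(v) - T^a_d(v) T^c_b(u)`. The coefficients with
a positive power of `u` or of `v` vanish identically on both sides. -/
inductive YangianRel (n : ℕ) :
    FreeAlgebra ℂ (Fin n × Fin n × ℕ) → FreeAlgebra ℂ (Fin n × Fin n × ℕ) → Prop
  | comm (a b c d : Fin n) (r s : ℕ) :
      YangianRel n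
        ((freeT a b (r + 1) * freeT c d s - freeT c d s * freeT a b (r + 1)) -
          (freeT a b r * freeT c d (s + 1) - freeT c d (s + 1) * freeT a b r))
        (freeT a d r * freeT c b s - freeT a d s * freeT c b r)

/-- The Yangian `Y(gl_n)` over `ℂ`. -/
def Yangian (n : ℕ) : Type := RingQuot (YangianRel n)

instance (n : ℕ) : Ring (Yangian n) := inferInstanceAs (Ring (RingQuot (YangianRel n)))

instance (n : ℕ) : Algebra ℂ (Yangian n) :=
  inferInstanceAs (Algebra ℂ (RingQuot (YangianRel n)))

/-- The quotient map from the free algebra. -/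
def yangianMk (n : ℕ) : FreeAlgebra ℂ (Fin n × Fin n × ℕ) →ₐ[ℂ] Yangian n :=
  RingQuot.mkAlgHom ℂ (YangianRel n)

/-- The element `(T^a_b)^{s}` of `Y(gl_n)`; it is `δ_{ab}` for `s = 0`. -/
def yangianT {n : ℕ} (a b : Fin n) (s : ℕ) : Yangian n :=
  yangianMk n (freeT a b s)

/-- The generating series `T^a_b(u)`, as a formal power series in `u^{-1}`. -/
def yangianSeries {n : ℕ} (a b : Fin n) : PowerSeries (Yangian n) :=
  PowerSeries.mk (yangianT a b)

theorem yangianT_zero {n : ℕ} (a b : Fin n) :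
    yangianT a b 0 = if a = b then 1 else 0 := by
  unfold yangianT freeT
  split_ifs <;> simp

theorem yangianT_rel {n : ℕ} (a b c d : Fin n) (r s : ℕ) :
    (yangianT a b (r + 1) * yangianT c d s - yangianT c d s * yangianT a b (r + 1)) -
        (yangianT a b r * yangianT c d (s + 1) - yangianT c d (s + 1) * yangianT a b r) =
      yangianT a d r * yangianT c b s - yangianT a d s * yangianT c b r := by
  have h : yangianMk n _ = yangianMk n _ :=
    RingQuot.mkAlgHom_rel ℂ (YangianRel.comm a b c d r s)
  simp only [map_sub, map_mul] at h
  exact h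

/-- The homomorphism out of the Yangian given by images `f a b s` of the `(T^a_b)^{s}` that
satisfy the defining relations. -/
def yangianLift {n : ℕ} {A : Type*} [Ring A] [Algebra ℂ A] (f : Fin n → Fin n → ℕ → A)
    (h0 : ∀ a b, f a b 0 = if a = b then 1 else 0)
    (hrel : ∀ a b c d r s,
      (f a b (r + 1) * f c d s - f c d s * f a b (r + 1)) -
          (f a b r * f c d (s + 1) - f c d (s + 1) * f a b r) =
        f a d r * f c b s - f a d s * f c b r) : Yangian n →ₐ[ℂ] A :=
  RingQuot.liftAlgHom ℂ
    ⟨FreeAlgebra.lift ℂ fun g : Fin n × Fin n × ℕ => f g.1 g.2.1 (g.2.2 + 1), by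
      have key : ∀ a b s, FreeAlgebra.lift ℂ
          (fun g : Fin n × Fin n × ℕ => f g.1 g.2.1 (g.2.2 + 1)) (freeT a b s) = f a b s := by
        intro a b s
        cases s with
        | zero => rw [h0]; unfold freeT; split_ifs <;> simp
        | succ s => simp [freeT]
      rintro _ _ ⟨a, b, c, d, r, s⟩
      simp only [map_sub, map_mul, key]
      exact hrel a b c d r s⟩

theorem yangianLift_T {n : ℕ} {A : Type*} [Ring A] [Algebra ℂ A] (f : Fin n → Fin n → ℕ → A)
    (h0 hrel) (a b : Fin n) (s : ℕ) : yangianLift f h0 hrel (yangianT a b s) = f a b s := by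
  unfold yangianLift yangianT
  refine (RingQuot.liftAlgHom_mkAlgHom_apply _ _ _ _).trans ?_
  cases s with
  | zero => rw [h0]; unfold freeT; split_ifs <;> simp
  | succ s => simp [freeT]

/-! ### Shift automorphisms, evaluation homomorphism, evaluation modules -/

/-- The coefficient of `u^{-s}` in the expansion of `(u - x)^{-j}` in powers of `u^{-1}`. -/
def shiftCoeff (x : ℂ) : ℕ → ℕ → ℂ
  | 0, 0 => 1
  | 0, _ + 1 => 0
  | _ + 1, 0 => 0
  | s + 1, j + 1 => (s.choose j : ℂ) * x ^ (s - j)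

theorem shiftCoeff_eq_zero (x : ℂ) {s j : ℕ} (h : s < j) : shiftCoeff x s j = 0 := by
  rcases s with _ | s <;> rcases j with _ | j <;> simp_all [shiftCoeff]
  left
  exact Nat.choose_eq_zero_of_lt h

theorem shiftCoeff_succ (x : ℂ) (s j : ℕ) :
    shiftCoeff x (s + 1) (j + 1) = shiftCoeff x s j + x * shiftCoeff x s (j + 1) := by
  rcases s with _ | s <;> rcases j with _ | j <;> simp [shiftCoeff]
  · ring
  · rw [Nat.choose_succ_succ]
    push_cast
    rcases lt_or_ge j s with h | h
    · have : s - j = (s - (j + 1)) + 1 := by omega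
      rw [this]
      ring
    · rw [Nat.choose_eq_zero_of_lt (show s < j + 1 by omega)]
      push_cast
      ring

/-- The coefficient of `u^{-s}` in `T^a_b(u - x)`, expanded in powers of `u^{-1}`. -/
def shiftT {n : ℕ} (x : ℂ) (a b : Fin n) (s : ℕ) : Yangian n :=
  ∑ j ∈ Finset.range (s + 1), shiftCoeff x s j • yangianT a b j

theorem shiftT_eq_sum {n : ℕ} (x : ℂ) (a b : Fin n) {s M : ℕ} (h : s < M) :
    shiftT x a b s = ∑ j ∈ Finset.range M, shiftCoeff x s j • yangianT a b j := by
  unfold shiftT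
  refine Finset.sum_subset (fun j hj => ?_) (fun j _ hj => ?_)
  · simp only [Finset.mem_range] at hj ⊢
    omega
  · rw [shiftCoeff_eq_zero, zero_smul]
    simp only [Finset.mem_range] at hj
    omega

theorem shiftT_zero {n : ℕ} (x : ℂ) (a b : Fin n) :
    shiftT x a b 0 = if a = b then 1 else 0 := by
  simp [shiftT, shiftCoeff, yangianT_zero]

theorem shiftT_succ {n : ℕ} (x : ℂ) (a b : Fin n) {s M : ℕ} (h : s < M) :
    shiftT x a b (s + 1) =
      (∑ j ∈ Finset.range M, shiftCoeff x s j • yangianT a b (j + 1)) +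
        x • (shiftT x a b s - shiftCoeff x s 0 • yangianT a b 0) := by
  rw [shiftT_eq_sum x a b (show s + 1 < M + 1 by omega),
    shiftT_eq_sum x a b (show s < M + 1 by omega), Finset.sum_range_succ',
    Finset.sum_range_succ', add_sub_cancel_right, Finset.smul_sum, ← Finset.sum_add_distrib]
  simp only [shiftCoeff_succ, add_smul, smul_smul]
  simp [shiftCoeff]

theorem commute_shift_zero {n : ℕ} (x : ℂ) (a b : Fin n) (s : ℕ) (y : Yangian n) :
    (shiftCoeff x s 0 • yangianT a b 0) * y = y * (shiftCoeff x s 0 • yangianT a b 0) := by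
  rw [yangianT_zero]
  split_ifs <;> simp

theorem shiftT_rel {n : ℕ} (x : ℂ) (a b c d : Fin n) (r s : ℕ) :
    (shiftT x a b (r + 1) * shiftT x c d s - shiftT x c d s * shiftT x a b (r + 1)) -
        (shiftT x a b r * shiftT x c d (s + 1) - shiftT x c d (s + 1) * shiftT x a b r) =
      shiftT x a d r * shiftT x c b s - shiftT x a d s * shiftT x c b r := by
  obtain ⟨M, hr, hs⟩ : ∃ M, r < M ∧ s < M := ⟨r + s + 1, by omega, by omega⟩
  have h1 := commute_shift_zero x a b r (shiftT x c d s)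
  have h2 := commute_shift_zero x c d s (shiftT x a b r)
  rw [shiftT_succ x a b hr, shiftT_succ x c d hs]
  set P := ∑ j ∈ Finset.range M, shiftCoeff x r j • yangianT a b (j + 1) with hP
  set P2 := ∑ j ∈ Finset.range M, shiftCoeff x s j • yangianT c d (j + 1) with hP2
  have h3 : (P * shiftT x c d s - shiftT x c d s * P) -
      (shiftT x a b r * P2 - P2 * shiftT x a b r) =
      shiftT x a d r * shiftT x c b s - shiftT x a d s * shiftT x c b r := by
    rw [shiftT_eq_sum x a b hr, shiftT_eq_sum x c d hs, shiftT_eq_sum x a d hr,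
      shiftT_eq_sum x c b hs, shiftT_eq_sum x a d hs, shiftT_eq_sum x c b hr, hP, hP2]
    have e1 : ∀ (f g : ℕ → ℂ) (A B : ℕ → Yangian n),
        (∑ j ∈ Finset.range M, f j • A j) * (∑ l ∈ Finset.range M, g l • B l) =
          ∑ j ∈ Finset.range M, ∑ l ∈ Finset.range M, (f j * g l) • (A j * B l) := by
      intro f g A B
      rw [Finset.sum_mul_sum]
      simp only [smul_mul_smul_comm]
    have e2 : ∀ (f g : ℕ → ℂ) (A B : ℕ → Yangian n),
        (∑ j ∈ Finset.range M, f j • A j) * (∑ l ∈ Finset.range M, g l • B l) =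
          ∑ j ∈ Finset.range M, ∑ l ∈ Finset.range M, (g j * f l) • (A l * B j) := by
      intro f g A B
      rw [e1, Finset.sum_comm]
      simp only [mul_comm]
    rw [e1 _ _ (fun j => yangianT a b (j + 1)), e2 _ _ (yangianT c d) (fun j => yangianT a b (j + 1)),
      e1 _ _ (yangianT a b) (fun j => yangianT c d (j + 1)),
      e2 _ _ (fun j => yangianT c d (j + 1)) (yangianT a b),
      e1 _ _ (yangianT a d) (yangianT c b), e2 _ _ (yangianT a d) (yangianT c b)]
    simp only [← Finset.sum_sub_distrib]
    refine Finset.sum_congr rfl fun j _ => Finset.sum_congr rfl fun l _ => ?_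
    rw [← smul_sub, ← smul_sub, ← smul_sub, ← smul_sub, yangianT_rel]
  rw [← h3]
  generalize shiftCoeff x r 0 • yangianT a b 0 = Z1 at h1 ⊢
  generalize shiftCoeff x s 0 • yangianT c d 0 = Z2 at h2 ⊢
  simp only [add_mul, mul_add, smul_mul_assoc, mul_smul_comm, sub_mul, mul_sub, smul_sub, h1, h2]
  abel

/-- The automorphism `ρ_x : T(u) ↦ T(u - x)` of `Y(gl_n)`. -/
def shiftHom (n : ℕ) (x : ℂ) : Yangian n →ₐ[ℂ] Yangian n :=
  yangianLift (shiftT x) (shiftT_zero x) (shiftT_rel x)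

/-- The universal enveloping algebra of the Lie algebra `gl_n` of `n × n` matrices. -/
abbrev UGl (n : ℕ) : Type := UniversalEnvelopingAlgebra ℂ (Matrix (Fin n) (Fin n) ℂ)

/-- The standard generator `e_{ab}` of `gl_n`. -/
def e {n : ℕ} (a b : Fin n) : Matrix (Fin n) (Fin n) ℂ := Matrix.single a b 1

/-- The coefficients of the series `δ_{ab} + e_{ba} u^{-1}`. -/
def evalT {n : ℕ} (a b : Fin n) : ℕ → UGl n
  | 0 => if a = b then 1 else 0
  | 1 => UniversalEnvelopingAlgebra.ι ℂ (e b a)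
  | _ + 2 => 0

theorem evalT_zero {n : ℕ} (a b : Fin n) : evalT a b 0 = if a = b then 1 else 0 := rfl

theorem evalT_comm {n : ℕ} (a b c d : Fin n) :
    evalT a b 1 * evalT c d 1 - evalT c d 1 * evalT a b 1 =
      (if a = d then evalT c b 1 else 0) - (if c = b then evalT a d 1 else 0) := by
  have h : ⁅(e b a : Matrix (Fin n) (Fin n) ℂ), e d c⁆ =
      (if a = d then e b c else 0) - (if c = b then e d a else 0) := by
    rw [Ring.lie_def]
    unfold e
    congr 1 <;> split_ifs with h
    · subst h; simp
    · simp [h]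
    · subst h; simp
    · simp [h]
  have h' := congrArg (UniversalEnvelopingAlgebra.ι ℂ) h
  rw [LieHom.map_lie, Ring.lie_def] at h'
  simp only [evalT]
  rw [h']
  split_ifs <;> simp

theorem evalT_rel {n : ℕ} (a b c d : Fin n) (r s : ℕ) :
    (evalT a b (r + 1) * evalT c d s - evalT c d s * evalT a b (r + 1)) -
        (evalT a b r * evalT c d (s + 1) - evalT c d (s + 1) * evalT a b r) =
      evalT a d r * evalT c b s - evalT a d s * evalT c b r := by
  have h := evalT_comm a b c d
  have z : ∀ (a b : Fin n) (y : UGl n), evalT a b 0 * y - y * evalT a b 0 = 0 := by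
    intro a b y
    unfold evalT
    split_ifs
    · rw [one_mul, mul_one, sub_self]
    · rw [zero_mul, mul_zero, sub_self]
  have z2 : ∀ (a b : Fin n) (k : ℕ), evalT a b (k + 1 + 1) = 0 := fun _ _ _ => rfl
  have z' : ∀ a b c d : Fin n, evalT a b 1 * evalT c d 0 - evalT c d 0 * evalT a b 1 = 0 := by
    intro a b c d
    rw [← neg_sub, z, neg_zero]
  rcases r with _ | _ | r <;> rcases s with _ | _ | s
  · simp only [zero_add, z, z', sub_self]
  · simp only [zero_add, z2, zero_mul, mul_zero, sub_zero]
    rw [h, evalT_zero, evalT_zero]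
    split_ifs <;> simp
  · simp only [zero_add, z2, zero_mul, mul_zero, sub_zero]
  · simp only [zero_add, z2, zero_mul, mul_zero, sub_zero, zero_sub]
    rw [h, evalT_zero, evalT_zero]
    split_ifs <;> simp
  all_goals simp only [zero_add, z2, zero_mul, mul_zero, sub_self]

/-- The evaluation homomorphism `ε : Y(gl_n) → U(gl_n)`, `T^a_b(u) ↦ δ_{ab} + e_{ba} u^{-1}`. -/
def evalHom (n : ℕ) : Yangian n →ₐ[ℂ] UGl n :=
  yangianLift evalT evalT_zero evalT_rel

/-- The evaluation module `V(x)` over `Y(gl_n)`: the `gl_n`-module `V` on which `Y(gl_n)` acts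
through `ε ∘ ρ_x`. -/
def evalModule {n : ℕ} (V : Type*) [AddCommGroup V] [Module ℂ V]
    [LieRingModule (Matrix (Fin n) (Fin n) ℂ) V] [LieModule ℂ (Matrix (Fin n) (Fin n) ℂ) V]
    (x : ℂ) : Yangian n →ₐ[ℂ] Module.End ℂ V :=
  (UniversalEnvelopingAlgebra.lift ℂ (LieModule.toEnd ℂ (Matrix (Fin n) (Fin n) ℂ) V)).comp
    ((evalHom n).comp (shiftHom n x))

/-- `v` is a `gl_n`-singular vector of weight `Λ`. -/
def IsSingularVector {n : ℕ} {V : Type*} [AddCommGroup V] [Module ℂ V]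
    [LieRingModule (Matrix (Fin n) (Fin n) ℂ) V] (Λ : Fin n → ℂ) (v : V) : Prop :=
  (∀ a b : Fin n, a < b → ⁅(e a b : Matrix (Fin n) (Fin n) ℂ), v⁆ = 0) ∧
    ∀ a : Fin n, ⁅(e a a : Matrix (Fin n) (Fin n) ℂ), v⁆ = Λ a • v

/-- The operator by which `e_{ab}` acts on a `gl_n`-module. -/
def eOp (n : ℕ) (V : Type*) [AddCommGroup V] [Module ℂ V]
    [LieRingModule (Matrix (Fin n) (Fin n) ℂ) V] [LieModule ℂ (Matrix (Fin n) (Fin n) ℂ) V]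
    (a b : Fin n) : Module.End ℂ V :=
  LieModule.toEnd ℂ (Matrix (Fin n) (Fin n) ℂ) V (e a b)

/-! ### The formal variables `t^a_i`

Everything depending on the variables `t^a_i` is a formal Laurent (Hahn) series in the
`(t^a_i)^{-1}`, whose exponents are ordered lexicographically. The series with coefficients in
`ℂ` form a field, in which the `t^a_i` are algebraically independent over `ℂ`; thus it contains
the field of rational functions in them. The series with coefficients in a vector space `V`
contain the `V`-valued rational functions. -/

/-- The labels `(a, i)` of the variables `t^a_i`, `i = 1, …, ξ_a`, in the order
`t^1_1, …, t^1_{ξ_1}, t^2_1, …`. They also label the factors of `(ℂ^n)^{⊗(ξ_1 + … + ξ_{n-1})}`.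
Indices are counted from `0`. -/
abbrev Label {m : ℕ} (ξ : Fin m → ℕ) : Type := Σₗ a : Fin m, Fin (ξ a)

/-- The label of `t^a_i`. -/
def lab {m : ℕ} {ξ : Fin m → ℕ} (a : Fin m) (i : Fin (ξ a)) : Label ξ := toLex ⟨a, i⟩

/-- Exponents of monomials in the `(t^a_i)^{-1}`, ordered lexicographically. -/
abbrev Expo {m : ℕ} (ξ : Fin m → ℕ) : Type := Lex (Label ξ → ℤ)

/-- The formal series in the `(t^a_i)^{-1}` with coefficients in `A`. -/
abbrev Ser {m : ℕ} (ξ : Fin m → ℕ) (A : Type*) [Zero A] : Type _ := HahnSeries (Expo ξ) A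

/-- The exponent of the monomial `(t_i)^{-k}`. -/
def expo {m : ℕ} {ξ : Fin m → ℕ} (i : Label ξ) (k : ℤ) : Expo ξ := toLex (Pi.single i k)

theorem expo_strictMono {m : ℕ} {ξ : Fin m → ℕ} (i : Label ξ) :
    StrictMono fun k : ℕ => expo i (k : ℤ) := by
  intro k l h
  refine ⟨i, fun j hj => ?_, ?_⟩
  · simp [expo, Pi.single_eq_of_ne hj.ne]
  · simpa [expo] using h

/-- The variable `t_i` itself. -/
def tVar {m : ℕ} {ξ : Fin m → ℕ} (i : Label ξ) : Ser ξ ℂ := HahnSeries.single (expo i (-1)) 1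

/-- The group of variables `𝐭^a = (t^a_1, …, t^a_{ξ_a})`. -/
def tVars {m : ℕ} (ξ : Fin m → ℕ) (a : Fin m) : Fin (ξ a) → Ser ξ ℂ := fun i => tVar (lab a i)

/-- Substitution `u = t_i` in a power series in `u^{-1}`. -/
def substVar {m : ℕ} {ξ : Fin m → ℕ} {A : Type*} [Ring A] (i : Label ξ) (f : PowerSeries A) :
    Ser ξ A :=
  HahnSeries.embDomain (OrderEmbedding.ofStrictMono _ (expo_strictMono i))
    (HahnSeries.toPowerSeries.symm f)

/-- Scalar series as series with coefficients in a `ℂ`-algebra. -/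
def scalarSer {m : ℕ} {ξ : Fin m → ℕ} (A : Type*) [Ring A] [Algebra ℂ A] (f : Ser ξ ℂ) :
    Ser ξ A :=
  f.map (algebraMap ℂ A)

/-- The `V`-valued series `f · w` for a scalar series `f` and a vector `w`. -/
def serSMul {m : ℕ} {ξ : Fin m → ℕ} {V : Type*} [AddCommGroup V] [Module ℂ V] (f : Ser ξ ℂ)
    (w : V) : Ser ξ V :=
  f.map (LinearMap.toSpanSingleton ℂ V w)

/-- The coefficientwise action of a series with coefficients in an algebra `A` on a vector of an
`A`-module, the module being given by a representation `ρ`. -/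
def serAct {m : ℕ} {ξ : Fin m → ℕ} {A V : Type*} [Ring A] [Algebra ℂ A] [AddCommGroup V]
    [Module ℂ V] (ρ : A →ₐ[ℂ] Module.End ℂ V) (f : Ser ξ A) (v : V) : Ser ξ V :=
  f.map ((LinearMap.applyₗ v).comp ρ.toLinearMap)

/-! ### The weight function -/

/-- The rational `R`-matrix `R(u) = 1 + u⁻¹ ∑ E_{ab} ⊗ E_{ba}`. -/
def rMatrix (n : ℕ) {K : Type*} [Field K] (u : K) : Matrix (Fin n × Fin n) (Fin n × Fin n) K :=
  1 + u⁻¹ • ∑ a : Fin n, ∑ b : Fin n,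
    Matrix.single a b (1 : K) ⊗ₖ Matrix.single b a (1 : K)

/-- Matrices acting in `(ℂ^n)^{⊗(ξ_1 + … + ξ_{n-1})}`, `n = m + 1`, with entries in the series with
coefficients in `Y(gl_n)`. Rows and columns are labelled by multiindices. -/
abbrev BigMatrix {m : ℕ} (ξ : Fin m → ℕ) : Type :=
  Matrix (Label ξ → Fin (m + 1)) (Label ξ → Fin (m + 1)) (Ser ξ (Yangian (m + 1)))

/-- `T^{(i)}(t_i)`: the matrix `T(t_i)` in the tensor factor with label `i`. -/
def tFactor {m : ℕ} (ξ : Fin m → ℕ) (i : Label ξ) : BigMatrix ξ := fun α β =>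
  if ∀ l, l ≠ i → α l = β l then substVar i (yangianSeries (α i) (β i)) else 0

/-- `R^{(i j)}(t_i - t_j)`: the `R`-matrix in the tensor factors with labels `i ≠ j`. -/
def rFactor {m : ℕ} (ξ : Fin m → ℕ) (i j : Label ξ) : BigMatrix ξ := fun α β =>
  if ∀ l, l ≠ i → l ≠ j → α l = β l then
    scalarSer (Yangian (m + 1)) (rMatrix (m + 1) (tVar i - tVar j) (α i, α j) (β i, β j))
  else 0

/-- `𝕋^{[a]}(𝐭^a)`: the product of the `T`-factors of the group `a`, from left to right. -/
def tGroup {m : ℕ} (ξ : Fin m → ℕ) (a : Fin m) : BigMatrix ξ :=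
  ((List.finRange (ξ a)).map fun k => tFactor ξ (lab a k)).prod

/-- `ℝ^{[a,b]}(𝐭^a, 𝐭^b) = ∏→_i ∏←_l R(t^a_i - t^b_l)`. -/
def rGroup {m : ℕ} (ξ : Fin m → ℕ) (a b : Fin m) : BigMatrix ξ :=
  ((List.finRange (ξ a)).map fun i =>
    ((List.finRange (ξ b)).reverse.map fun l => rFactor ξ (lab a i) (lab b l)).prod).prod

/-- `𝕋^{[1]} ⋯ 𝕋^{[m]} · ∏←_a ∏←_{b < a} ℝ^{[a,b]}`. -/
def tHat {m : ℕ} (ξ : Fin m → ℕ) : BigMatrix ξ :=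
  ((List.finRange m).map fun a => tGroup ξ a).prod *
    ((List.finRange m).reverse.map fun a =>
      (((List.finRange m).filter fun b => b < a).reverse.map fun b => rGroup ξ a b).prod).prod

/-- `𝔹_ξ(𝐭)`: the entry of `tHat` in the row `(1^{ξ_1}, 2^{ξ_2}, …, (n-1)^{ξ_{n-1}})` and the
column `(2^{ξ_1}, 3^{ξ_2}, …, n^{ξ_{n-1}})`, for `n = m + 1`. -/
def betheB {m : ℕ} (ξ : Fin m → ℕ) : Ser ξ (Yangian (m + 1)) :=
  tHat ξ (fun l => (ofLex l).1.castSucc) (fun l => (ofLex l).1.succ)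

/-! ### The coefficient functions -/

section Functions

variable {K : Type*} [Field K]

/-- `Q_m(t_1, …, t_m) = ∏_{i < j} (t_i - t_j - 1) / (t_i - t_j)`. -/
def qFun {m : ℕ} (t : Fin m → K) : K :=
  ∏ i : Fin m, ∏ j ∈ Finset.Ioi i, (t i - t j - 1) / (t i - t j)

/-- The symmetrization of `f · Q_m`. -/
def symBar {m : ℕ} (f : (Fin m → K) → K) (t : Fin m → K) : K :=
  ∑ σ : Equiv.Perm (Fin m), f (t ∘ σ) * qFun (t ∘ σ)

/-- `F_I(𝐭, 𝐳) = ∏_{a ≤ |I|} (1 / (t_a - z_{i_a}) ∏_{m > i_a} (t_a - z_m + 1) / (t_a - z_m))` for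
`I = {i_1 < i_2 < ⋯}`, `|I| ≤ ξ`. -/
def fFun {ξ k : ℕ} (I : Finset (Fin k)) (t : Fin ξ → K) (z : Fin k → K) : K :=
  ∏ a : Fin ξ, if h : a.val < I.card then
      1 / (t a - z (I.orderEmbOfFin rfl ⟨a.val, h⟩)) *
        ∏ l ∈ Finset.Ioi (I.orderEmbOfFin rfl ⟨a.val, h⟩), (t a - z l + 1) / (t a - z l)
    else 1

/-- `F̃_I(𝐭, 𝐳) = ∏_{a ≤ |I|} (1 / (z_{i_a} - t_{ξ-a+1})
∏_{m > i_a} (z_m - t_{ξ-a+1} + 1) / (z_m - t_{ξ-a+1}))` for `I = {i_1 < i_2 < ⋯}`, `|I| ≤ ξ`. -/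
def fTilde {ξ k : ℕ} (I : Finset (Fin k)) (t : Fin ξ → K) (z : Fin k → K) : K :=
  ∏ a : Fin ξ, if h : a.val < I.card then
      1 / (z (I.orderEmbOfFin rfl ⟨a.val, h⟩) - t a.rev) *
        ∏ l ∈ Finset.Ioi (I.orderEmbOfFin rfl ⟨a.val, h⟩),
          (z l - t a.rev + 1) / (z l - t a.rev)
    else 1

/-- `V_I(𝐭, 𝐳, y)`, for `|I| ≤ ξ`. -/
def vFun {ξ k : ℕ} (I : Finset (Fin k)) (t : Fin ξ → K) (z : Fin k → K) (y : K) : K :=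
  1 / ((ξ - I.card)! : K) *
    symBar (fun s => fFun I s z * ∏ a : Fin ξ with a.val < I.card, (s a - y)) t

/-- `Ṽ_I(𝐭, 𝐳, y)`, for `|I| ≤ ξ`. -/
def vTilde {ξ k : ℕ} (I : Finset (Fin k)) (t : Fin ξ → K) (z : Fin k → K) (y : K) : K :=
  1 / ((ξ - I.card)! : K) *
    symBar (fun s => fTilde I s z * ∏ a : Fin ξ with a.val < I.card, (s a.rev - y)) t

end Functions

/-- `𝒮_{p,q,r,k}`: the pairs `(I, J)` of subsets of `{1, …, k}` with `|I| = p`, `|J| = q`,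
`|I ∩ J| = r`. -/
def pairs (p q r k : ℕ) : Finset (Finset (Fin k) × Finset (Fin k)) :=
  {IJ | IJ.1.card = p ∧ IJ.2.card = q ∧ (IJ.1 ∩ IJ.2).card = r}

end YangianGl

end

open YangianGl

set_option linter.unusedSectionVars false

/-! In the evaluation module, `T(t_i)` becomes the matrix with entries δ_{ab} + (t_i - x)⁻¹ e_{ba},
so the weight function applied to `v` is one coordinate (the row) of a product of such matrices and
R-matrices applied to `v` placed at one basis tensor (the column). Basis tensors are colourings of
the labels. Colours, groups and indices of `e` are counted from 0 in the code; below, T1, T2, T3 and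
R21, R31, R32 denote the factors of the three groups as numbered in the theorem, while colours and
`e a b` are indexed as in the code.

The RTT and Yang–Baxter relations give T1 T2 T3 R32 R31 R21 = R21 T2 T1 · T3 R31 R32
(`nested_reorder`). Two problems of type gl_2 then separate. In T3 R31 R32 the first group is inert,
because `e 1 2` kills every vector `e 3 2 ^ m v`; what remains involves the colours 2 and 3, with
the labels of the second group as two-state sites (`third_group`). In R21 T1 the row is fixed
instead of the column; after transposing and replacing t by -t it is the same problem for the
colours 1 and 0 (`first_groups`).

The gl_2 problem is the algebraic Bethe ansatz for an inhomogeneous chain attached to a highest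
weight module. Sites are added one at a time, and `IsBase.monodromy` follows simultaneously the
creation entry and the diagonal entry with its wanted and unwanted terms. The rational identities
behind the induction are `attach_insert`, `diagAct_step` and `attach_diagAct`. The resulting
coefficients `bethe` satisfy a recursion over sites: an excited site consumes one variable, the
others keep all of them. Splitting a symmetrization by its first variable gives the same recursion
for V_I (`bethe_eq_vFun`), and `vTilde_eq` identifies the negated version with Ṽ_J up to sign.

The middle factor T2 joins a row colour 0 or 1 to a column colour 2 or 3, so it contributes only `e
2 1`, `e 2 0`, `e 3 1`, `e 3 0`, which commute (`IsGlFamily.prod_lowering`). With I the sites of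
colour 3 on the right and J those of colour 0 on the left, the sum over intermediate colourings is a
sum over pairs (I, J), sorted at the end by |I|, |J| and |I ∩ J|.

Everything takes place over the field of scalar series, on the module `SerOrbit` of classes f v with
f a series of operators; equality there means equality of all coefficients after application to `v`.
-/

noncomputable section

namespace YangianGl

/-! ### Ordered products over groups of labels -/

section OrderedProducts

variable {N ι : Type*} [Monoid N]

/-- `∏←_{l ∈ b} R_l`. -/
def leftProd (R : ι → N) (b : List ι) : N := (b.reverse.map R).prod

/-- `∏→_{i ∈ a} ∏←_{l ∈ b} R_{i l}`. -/
def gridProd (R : ι → ι → N) (a b : List ι) : N := (a.map fun i => leftProd (R i) b).prod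

@[simp] theorem leftProd_nil (R : ι → N) : leftProd R [] = 1 := rfl

theorem leftProd_cons (R : ι → N) (l : ι) (b : List ι) :
    leftProd R (l :: b) = leftProd R b * R l := by
  simp [leftProd]

@[simp] theorem gridProd_nil (R : ι → ι → N) (b : List ι) : gridProd R [] b = 1 := rfl

theorem gridProd_cons (R : ι → ι → N) (i : ι) (a b : List ι) :
    gridProd R (i :: a) b = leftProd (R i) b * gridProd R a b := by
  simp [gridProd]

theorem commute_listProd {x : N} {f : ι → N} {a : List ι} (h : ∀ i ∈ a, Commute x (f i)) :
    Commute x (a.map f).prod := by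
  refine Commute.list_prod_right _ _ fun y hy => ?_
  obtain ⟨i, hi, rfl⟩ := List.mem_map.1 hy
  exact h i hi

theorem commute_leftProd {x : N} {f : ι → N} {a : List ι} (h : ∀ i ∈ a, Commute x (f i)) :
    Commute x (leftProd f a) :=
  commute_listProd fun i hi => h i (List.mem_reverse.1 hi)

theorem commute_gridProd {x : N} {R : ι → ι → N} {a b : List ι}
    (h : ∀ i ∈ a, ∀ l ∈ b, Commute x (R i l)) : Commute x (gridProd R a b) :=
  commute_listProd fun i hi => commute_leftProd (h i hi)

/-- Interleaving two ordered products with commuting off-diagonal factors. -/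
theorem listProd_mul_interleave (f g : ι → N) (a : List ι) (ha : a.Nodup)
    (h : ∀ i ∈ a, ∀ j ∈ a, i ≠ j → Commute (f i) (g j)) :
    (a.map f).prod * (a.map g).prod = (a.map fun i => f i * g i).prod := by
  induction a with
  | nil => simp
  | cons i a ih =>
    rw [List.nodup_cons] at ha
    have hc : Commute (g i) (a.map f).prod := commute_listProd fun j hj =>
      (h j (List.mem_cons_of_mem _ hj) i List.mem_cons_self
        (fun e => ha.1 (e ▸ hj))).symm
    simp only [List.map_cons, List.prod_cons]
    rw [← ih ha.2 fun i hi j hj => h i (List.mem_cons_of_mem _ hi) j (List.mem_cons_of_mem _ hj)]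
    rw [mul_assoc, ← mul_assoc _ (g i), ← hc.eq]
    simp only [mul_assoc]

/-- Row-by-row and column-by-column orderings of a grid product agree. -/
theorem listProd_comm (A : ι → ι → N) (a b : List ι) (ha : a.Nodup) (hb : b.Nodup)
    (h : ∀ i ∈ a, ∀ j ∈ a, ∀ l ∈ b, ∀ m ∈ b, i ≠ j → l ≠ m → Commute (A i l) (A j m)) :
    (a.map fun i => (b.map fun l => A i l).prod).prod =
      (b.map fun l => (a.map fun i => A i l).prod).prod := by
  induction b with
  | nil => simp
  | cons l b ih =>
    rw [List.nodup_cons] at hb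
    simp only [List.map_cons, List.prod_cons]
    rw [← ih hb.2 fun i hi j hj l hl m hm => h i hi j hj l (List.mem_cons_of_mem _ hl) m
      (List.mem_cons_of_mem _ hm), listProd_mul_interleave _ _ _ ha]
    intro i hi j hj hij
    exact commute_listProd fun m hm => h i hi j hj l List.mem_cons_self m
      (List.mem_cons_of_mem _ hm) hij fun e => hb.1 (e ▸ hm)

variable {T : ι → N} {R : ι → ι → N}

/-- The RTT relation is applied to one label of `b` at a time. The decreasing order inside
`leftProd` is what brings each `R i l` next to `T l * T i`; all other factors met on the way sit at
different labels and commute. -/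
theorem prod_mul_leftProd_exchange (i : ι) (b : List ι) (hi : i ∉ b) (hb : b.Nodup)
    (hTR : ∀ i j k, i ≠ j → i ≠ k → Commute (T i) (R j k))
    (hRTT : ∀ i j, i ≠ j → T j * T i * R i j = R i j * T i * T j) :
    (b.map T).prod * T i * leftProd (R i) b = leftProd (R i) b * T i * (b.map T).prod := by
  induction b with
  | nil => simp
  | cons l b ih =>
    rw [List.nodup_cons] at hb
    simp only [List.mem_cons, not_or] at hi
    have hl : Commute (T l) (leftProd (R i) b) := commute_leftProd fun m hm =>
      hTR l i m (Ne.symm hi.1) fun e => hb.1 (e ▸ hm)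
    have hr : Commute (R i l) (b.map T).prod := commute_listProd fun m hm =>
      (hTR m i l (fun e => hi.2 (e ▸ hm)) (fun e => hb.1 (e ▸ hm))).symm
    rw [leftProd_cons, List.map_cons, List.prod_cons]
    calc T l * (b.map T).prod * T i * (leftProd (R i) b * R i l)
        = T l * ((b.map T).prod * T i * leftProd (R i) b) * R i l := by simp only [mul_assoc]
      _ = (T l * leftProd (R i) b) * T i * ((b.map T).prod * R i l) := by
          rw [ih hi.2 hb.2]; simp only [mul_assoc]
      _ = leftProd (R i) b * (T l * T i * R i l) * (b.map T).prod := by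
          rw [hl.eq, ← hr.eq]; simp only [mul_assoc]
      _ = _ := by rw [hRTT i l hi.1]; simp only [mul_assoc]

theorem prod_mul_gridProd_exchange (a b : List ι) (hab : ∀ i ∈ a, i ∉ b) (ha : a.Nodup)
    (hb : b.Nodup)
    (hTR : ∀ i j k, i ≠ j → i ≠ k → Commute (T i) (R j k))
    (hRTT : ∀ i j, i ≠ j → T j * T i * R i j = R i j * T i * T j) :
    (b.map T).prod * (a.map T).prod * gridProd R a b =
      gridProd R a b * (a.map T).prod * (b.map T).prod := by
  induction a with
  | nil => simp
  | cons i a ih =>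
    rw [List.nodup_cons] at ha
    have hi : i ∉ b := hab i List.mem_cons_self
    have hab' : ∀ j ∈ a, j ∉ b := fun j hj => hab j (List.mem_cons_of_mem _ hj)
    have h1 : Commute (leftProd (R i) b) (a.map T).prod := commute_listProd fun j hj =>
      (commute_leftProd fun m hm => hTR j i m (fun e => ha.1 (e ▸ hj))
        (fun e => hab' j hj (e ▸ hm))).symm
    have h2 : Commute (T i) (gridProd R a b) := commute_gridProd fun j hj m hm =>
      hTR i j m (fun e => ha.1 (e ▸ hj)) (fun e => hi (e ▸ hm))
    rw [gridProd_cons, List.map_cons, List.prod_cons]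
    calc (b.map T).prod * (T i * (a.map T).prod) * (leftProd (R i) b * gridProd R a b)
        = (b.map T).prod * T i * ((a.map T).prod * leftProd (R i) b) * gridProd R a b := by
          simp only [mul_assoc]
      _ = ((b.map T).prod * T i * leftProd (R i) b) * (a.map T).prod * gridProd R a b := by
          rw [← h1.eq]; simp only [mul_assoc]
      _ = leftProd (R i) b * T i * ((b.map T).prod * (a.map T).prod * gridProd R a b) := by
          rw [prod_mul_leftProd_exchange i b hi hb hTR hRTT]; simp only [mul_assoc]
      _ = leftProd (R i) b * (T i * gridProd R a b) * (a.map T).prod * (b.map T).prod := by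
          rw [ih hab' ha.2]; simp only [mul_assoc]
      _ = _ := by rw [h2.eq]; simp only [mul_assoc]

/-- `R k i` is carried through the two rows by one Yang–Baxter move for each label of `a`. -/
theorem leftProd_mul_exchange (k i : ι) (a : List ι) (hi : i ∉ a) (hk : k ∉ a) (hki : k ≠ i)
    (ha : a.Nodup)
    (hRR : ∀ i j k l, i ≠ k → i ≠ l → j ≠ k → j ≠ l → Commute (R i j) (R k l))
    (hYB : ∀ i j k, i ≠ j → i ≠ k → j ≠ k →
      R i j * R i k * R j k = R j k * R i k * R i j) :
    R k i * leftProd (R k) a * leftProd (R i) a = leftProd (R i) a * leftProd (R k) a * R k i := by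
  induction a with
  | nil => simp
  | cons l a ih =>
    rw [List.nodup_cons] at ha
    simp only [List.mem_cons, not_or] at hi hk
    have h1 : Commute (R k l) (leftProd (R i) a) := commute_leftProd fun m hm =>
      hRR _ _ _ _ hki (fun e => hk.2 (e ▸ hm)) (Ne.symm hi.1) (fun e => ha.1 (e ▸ hm))
    have h2 : Commute (R i l) (leftProd (R k) a) := commute_leftProd fun m hm =>
      hRR _ _ _ _ hki.symm (fun e => hi.2 (e ▸ hm)) (Ne.symm hk.1) (fun e => ha.1 (e ▸ hm))
    rw [leftProd_cons, leftProd_cons]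
    calc R k i * (leftProd (R k) a * R k l) * (leftProd (R i) a * R i l)
        = R k i * leftProd (R k) a * (R k l * leftProd (R i) a) * R i l := by
          simp only [mul_assoc]
      _ = (R k i * leftProd (R k) a * leftProd (R i) a) * R k l * R i l := by
          rw [h1.eq]; simp only [mul_assoc]
      _ = leftProd (R i) a * leftProd (R k) a * (R k i * R k l * R i l) := by
          rw [ih hi.2 hk.2 ha.2]; simp only [mul_assoc]
      _ = leftProd (R i) a * (leftProd (R k) a * R i l) * R k l * R k i := by
          rw [hYB k i l hki hk.1 hi.1]; simp only [mul_assoc]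
      _ = _ := by rw [← h2.eq]; simp only [mul_assoc]

theorem leftProd_mul_gridProd_exchange (k : ι) (a b : List ι) (hab : ∀ i ∈ a, i ∉ b)
    (hka : k ∉ a) (hkb : k ∉ b) (ha : a.Nodup) (hb : b.Nodup)
    (hRR : ∀ i j k l, i ≠ k → i ≠ l → j ≠ k → j ≠ l → Commute (R i j) (R k l))
    (hYB : ∀ i j k, i ≠ j → i ≠ k → j ≠ k →
      R i j * R i k * R j k = R j k * R i k * R i j) :
    leftProd (R k) a * leftProd (R k) b * gridProd R a b =
      gridProd R a b * leftProd (R k) b * leftProd (R k) a := by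
  induction a with
  | nil => simp
  | cons i a ih =>
    rw [List.nodup_cons] at ha
    simp only [List.mem_cons, not_or] at hka
    have hi : i ∉ b := hab i List.mem_cons_self
    have hab' : ∀ j ∈ a, j ∉ b := fun j hj => hab j (List.mem_cons_of_mem _ hj)
    have h1 : Commute (R k i) (gridProd R a b) := commute_gridProd fun j hj m hm =>
      hRR _ _ _ _ (fun e => hka.2 (e ▸ hj)) (fun e => hkb (e ▸ hm)) (fun e => ha.1 (e ▸ hj))
        (fun e => hi (e ▸ hm))
    have h2 : Commute (leftProd (R k) a) (leftProd (R i) b) := commute_leftProd fun m hm =>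
      (commute_leftProd fun j hj => hRR _ _ _ _ (Ne.symm hka.1) (fun e => ha.1 (e ▸ hj))
        (fun e => hkb (e ▸ hm)) (fun e => hab' j hj (e ▸ hm))).symm
    rw [gridProd_cons, leftProd_cons]
    calc leftProd (R k) a * R k i * leftProd (R k) b * (leftProd (R i) b * gridProd R a b)
        = leftProd (R k) a * (R k i * leftProd (R k) b * leftProd (R i) b) * gridProd R a b := by
          simp only [mul_assoc]
      _ = (leftProd (R k) a * leftProd (R i) b) * leftProd (R k) b *
            (R k i * gridProd R a b) := by
          rw [leftProd_mul_exchange k i b hi hkb hka.1 hb hRR hYB]; simp only [mul_assoc]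
      _ = leftProd (R i) b * (leftProd (R k) a * leftProd (R k) b * gridProd R a b) * R k i := by
          rw [h1.eq, h2.eq]; simp only [mul_assoc]
      _ = _ := by rw [ih hab' hka.2 ha.2]; simp only [mul_assoc]

/-- Fusion: three pairwise disjoint groups of labels behave like three single labels. Single labels
of `c` are treated by `leftProd_mul_gridProd_exchange` and moved past the remaining ones by
commutation at disjoint labels. -/
theorem gridProd_yangBaxter (c a b : List ι) (hab : ∀ i ∈ a, i ∉ b)
    (hca : ∀ k ∈ c, k ∉ a) (hcb : ∀ k ∈ c, k ∉ b) (ha : a.Nodup) (hb : b.Nodup) (hc : c.Nodup)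
    (hRR : ∀ i j k l, i ≠ k → i ≠ l → j ≠ k → j ≠ l → Commute (R i j) (R k l))
    (hYB : ∀ i j k, i ≠ j → i ≠ k → j ≠ k →
      R i j * R i k * R j k = R j k * R i k * R i j) :
    gridProd R c a * gridProd R c b * gridProd R a b =
      gridProd R a b * gridProd R c b * gridProd R c a := by
  induction c with
  | nil => simp
  | cons k c ih =>
    rw [List.nodup_cons] at hc
    have hca' : ∀ j ∈ c, j ∉ a := fun j hj => hca j (List.mem_cons_of_mem _ hj)
    have hcb' : ∀ j ∈ c, j ∉ b := fun j hj => hcb j (List.mem_cons_of_mem _ hj)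
    have hka := hca k List.mem_cons_self
    have hkb := hcb k List.mem_cons_self
    have h1 : Commute (leftProd (R k) b) (gridProd R c a) := commute_gridProd fun j hj m hm =>
      (commute_leftProd fun l hl => hRR j m k l (fun e => hc.1 (e ▸ hj))
        (fun e => hcb' j hj (e ▸ hl)) (fun e => hka (e ▸ hm)) (fun e => hab m hm (e ▸ hl))).symm
    have h2 : Commute (leftProd (R k) a) (gridProd R c b) := commute_gridProd fun j hj m hm =>
      (commute_leftProd fun l hl => hRR j m k l (fun e => hc.1 (e ▸ hj))
        (fun e => hca' j hj (e ▸ hl)) (fun e => hkb (e ▸ hm)) (fun e => hab l hl (e ▸ hm))).symm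
    simp only [gridProd_cons]
    calc leftProd (R k) a * gridProd R c a * (leftProd (R k) b * gridProd R c b) * gridProd R a b
        = leftProd (R k) a * (gridProd R c a * leftProd (R k) b) * gridProd R c b *
            gridProd R a b := by simp only [mul_assoc]
      _ = leftProd (R k) a * leftProd (R k) b *
            (gridProd R c a * gridProd R c b * gridProd R a b) := by
          rw [← h1.eq]; simp only [mul_assoc]
      _ = (leftProd (R k) a * leftProd (R k) b * gridProd R a b) * gridProd R c b *
            gridProd R c a := by
          rw [ih hca' hcb' hc.2]; simp only [mul_assoc]
      _ = gridProd R a b * leftProd (R k) b * (leftProd (R k) a * gridProd R c b) *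
            gridProd R c a := by
          rw [leftProd_mul_gridProd_exchange k a b hab hka hkb ha hb hRR hYB]
          simp only [mul_assoc]
      _ = _ := by rw [h2.eq]; simp only [mul_assoc]

end OrderedProducts

/-! ### Operators on vector-valued functions of colourings -/

section Operators

variable {K : Type*} [Field K] {M : Type*} [AddCommGroup M] [Module K M]
  {ι : Type*} [DecidableEq ι] {C : Type*}

variable (K M C) in
/-- Permutations of the tensor factors. -/
def permOp : Equiv.Perm ι →* Module.End K ((ι → C) → M) where
  toFun σ := LinearMap.funLeft K M fun α => α ∘ σ
  map_one' := rfl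
  map_mul' _ _ := rfl

@[simp] theorem permOp_apply (σ : Equiv.Perm ι) (f : (ι → C) → M) (α : ι → C) :
    permOp K M C σ f α = f (α ∘ σ) := rfl

variable (M C) in
/-- The operator `1 + c P_{ij}`. -/
def crossOp (c : K) (i j : ι) : Module.End K ((ι → C) → M) := 1 + c • permOp K M C (.swap i j)

@[simp] theorem crossOp_apply (c : K) (i j : ι) (f : (ι → C) → M) (α : ι → C) :
    crossOp M C c i j f α = f α + c • f (α ∘ Equiv.swap i j) := rfl

theorem crossOp_symm (c : K) (i j : ι) : crossOp M C c i j = crossOp M C c j i := by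
  rw [crossOp, Equiv.swap_comm, crossOp]

theorem crossOp_commute (c d : K) {i j k l : ι} (hik : i ≠ k) (hil : i ≠ l) (hjk : j ≠ k)
    (hjl : j ≠ l) : Commute (crossOp M C c i j) (crossOp M C d k l) := by
  have h : Commute (permOp K M C (.swap i j)) (permOp K M C (.swap k l)) := by
    refine Commute.map (Equiv.Perm.Disjoint.commute fun x => ?_) _
    by_cases hi : x = i
    · exact Or.inr (hi ▸ Equiv.swap_apply_of_ne_of_ne hik hil)
    by_cases hj : x = j
    · exact Or.inr (hj ▸ Equiv.swap_apply_of_ne_of_ne hjk hjl)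
    exact Or.inl (Equiv.swap_apply_of_ne_of_ne hi hj)
  exact (Commute.one_left _).add_left
    (((Commute.one_right _).add_right (h.smul_right d)).smul_left c)

/-- The hypothesis on the coefficients says that 1/b = 1/a + 1/c when they are nonzero, which is
additivity of the differences t_i - t_j. The two sides differ only in the terms quadratic in the
transpositions, and there by a multiple of `a * b + b * c - a * c`. -/
theorem crossOp_yangBaxter {a b c : K} (h : a * b + b * c = a * c) {i j k : ι} (hij : i ≠ j)
    (hik : i ≠ k) (hjk : j ≠ k) :
    crossOp M C a i j * crossOp M C b i k * crossOp M C c j k =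
      crossOp M C c j k * crossOp M C b i k * crossOp M C a i j := by
  simp only [crossOp]
  have e1 : Equiv.swap i j * Equiv.swap i k = Equiv.swap j k * Equiv.swap i j := by
    rw [Equiv.mul_swap_eq_swap_mul, Equiv.swap_apply_left,
      Equiv.swap_apply_of_ne_of_ne hik.symm hjk.symm]
  have e2 : Equiv.swap i k * Equiv.swap j k = Equiv.swap i j * Equiv.swap i k := by
    rw [Equiv.mul_swap_eq_swap_mul, Equiv.swap_apply_right,
      Equiv.swap_apply_of_ne_of_ne hij.symm hjk, Equiv.swap_comm j i]
  have s : ∀ x y : ι, Equiv.swap x y * Equiv.swap x y = 1 := Equiv.swap_mul_self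
  have e3 : Equiv.swap i k * Equiv.swap i j = Equiv.swap i j * Equiv.swap j k := by
    rw [← inv_inj]; simpa using e1
  have e4 : Equiv.swap j k * Equiv.swap i k = Equiv.swap i k * Equiv.swap i j := by
    rw [← inv_inj]; simpa using e2
  have s1 := Equiv.swap_mul_self i j
  have s2 := Equiv.swap_mul_self j k
  replace e1 := congrArg (permOp K M C) e1
  replace e2 := congrArg (permOp K M C) e2
  replace e3 := congrArg (permOp K M C) e3
  replace e4 := congrArg (permOp K M C) e4
  replace s1 := congrArg (permOp K M C) s1
  replace s2 := congrArg (permOp K M C) s2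
  simp only [map_mul, map_one] at e1 e2 e3 e4 s1 s2
  generalize permOp K M C (.swap i j) = S at *
  generalize permOp K M C (.swap i k) = U at *
  generalize permOp K M C (.swap j k) = W at *
  -- The cubic terms of both sides reduce to the same transposition.
  have t1 : S * U * W = U := by rw [mul_assoc, e2, ← mul_assoc, s1, one_mul]
  have t2 : W * U * S = U := by rw [mul_assoc, ← e4, ← mul_assoc, s2, one_mul]
  simp only [add_mul, mul_add, one_mul, mul_one, smul_mul_assoc, mul_smul_comm, smul_smul,
    smul_add, t1, t2]
  rw [e2, e4, ← e1, e3]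
  linear_combination (norm := module) h • (S * U - S * W)

theorem update_comp_swap_left (α : ι → C) (i j : ι) (b : C) :
    Function.update (α ∘ Equiv.swap i j) i b = Function.update α j b ∘ Equiv.swap i j := by
  ext x
  by_cases hx : x = i
  · subst hx; simp
  · have : Equiv.swap i j x ≠ j := by
      rw [Ne, Equiv.swap_apply_eq_iff]; simpa using hx
    simp [hx, this]

variable [Fintype C]

/-- The operator acting by a matrix `τ` with entries in `End M` in the tensor factor `i`. -/
def siteOp (i : ι) (τ : C → C → Module.End K M) : Module.End K ((ι → C) → M) where
  toFun f α := ∑ b, τ (α i) b (f (Function.update α i b))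
  map_add' f g := by ext α; simp [Finset.sum_add_distrib]
  map_smul' c f := by ext α; simp [Finset.smul_sum]

@[simp] theorem siteOp_apply (i : ι) (τ : C → C → Module.End K M) (f : (ι → C) → M) (α : ι → C) :
    siteOp i τ f α = ∑ b, τ (α i) b (f (Function.update α i b)) := rfl

theorem siteOp_add (i : ι) (τ τ' : C → C → Module.End K M) :
    siteOp i (fun a b => τ a b + τ' a b) = siteOp i τ + siteOp i τ' := by
  ext f α
  simp [Finset.sum_add_distrib]

theorem siteOp_smul (i : ι) (c : K) (τ : C → C → Module.End K M) :
    siteOp i (fun a b => c • τ a b) = c • siteOp i τ := by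
  ext f α
  simp [Finset.smul_sum]

theorem siteOp_one [DecidableEq C] (i : ι) :
    siteOp i (fun a b : C => if a = b then (1 : Module.End K M) else 0) = 1 := by
  ext f α
  simp only [siteOp_apply, Module.End.one_apply]
  rw [Finset.sum_eq_single (α i)]
  · simp
  · intro b _ hb
    simp [hb.symm]
  · simp

theorem permOp_mul_siteOp (i j : ι) (τ : C → C → Module.End K M) :
    permOp K M C (.swap i j) * siteOp i τ = siteOp j τ * permOp K M C (.swap i j) := by
  ext f α
  simp [update_comp_swap_left]

theorem siteOp_commute_permOp {i j k : ι} (hij : i ≠ j) (hik : i ≠ k)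
    (τ : C → C → Module.End K M) :
    Commute (siteOp i τ) (permOp K M C (.swap j k)) := by
  ext f α
  simp only [Module.End.mul_apply, siteOp_apply, permOp_apply, Function.comp_apply,
    Equiv.swap_apply_of_ne_of_ne hij hik]
  refine Finset.sum_congr rfl fun b _ => ?_
  congr 2
  ext x
  by_cases hx : x = i
  · subst hx; simp [Equiv.swap_apply_of_ne_of_ne hij hik]
  · have : Equiv.swap j k x ≠ i := by
      rw [Ne, Equiv.swap_apply_eq_iff, Equiv.swap_apply_of_ne_of_ne hij hik]; exact hx
    simp [hx, this]

theorem siteOp_commute_crossOp {i j k : ι} (hij : i ≠ j) (hik : i ≠ k)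
    (τ : C → C → Module.End K M) (c : K) :
    Commute (siteOp i τ) (crossOp M C c j k) :=
  (Commute.one_right _).add_right ((siteOp_commute_permOp hij hik τ).smul_right c)

/-- The commutation relations of `gl` for a family of operators `e a b`. -/
def IsGlFamily [DecidableEq C] (e : C → C → Module.End K M) : Prop :=
  ∀ a b c d, e a b * e c d - e c d * e a b =
    (if b = c then e a d else 0) - (if d = a then e c b else 0)

/-- The matrix `δ_{ab} + d e_{ba}`. -/
def lMat [DecidableEq C] (e : C → C → Module.End K M) (d : K) (a b : C) : Module.End K M :=
  (if a = b then 1 else 0) + d • e b a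

theorem siteOp_lMat [DecidableEq C] (e : C → C → Module.End K M) (d : K) (i : ι) :
    siteOp i (lMat e d) = 1 + d • siteOp i fun a b => e b a := by
  rw [← siteOp_one i, ← siteOp_smul, ← siteOp_add]
  rfl

/-- The two Kronecker deltas in the gl relation force a colour at one label to equal a colour at the
other; this is the effect of exchanging the two tensor factors. -/
theorem siteOp_commutator [DecidableEq C] {e : C → C → Module.End K M} (he : IsGlFamily e)
    {i j : ι} (hij : i ≠ j) :
    siteOp j (fun a b => e b a) * siteOp i (fun a b => e b a) -
        siteOp i (fun a b => e b a) * siteOp j (fun a b => e b a) =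
      permOp K M C (.swap i j) *
        (siteOp j (fun a b => e b a) - siteOp i (fun a b => e b a)) := by
  ext f α
  simp only [LinearMap.sub_apply, Module.End.mul_apply, siteOp_apply, permOp_apply,
    Function.comp_apply, Equiv.swap_apply_left, Equiv.swap_apply_right, Pi.sub_apply, map_sum,
    Function.update_of_ne hij, Function.update_of_ne hij.symm]
  rw [Finset.sum_comm (f := fun b c => e b (α i) _), ← Finset.sum_sub_distrib]
  have h : ∀ b c, (e b (α j)) ((e c (α i)) (f (Function.update (Function.update α j b) i c))) -
      (e c (α i)) ((e b (α j)) (f (Function.update (Function.update α i c) j b))) =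
      (if α j = c then e b (α i) (f (Function.update (Function.update α j b) i c)) else 0) -
      (if α i = b then e c (α j) (f (Function.update (Function.update α j b) i c)) else 0) := by
    intro b c
    rw [Function.update_comm hij]
    have := LinearMap.congr_fun (he b (α j) c (α i))
      (f (Function.update (Function.update α j b) i c))
    simp only [LinearMap.sub_apply, Module.End.mul_apply] at this
    rw [this]
    split_ifs <;> simp
  have u1 : ∀ b, Function.update (Function.update α j b) i (α j) =
      Function.update (α ∘ Equiv.swap i j) j b := by
    intro b
    rw [Equiv.swap_comm, update_comp_swap_left]
    ext x
    by_cases hx : x = i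
    · subst hx; simp [hij.symm]
    by_cases hx' : x = j
    · subst hx'; simp [hij.symm]
    · simp [hx, hx', Equiv.swap_apply_of_ne_of_ne]
  have u2 : ∀ b, Function.update (Function.update α j (α i)) i b =
      Function.update (α ∘ Equiv.swap i j) i b := by
    intro b
    rw [update_comp_swap_left]
    ext x
    by_cases hx : x = i
    · subst hx; simp
    by_cases hx' : x = j
    · subst hx'; simp [hij, hij.symm]
    · simp [hx, hx', Equiv.swap_apply_of_ne_of_ne]
  simp only [← Finset.sum_sub_distrib, h]
  simp only [Finset.sum_sub_distrib]
  congr 1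
  · simp [u1]
  · rw [Finset.sum_comm]
    simp [u2]

/-- With A, B the operators at i, j and P the flip, PA = BP makes the terms containing all three
agree. What is left is di·dj·[B, A] = di·dj·P(B - A) against c(dj - di)P(A - B), and these cancel by
`h`. For d = 1/(t - x) and c = 1/(t_i - t_j) the hypothesis `h` holds. -/
theorem siteOp_rtt [DecidableEq C] {e : C → C → Module.End K M} (he : IsGlFamily e) {i j : ι}
    (hij : i ≠ j) {di dj c : K} (h : c * (dj - di) = di * dj) :
    siteOp j (lMat e dj) * siteOp i (lMat e di) * crossOp M C c i j =
      crossOp M C c i j * siteOp i (lMat e di) * siteOp j (lMat e dj) := by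
  have h1 := siteOp_commutator (M := M) he hij
  have h2 := permOp_mul_siteOp (M := M) i j (fun a b => e b a)
  have h3 := permOp_mul_siteOp (M := M) j i (fun a b => e b a)
  rw [Equiv.swap_comm j i] at h3
  simp only [siteOp_lMat, crossOp]
  generalize siteOp i (fun a b => e b a) = A at *
  generalize siteOp j (fun a b => e b a) = B at *
  generalize permOp K M C (.swap i j) = P at *
  have h4 : B * A * P = P * A * B := by rw [h2, mul_assoc, mul_assoc, h3]
  simp only [add_mul, mul_add, one_mul, mul_one, smul_mul_assoc, mul_smul_comm, smul_smul,
    smul_add, h4]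
  rw [← h2, ← h3]
  rw [mul_sub] at h1
  linear_combination (norm := module) (di * dj) • h1 + h • (P * A - P * B)

end Operators

/-! ### Rational identities -/

section Rational

variable {K : Type*} [Field K] {ι : Type*} [DecidableEq ι] (t : ι → K)

/-- `∏_{j ∈ S} (1 - 1 / (t_b - t_j))`. -/
def cross (b : ι) (S : Finset ι) : K := ∏ j ∈ S, (1 - 1 / (t b - t j))

theorem cross_insert (b : ι) {s : ι} {S : Finset ι} (hs : s ∉ S) :
    cross t b (insert s S) = (1 - 1 / (t b - t s)) * cross t b S :=
  Finset.prod_insert hs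

theorem sum_insert_erase {A : Type*} [AddCommMonoid A] (F : ι → Finset ι → A) {a : ι}
    {S : Finset ι} (ha : a ∉ S) :
    ∑ b ∈ insert a S, F b ((insert a S).erase b) = F a S + ∑ b ∈ S, F b (insert a (S.erase b)) := by
  rw [Finset.sum_insert ha, Finset.erase_insert ha]
  congr 1
  refine Finset.sum_congr rfl fun b hb => ?_
  rw [Finset.erase_insert_of_ne]
  rintro rfl
  exact ha hb

variable {t}

/-- This is the partial fraction expansion of `cross t a S` as a function of t_a: it tends to 1 at
infinity and has simple poles at t_b with residue `-cross t b (S.erase b)`. -/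
theorem sum_cross_div (ht : Function.Injective t) {a : ι} {S : Finset ι} (ha : a ∉ S) :
    ∑ b ∈ S, cross t b (S.erase b) / (t b - t a) = cross t a S - 1 := by
  induction S using Finset.induction_on generalizing a with
  | empty => simp [cross]
  | insert s S hs ih =>
    simp only [Finset.mem_insert, not_or] at ha
    have hne : ∀ {x y : ι}, x ≠ y → t x - t y ≠ 0 := fun h => sub_ne_zero.2 (ht.ne h)
    rw [sum_insert_erase (fun b S => cross t b S / (t b - t a)) hs, cross_insert t a hs]
    have h : ∀ b ∈ S, cross t b (insert s (S.erase b)) / (t b - t a) =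
        cross t b (S.erase b) / (t b - t a) - (cross t b (S.erase b) / (t b - t s) -
          cross t b (S.erase b) / (t b - t a)) / (t s - t a) := by
      intro b hb
      have hbs : b ≠ s := fun e => hs (e ▸ hb)
      have hba : b ≠ a := fun e => ha.2 (e ▸ hb)
      rw [cross_insert t b fun h => hs (Finset.mem_of_mem_erase h)]
      have h1 := hne hbs
      have h2 := hne hba
      have h3 := hne (Ne.symm ha.1)
      field_simp
      ring
    rw [Finset.sum_congr rfl h, Finset.sum_sub_distrib, ← Finset.sum_div, Finset.sum_sub_distrib,
      ih ha.2, ih hs]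
    have h3 := hne (Ne.symm ha.1)
    have h4 := hne ha.1
    field_simp
    ring

/-- The coefficient of 1/t_a at infinity in the expansion of `sum_cross_div`. The same identity
later evaluates the symmetrization of the constant 1. -/
theorem sum_cross (ht : Function.Injective t) (S : Finset ι) :
    ∑ b ∈ S, cross t b (S.erase b) = S.card := by
  induction S using Finset.induction_on with
  | empty => simp
  | insert s S hs ih =>
    rw [sum_insert_erase (fun b S => cross t b S) hs, Finset.card_insert_of_notMem hs]
    have h : ∀ b ∈ S, cross t b (insert s (S.erase b)) =
        cross t b (S.erase b) - cross t b (S.erase b) / (t b - t s) := by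
      intro b hb
      rw [cross_insert t b fun h => hs (Finset.mem_of_mem_erase h)]
      ring
    rw [Finset.sum_congr rfl h, Finset.sum_sub_distrib, ih, sum_cross_div ht hs]
    push_cast
    ring

variable (t) in
/-- The right-hand side of the action of the diagonal entry of the monodromy matrix. -/
def diagAct (a : ι → K) (Γ : Finset ι → K) (l : ι) (S : Finset ι) : K :=
  a l * cross t l S * Γ S -
    ∑ b ∈ S, a b / (t b - t l) * cross t b (S.erase b) * Γ (insert l (S.erase b))

variable (t) in
/-- The sum over the variable attached to a site at `z`. -/
def attach (z : K) (a : ι → K) (Γ : Finset ι → K) (S : Finset ι) : K :=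
  ∑ b ∈ S, a b / (t b - z) * cross t b (S.erase b) * Γ (S.erase b)

/-- Base of the Bethe ansatz induction: without sites, the wanted and unwanted terms must add up to
the eigenvalue in `IsBase`, which drops by 1 for each application of the creation entry. -/
theorem diagAct_one (ht : Function.Injective t) (y : K) {l : ι} {S : Finset ι} (hl : l ∉ S) :
    diagAct t (fun b => t b - y) (fun _ => 1) l S = t l - y - S.card := by
  have h : ∀ b ∈ S, (t b - y) / (t b - t l) * cross t b (S.erase b) * 1 =
      cross t b (S.erase b) + (t l - y) * (cross t b (S.erase b) / (t b - t l)) := by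
    intro b hb
    have : t b - t l ≠ 0 := sub_ne_zero.2 (ht.ne fun e => hl (e ▸ hb))
    field_simp
    ring
  rw [diagAct, Finset.sum_congr rfl h, Finset.sum_add_distrib, ← Finset.mul_sum,
    sum_cross_div ht hl, sum_cross ht]
  ring

/-- Creation entry at an excited site. The term b = l matches the wanted term of `diagAct`; for b in
S one splits 1/((t_b - z)(t_b - t_l)) into partial fractions in t_b. -/
theorem attach_insert (ht : Function.Injective t) {z : K} (a : ι → K) (Γ : Finset ι → K)
    {l : ι} {S : Finset ι} (hl : l ∉ S) (hzl : t l ≠ z) (hzS : ∀ b ∈ S, t b ≠ z) :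
    attach t z a Γ (insert l S) =
      (1 + 1 / (t l - z)) *
          ∑ b ∈ S, a b / (t b - z) * cross t b (S.erase b) * Γ (insert l (S.erase b)) +
        1 / (t l - z) * diagAct t a Γ l S := by
  rw [attach, sum_insert_erase (fun b S => a b / (t b - z) * cross t b S * Γ S) hl, diagAct,
    mul_sub, Finset.mul_sum, Finset.mul_sum, add_sub_left_comm, ← Finset.sum_sub_distrib]
  congr 1
  · ring
  refine Finset.sum_congr rfl fun b hb => ?_
  have h1 : t b - t l ≠ 0 := sub_ne_zero.2 (ht.ne fun e => hl (e ▸ hb))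
  have h2 := sub_ne_zero.2 hzl
  have h3 := sub_ne_zero.2 (hzS b hb)
  rw [cross_insert t b fun h => hl (Finset.mem_of_mem_erase h)]
  field_simp
  ring

/-- Diagonal entry at an unexcited site: the term in which the site passes its excitation to the
auxiliary label is exactly what multiplies each eigenvalue by 1 + 1/(t_b - z). -/
theorem diagAct_step (ht : Function.Injective t) {z : K} (a : ι → K) (Γ : Finset ι → K)
    {l : ι} {S : Finset ι} (hl : l ∉ S) (hzl : t l ≠ z) (hzS : ∀ b ∈ S, t b ≠ z) :
    (1 + 1 / (t l - z)) * diagAct t a Γ l S +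
        1 / (t l - z) *
          ∑ b ∈ S, a b / (t b - z) * cross t b (S.erase b) * Γ (insert l (S.erase b)) =
      diagAct t (fun b => a b * (1 + 1 / (t b - z))) Γ l S := by
  simp only [diagAct]
  rw [mul_sub, Finset.mul_sum, Finset.mul_sum, sub_add, ← Finset.sum_sub_distrib]
  congr 1
  · ring
  refine Finset.sum_congr rfl fun b hb => ?_
  have h1 : t b - t l ≠ 0 := sub_ne_zero.2 (ht.ne fun e => hl (e ▸ hb))
  have h2 := sub_ne_zero.2 hzl
  have h3 := sub_ne_zero.2 (hzS b hb)
  field_simp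
  ring

/-- Sums over ordered pairs of distinct elements see only the symmetric part of the summand. -/
theorem sum_erase_symm [CharZero K] {S : Finset ι} {f g : ι → ι → K}
    (h : ∀ b ∈ S, ∀ c ∈ S, b ≠ c → f b c + f c b = g b c + g c b) :
    ∑ b ∈ S, ∑ c ∈ S.erase b, f b c = ∑ b ∈ S, ∑ c ∈ S.erase b, g b c := by
  have key : ∀ f : ι → ι → K, ∑ b ∈ S, ∑ c ∈ S.erase b, f c b =
      ∑ b ∈ S, ∑ c ∈ S.erase b, f b c := by
    intro f
    refine Finset.sum_comm' fun x y => ?_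
    simp only [Finset.mem_erase]
    tauto
  have h2 : (∑ b ∈ S, ∑ c ∈ S.erase b, f b c) + ∑ b ∈ S, ∑ c ∈ S.erase b, f c b =
      (∑ b ∈ S, ∑ c ∈ S.erase b, g b c) + ∑ b ∈ S, ∑ c ∈ S.erase b, g c b := by
    simp only [← Finset.sum_add_distrib]
    refine Finset.sum_congr rfl fun b hb => Finset.sum_congr rfl fun c hc => ?_
    rw [Finset.mem_erase] at hc
    exact h b hb c hc.2 hc.1.symm
  rw [key f, key g] at h2
  linear_combination h2 / 2

/-- Diagonal entry at an excited site: attaching a variable intertwines the diagonal actions before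
and after the site. Since Γ is arbitrary, the coefficients of `Γ (S.erase b)` and of `Γ (insert l
((S.erase b).erase c))` are compared separately. -/
theorem attach_diagAct [CharZero K] (ht : Function.Injective t) {z : K} (a : ι → K)
    (Γ : Finset ι → K) {l : ι} {S : Finset ι} (hl : l ∉ S) (hzl : t l ≠ z)
    (hzS : ∀ b ∈ S, t b ≠ z) :
    ∑ b ∈ S, a b / (t b - z) * cross t b (S.erase b) * diagAct t a Γ l (S.erase b) =
      diagAct t (fun b => a b * (1 + 1 / (t b - z))) (attach t z a Γ) l S := by
  have h1 : ∀ b ∈ S, a b / (t b - z) * cross t b (S.erase b) * diagAct t a Γ l (S.erase b) =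
      a b / (t b - z) * cross t b (S.erase b) * (a l * cross t l (S.erase b) * Γ (S.erase b)) -
      ∑ c ∈ S.erase b, a b / (t b - z) * cross t b (S.erase b) *
        (a c / (t c - t l) * cross t c ((S.erase b).erase c) *
          Γ (insert l ((S.erase b).erase c))) := by
    intro b _
    rw [diagAct, mul_sub, Finset.mul_sum]
  have h2 : ∀ b ∈ S, a b * (1 + 1 / (t b - z)) / (t b - t l) * cross t b (S.erase b) *
        attach t z a Γ (insert l (S.erase b)) =
      a b * (1 + 1 / (t b - z)) / (t b - t l) * cross t b (S.erase b) *
        (a l / (t l - z) * cross t l (S.erase b) * Γ (S.erase b)) +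
      ∑ c ∈ S.erase b, a b * (1 + 1 / (t b - z)) / (t b - t l) * cross t b (S.erase b) *
        (a c / (t c - z) * cross t c (insert l ((S.erase b).erase c)) *
          Γ (insert l ((S.erase b).erase c))) := by
    intro b _
    rw [attach, sum_insert_erase (fun b S => a b / (t b - z) * cross t b S * Γ S)
      fun h => hl (Finset.mem_of_mem_erase h), mul_add, Finset.mul_sum]
  have hne : ∀ {x y : ι}, x ≠ y → t x - t y ≠ 0 := fun h => sub_ne_zero.2 (ht.ne h)
  have cr : ∀ (x : ι) {b : ι}, b ∈ S → cross t x S =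
      (1 - 1 / (t x - t b)) * cross t x (S.erase b) := by
    intro x b hb
    rw [← cross_insert t x (Finset.notMem_erase b S), Finset.insert_erase hb]
  rw [Finset.sum_congr rfl h1, diagAct, Finset.sum_congr rfl h2, Finset.sum_sub_distrib,
    Finset.sum_add_distrib, ← sub_sub]
  congr 1
  · rw [attach, Finset.mul_sum, ← Finset.sum_sub_distrib]
    refine Finset.sum_congr rfl fun b hb => ?_
    have hbl : b ≠ l := fun e => hl (e ▸ hb)
    have n1 := hne hbl
    have n2 := hne hbl.symm
    have n3 := sub_ne_zero.2 hzl
    have n4 := sub_ne_zero.2 (hzS b hb)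
    rw [cr l hb]
    field_simp
    ring
  -- Γ depends on the set from which both b and c are removed, so the two summands agree only after
  -- symmetrization in b and c.
  · refine sum_erase_symm fun b hb c hc hbc => ?_
    have hbl : b ≠ l := fun e => hl (e ▸ hb)
    have hcl : c ≠ l := fun e => hl (e ▸ hc)
    have n1 := hne hbl
    have n2 := hne hcl
    have n3 := sub_ne_zero.2 hzl
    have n4 := sub_ne_zero.2 (hzS b hb)
    have n5 := sub_ne_zero.2 (hzS c hc)
    have n6 := hne hbc
    have n7 := hne hbc.symm
    have hlx : ∀ {x y}, l ∉ (S.erase x).erase y := fun h =>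
      hl (Finset.mem_of_mem_erase (Finset.mem_of_mem_erase h))
    have cb : cross t b (S.erase b) = (1 - 1 / (t b - t c)) * cross t b ((S.erase b).erase c) := by
      rw [← cross_insert t b (Finset.notMem_erase c _), Finset.insert_erase]
      exact Finset.mem_erase.2 ⟨hbc.symm, hc⟩
    have cc : cross t c (S.erase c) = (1 - 1 / (t c - t b)) * cross t c ((S.erase b).erase c) := by
      rw [Finset.erase_right_comm, ← cross_insert t c (Finset.notMem_erase b _),
        Finset.insert_erase]
      exact Finset.mem_erase.2 ⟨hbc, hb⟩
    rw [Finset.erase_right_comm (a := c) (b := b), cross_insert t c hlx, cross_insert t b hlx, cb, cc]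
    field_simp
    ring

end Rational

/-! ### The action of products of monodromy matrices on a reference state -/

section Monodromy

variable {K : Type*} [Field K] {ι : Type*} [DecidableEq ι] {C : Type*} [DecidableEq C]

/-- The eigenvalue of the diagonal entry of the monodromy matrix with sites `s`. -/
def diagEigen (t : ι → K) (y : K) (s : List ι) (b : ι) : K :=
  (t b - y) * (s.map fun m => 1 + 1 / (t b - t m)).prod

/-- The coefficients of the off-shell Bethe vector with variables `t_b`, `b ∈ S`, and sites `s`,
of which those with colour `q` are excited, while the others have colour `p`. -/
def bethe (t : ι → K) (y : K) (p q : C) : List ι → (ι → C) → Finset ι → K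
  | [], _, _ => 1
  | i :: s, α, S =>
    if α i = q then attach t (t i) (diagEigen t y s) (bethe t y p q s α) S
    else if α i = p then bethe t y p q s α S else 0

/-- The number of excited sites. -/
def excited (q : C) (s : List ι) (α : ι → C) : ℕ := s.countP fun i => α i = q

theorem bethe_congr (t : ι → K) (y : K) (p q : C) {s : List ι} {α β : ι → C}
    (h : ∀ i ∈ s, α i = β i) : bethe t y p q s α = bethe t y p q s β := by
  induction s with
  | nil => rfl
  | cons i s ih =>
    have := ih fun j hj => h j (List.mem_cons_of_mem _ hj)
    funext S
    simp only [bethe, h i List.mem_cons_self, this]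

theorem excited_congr (q : C) {s : List ι} {α β : ι → C} (h : ∀ i ∈ s, α i = β i) :
    excited q s α = excited q s β :=
  List.countP_congr fun i hi => by rw [h i hi]

theorem bethe_empty (t : ι → K) (y : K) {p q : C} (hpq : p ≠ q) (s : List ι) (α : ι → C) :
    bethe t y p q s α ∅ = if ∀ i ∈ s, α i = p then 1 else 0 := by
  induction s with
  | nil => simp [bethe]
  | cons i s ih =>
    simp only [bethe, attach, Finset.sum_empty, ih, List.forall_mem_cons]
    by_cases h1 : α i = p
    · simp [h1, hpq]
    · simp [h1]

theorem excited_cons (q : C) (i : ι) (s : List ι) (α : ι → C) :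
    excited q (i :: s) α = excited q s α + if α i = q then 1 else 0 := by
  simp [excited, List.countP_cons]

theorem diagEigen_cons (t : ι → K) (y : K) (i : ι) (s : List ι) (b : ι) :
    diagEigen t y (i :: s) b = diagEigen t y s b * (1 + 1 / (t b - t i)) := by
  simp only [diagEigen, List.map_cons, List.prod_cons]
  ring

variable {M : Type*} [AddCommGroup M] [Module K M]

/-- The operator `O` does not depend on and does not change the colours of the labels outside
`A`. -/
def ActsOn (O : Module.End K ((ι → C) → M)) (A : ι → Prop) : Prop :=
  ∀ f f' α, (∀ β, (∀ x, ¬A x → β x = α x) → f β = f' β) → O f α = O f' α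

theorem ActsOn.mul {O O' : Module.End K ((ι → C) → M)} {A : ι → Prop} (h : ActsOn O A)
    (h' : ActsOn O' A) : ActsOn (O * O') A := by
  intro f f' α hf
  refine h _ _ α fun β hβ => h' _ _ β fun γ hγ => hf γ fun x hx => ?_
  rw [hγ x hx, hβ x hx]

theorem ActsOn.one (A : ι → Prop) : ActsOn (1 : Module.End K ((ι → C) → M)) A :=
  fun _ _ α hf => hf α fun _ _ => rfl

theorem ActsOn.mono {O : Module.End K ((ι → C) → M)} {A B : ι → Prop} (h : ActsOn O A)
    (hAB : ∀ x, A x → B x) : ActsOn O B :=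
  fun f f' α hf => h f f' α fun β hβ => hf β fun x hx => hβ x fun hA => hx (hAB x hA)

theorem ActsOn.listProd {A : ι → Prop} {a : List (Module.End K ((ι → C) → M))}
    (h : ∀ O ∈ a, ActsOn O A) : ActsOn a.prod A := by
  induction a with
  | nil => exact ActsOn.one A
  | cons O a ih =>
    rw [List.prod_cons]
    exact (h O List.mem_cons_self).mul (ih fun O hO => h O (List.mem_cons_of_mem _ hO))

theorem crossOp_actsOn (c : K) {i j : ι} {A : ι → Prop} (hi : A i) (hj : A j) :
    ActsOn (crossOp M C c i j) A := by
  intro f f' α hf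
  rw [crossOp_apply, crossOp_apply, hf α fun _ _ => rfl, hf (α ∘ Equiv.swap i j)]
  intro x hx
  rw [Function.comp_apply, Equiv.swap_apply_of_ne_of_ne (fun h => hx (by rwa [h]))
    fun h => hx (by rwa [h])]

theorem siteOp_actsOn [Fintype C] {i : ι} (τ : C → C → Module.End K M) {A : ι → Prop} (hi : A i) :
    ActsOn (siteOp i τ) A := by
  intro f f' α hf
  simp only [siteOp_apply]
  refine Finset.sum_congr rfl fun b _ => ?_
  rw [hf (Function.update α i b)]
  intro x hx
  rw [Function.update_of_ne]
  rintro rfl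
  exact hx hi

theorem leftProd_crossOp_actsOn (c : ι → K) {l : ι} {s : List ι} {A : ι → Prop} (hl : A l)
    (hs : ∀ i ∈ s, A i) : ActsOn (leftProd (fun i => crossOp M C (c i) l i) s) A := by
  refine ActsOn.listProd fun O hO => ?_
  obtain ⟨i, hi, rfl⟩ := List.mem_map.1 hO
  exact crossOp_actsOn _ hl (hs i (List.mem_reverse.1 hi))

/-- The state with colour `c` at the label `l` and a Bethe vector at the sites `s`. -/
def auxState (t : ι → K) (y : K) (p q : C) (w : ℕ → M) (ref : ι → C) (D : List ι) (l : ι) (c : C)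
    (s : List ι) (S : Finset ι) : (ι → C) → M := fun β =>
  if β l = c ∧ ∀ x ∈ D, β x = ref x then
    bethe t y p q s β S • w (S.card - excited q s β) else 0

/-- The entries of the base operator `O` in the auxiliary factor `l`, in the presence of inert
labels `D` with the colours `ref`, are `d (t_l - y - m)` and the raising operator `d`. -/
structure IsBase (t : ι → K) (y : K) (p q : C) (w : ℕ → M) (ref : ι → C) (D : List ι) (l : ι)
    (d : K) (O : Module.End K ((ι → C) → M)) : Prop where
  actsOn : ActsOn O fun x => x = l ∨ x ∈ D
  diag : ∀ m α, α l = p → O (fun β => if β l = p ∧ ∀ x ∈ D, β x = ref x then w m else 0) α =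
    if ∀ x ∈ D, α x = ref x then (d * (t l - y - m)) • w m else 0
  raise : ∀ m α, α l = p → O (fun β => if β l = q ∧ ∀ x ∈ D, β x = ref x then w m else 0) α =
    if ∀ x ∈ D, α x = ref x then d • w (m + 1) else 0

variable (M C) in
/-- `∏←_{i ∈ s} R_{l i}(t_l - t_i)`. -/
def rho (t : ι → K) (l : ι) (s : List ι) : Module.End K ((ι → C) → M) :=
  leftProd (fun i => crossOp M C (1 / (t l - t i)) l i) s

variable {t : ι → K} {y : K} {p q : C} {w : ℕ → M} {ref : ι → C} {D : List ι} {l : ι} {d : K}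
  {O : Module.End K ((ι → C) → M)}

theorem auxState_cons_of_p (hpq : p ≠ q) {i : ι} {s : List ι} {S : Finset ι} {c : C} {β : ι → C}
    (hβ : β i = p) :
    auxState t y p q w ref D l c (i :: s) S β = auxState t y p q w ref D l c s S β := by
  simp [auxState, bethe, excited_cons, hβ, hpq]

theorem auxState_cons_of_q {i : ι} {s : List ι} {S : Finset ι} {c : C} {β : ι → C}
    (hβ : β i = q) :
    auxState t y p q w ref D l c (i :: s) S β =
      ∑ b ∈ S, (diagEigen t y s b / (t b - t i) * cross t b (S.erase b)) •
        auxState t y p q w ref D l c s (S.erase b) β := by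
  simp only [auxState]
  split_ifs with h
  · simp only [bethe, excited_cons, hβ, if_true, attach, Finset.sum_smul, smul_smul]
    refine Finset.sum_congr rfl fun b hb => ?_
    rw [Finset.card_erase_of_mem hb]
    congr 2
    omega
  · simp

theorem auxState_cons_of_ne {i : ι} {s : List ι} {S : Finset ι} {c : C} {β : ι → C}
    (hp : β i ≠ p) (hq : β i ≠ q) : auxState t y p q w ref D l c (i :: s) S β = 0 := by
  simp [auxState, bethe, hp, hq]

theorem auxState_of_ne {s : List ι} {S : Finset ι} {c : C} {β : ι → C}
    (h : β l ≠ c) : auxState t y p q w ref D l c s S β = 0 := by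
  simp [auxState, h]

theorem auxState_congr {s : List ι} {S : Finset ι} {c c' : C} {β β' : ι → C}
    (hs : ∀ i ∈ s, β i = β' i) (hD : ∀ x ∈ D, β x = β' x) (hc : β l = c ↔ β' l = c') :
    auxState t y p q w ref D l c s S β = auxState t y p q w ref D l c' s S β' := by
  have : (∀ x ∈ D, β x = ref x) ↔ ∀ x ∈ D, β' x = ref x :=
    forall₂_congr fun x hx => by rw [hD x hx]
  simp only [auxState, hc, this, bethe_congr t y p q hs, excited_congr q hs]

theorem auxState_nil {S : Finset ι} {c : C} :
    auxState t y p q w ref D l c [] S =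
      fun β => if β l = c ∧ ∀ x ∈ D, β x = ref x then w S.card else 0 := by
  funext β
  simp [auxState, bethe, excited]

theorem IsBase.actsOn_rho (hO : IsBase t y p q w ref D l d O) (s : List ι) :
    ActsOn (O * rho C M t l s) fun x => x = l ∨ x ∈ D ∨ x ∈ s :=
  (hO.actsOn.mono fun x hx => by tauto).mul
    (leftProd_crossOp_actsOn _ (Or.inl rfl) fun _ hi => Or.inr (Or.inr hi))

/-- The algebraic Bethe ansatz, by induction on the sites. The R-matrix of the new site mixes the
colours p and q at the auxiliary label, so the creation entry and the diagonal entry have to be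
computed together. `w` counts the excitations absorbed by the base module, namely those not sitting
on sites. Its truncated argument is harmless, since `bethe` vanishes when there are fewer variables
than excited sites. -/
theorem IsBase.monodromy [CharZero K] (hO : IsBase t y p q w ref D l d O)
    (ht : Function.Injective t) (hpq : p ≠ q) (hlD : l ∉ D) {s : List ι} (hs : s.Nodup)
    (hls : l ∉ s) (hsD : ∀ i ∈ s, i ∉ D) {S : Finset ι} (hlS : l ∉ S) (hsS : ∀ i ∈ s, i ∉ S)
    {α : ι → C} (hα : α l = p) :
    (O * rho C M t l s) (auxState t y p q w ref D l q s S) α =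
        (if ∀ x ∈ D, α x = ref x then
          (d * bethe t y p q s α (insert l S)) • w (S.card + 1 - excited q s α) else 0) ∧
      (O * rho C M t l s) (auxState t y p q w ref D l p s S) α =
        (if ∀ x ∈ D, α x = ref x then
          (d * diagAct t (diagEigen t y s) (bethe t y p q s α) l S) •
            w (S.card - excited q s α) else 0) := by
  induction s generalizing S with
  | nil =>
    have h1 : diagEigen t y [] = fun b => t b - y := by funext; simp [diagEigen]
    have h2 : bethe t y p q [] α = fun _ => 1 := rfl
    have h3 : excited q [] α = 0 := rfl
    simp only [rho, leftProd_nil, mul_one, auxState_nil, h1, h2, h3, diagAct_one ht y hlS,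
      hO.diag _ α hα, hO.raise _ α hα, Nat.sub_zero, and_self]
  | cons i s ih =>
    rw [List.nodup_cons] at hs
    simp only [List.mem_cons, not_or] at hls
    have his : ∀ j ∈ s, j ≠ i := fun j hj e => hs.1 (e ▸ hj)
    have hjl : ∀ j ∈ s, j ≠ l := fun j hj e => hls.2 (e ▸ hj)
    have hDi : ∀ x ∈ D, x ≠ i := fun x hx e => hsD i List.mem_cons_self (e ▸ hx)
    have hDl : ∀ x ∈ D, x ≠ l := fun x hx e => hlD (e ▸ hx)
    have hiS : i ∉ S := hsS i List.mem_cons_self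
    replace ih := fun {S : Finset ι} (h1 : l ∉ S) (h2 : ∀ i ∈ s, i ∉ S) =>
      ih hs.2 hls.2 (fun j hj => hsD j (List.mem_cons_of_mem _ hj)) h1 h2
    have ihS := ih hlS fun j hj => hsS j (List.mem_cons_of_mem _ hj)
    have ihb := fun b => ih (S := S.erase b) (fun h => hlS (Finset.mem_of_mem_erase h))
      fun j hj h => hsS j (List.mem_cons_of_mem _ hj) (Finset.mem_of_mem_erase h)
    have hzl : t l ≠ t i := ht.ne hls.1
    have hzS : ∀ b ∈ S, t b ≠ t i := fun b hb => ht.ne fun e => hiS (e ▸ hb)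
    -- The remaining operator leaves the colour of site i alone, so the state may be replaced by any
    -- function that agrees with it where that colour equals `α i`. Each case below chooses such a
    -- function as a combination of states on the shorter chain `s`.
    have hloc := hO.actsOn_rho s
    have hcard : ∀ b ∈ S, (S.erase b).card + 1 = S.card := fun b hb =>
      Finset.card_erase_add_one hb
    have hrho : ∀ f, (O * rho C M t l (i :: s)) f =
        (O * rho C M t l s) (crossOp M C (1 / (t l - t i)) l i f) := by
      intro f
      rw [rho, leftProd_cons, ← mul_assoc]
      rfl
    have hrel : ∀ β : ι → C, (∀ x, ¬(x = l ∨ x ∈ D ∨ x ∈ s) → β x = α x) → β i = α i :=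
      fun β hβ => hβ i fun h => h.elim (fun h => hls.1 h.symm) fun h => h.elim
        (fun h => hsD i List.mem_cons_self h) hs.1
    have hswl : ∀ β : ι → C, (β ∘ Equiv.swap l i) l = β i := fun β => by simp
    have hswi : ∀ β : ι → C, (β ∘ Equiv.swap l i) i = β l := fun β => by simp
    have hsws : ∀ (β : ι → C), ∀ j ∈ s, (β ∘ Equiv.swap l i) j = β j := fun β j hj => by
      simp [Equiv.swap_apply_of_ne_of_ne (hjl j hj) (his j hj)]
    have hswD : ∀ (β : ι → C), ∀ j ∈ D, (β ∘ Equiv.swap l i) j = β j := fun β j hj => by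
      simp [Equiv.swap_apply_of_ne_of_ne (hDl j hj) (hDi j hj)]
    have hE : diagEigen t y (i :: s) = fun b => diagEigen t y s b * (1 + 1 / (t b - t i)) :=
      funext fun b => diagEigen_cons t y i s b
    rw [hrho, hrho]
    generalize hc : 1 / (t l - t i) = c at *
    by_cases hq : α i = q
    · have hb1 : bethe t y p q (i :: s) α =
          attach t (t i) (diagEigen t y s) (bethe t y p q s α) := by
        funext S; simp [bethe, hq]
      have hx1 : excited q (i :: s) α = excited q s α + 1 := by simp [excited_cons, hq]
      -- One more variable and one more excited site leave the power in the base module unchanged.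
      rw [hb1, hx1, Nat.add_sub_add_right]
      constructor
      -- If the auxiliary colour is q, the swap fixes the colouring and gives 1 + c; if it is p,
      -- only the swapped term survives and contributes the diagonal entry with factor c.
      · rw [hloc _ (∑ b ∈ S, ((1 + c) * (diagEigen t y s b / (t b - t i) *
            cross t b (S.erase b))) • auxState t y p q w ref D l q s (S.erase b) +
            c • auxState t y p q w ref D l p s S) α]
        · simp only [map_add, map_sum, map_smul, Pi.add_apply, Finset.sum_apply, Pi.smul_apply,
            ihS, (ihb _).1]
          split_ifs with hP
          · rw [attach_insert ht _ _ hlS hzl hzS, hc]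
            rw [mul_add, add_smul]
            congr 1
            · rw [Finset.mul_sum, Finset.mul_sum, Finset.sum_smul]
              refine Finset.sum_congr rfl fun b hb => ?_
              rw [hcard b hb, smul_smul]
              congr 1
              ring
            · rw [smul_smul]
              congr 1
              ring
          · simp
        · intro β hβ
          have hβi := (hrel β hβ).trans hq
          rw [crossOp_apply, auxState_cons_of_q hβi]
          simp only [Pi.add_apply, Finset.sum_apply, Pi.smul_apply]
          by_cases h1 : β l = q
          · rw [auxState_cons_of_q ((hswi β).trans h1), Finset.smul_sum, ← Finset.sum_add_distrib,
              auxState_of_ne (c := p) (h1 ▸ hpq.symm), smul_zero, add_zero]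
            refine Finset.sum_congr rfl fun b _ => ?_
            rw [auxState_congr (hsws β) (hswD β) (by rw [hswl, hβi, h1])]
            module
          · simp only [auxState_of_ne (c := q) h1, smul_zero, Finset.sum_const_zero, zero_add]
            by_cases h2 : β l = p
            · rw [auxState_cons_of_p hpq ((hswi β).trans h2),
                auxState_congr (c' := p) (hsws β) (hswD β) (by rw [hswl, hβi, h2]; simp)]
            · rw [auxState_cons_of_ne (by rwa [hswi]) (by rwa [hswi]), auxState_of_ne h2]
      -- Here the swap would bring colour q to the auxiliary label, where the state vanishes, so the
      -- R-matrix acts as the identity.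
      · rw [hloc _ (∑ b ∈ S, (diagEigen t y s b / (t b - t i) *
            cross t b (S.erase b)) • auxState t y p q w ref D l p s (S.erase b)) α]
        · simp only [map_sum, map_smul, Finset.sum_apply, Pi.smul_apply, (ihb _).2]
          split_ifs with hP
          · rw [hE, ← attach_diagAct ht _ _ hlS hzl hzS, Finset.mul_sum, Finset.sum_smul]
            refine Finset.sum_congr rfl fun b hb => ?_
            rw [← hcard b hb, Nat.add_sub_add_right, smul_smul]
            congr 1
            ring
          · simp
        · intro β hβ
          have hβi := (hrel β hβ).trans hq
          rw [crossOp_apply, auxState_cons_of_q hβi,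
            auxState_of_ne (by rw [hswl, hβi]; exact hpq.symm), smul_zero, add_zero]
          simp only [Finset.sum_apply, Pi.smul_apply]
    by_cases hp : α i = p
    · have hb1 : bethe t y p q (i :: s) α = bethe t y p q s α := by
        funext S; simp [bethe, hp, hpq]
      have hx1 : excited q (i :: s) α = excited q s α := by simp [excited_cons, hq]
      rw [hb1, hx1]
      constructor
      · rw [hloc _ (auxState t y p q w ref D l q s S) α]
        · exact ihS.1
        · intro β hβ
          have hβi := (hrel β hβ).trans hp
          rw [crossOp_apply, auxState_cons_of_p hpq hβi,
            auxState_of_ne (β := β ∘ _) (by rw [hswl, hβi]; exact hpq), smul_zero, add_zero]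
      -- For auxiliary colour q, the swap produces an excited site and hence a creation entry with
      -- factor c; for auxiliary colour p, both terms coincide and give 1 + c.
      · rw [hloc _ (∑ b ∈ S, (c * (diagEigen t y s b / (t b - t i) *
            cross t b (S.erase b))) • auxState t y p q w ref D l q s (S.erase b) +
            (1 + c) • auxState t y p q w ref D l p s S) α]
        · simp only [map_add, map_sum, map_smul, Pi.add_apply, Finset.sum_apply, Pi.smul_apply,
            ihS, (ihb _).1]
          split_ifs with hP
          · rw [hE, ← diagAct_step ht _ _ hlS hzl hzS, hc, mul_add]
            conv_rhs => rw [add_smul]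
            refine (add_comm _ _).trans ?_
            congr 1
            · rw [smul_smul]
              congr 1
              ring
            · rw [Finset.mul_sum, Finset.mul_sum, Finset.sum_smul]
              refine Finset.sum_congr rfl fun b hb => ?_
              rw [hcard b hb, smul_smul]
              congr 1
              ring
          · simp
        · intro β hβ
          have hβi := (hrel β hβ).trans hp
          rw [crossOp_apply, auxState_cons_of_p hpq hβi]
          simp only [Pi.add_apply, Finset.sum_apply, Pi.smul_apply]
          by_cases h1 : β l = q
          · rw [auxState_cons_of_q ((hswi β).trans h1), Finset.smul_sum,
              auxState_of_ne (c := p) (h1 ▸ hpq.symm), smul_zero, add_zero, zero_add]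
            refine Finset.sum_congr rfl fun b _ => ?_
            rw [auxState_congr (c' := q) (hsws β) (hswD β) (by rw [hswl, hβi, h1]; simp), smul_smul]
          · simp only [auxState_of_ne (c := q) h1, smul_zero, Finset.sum_const_zero, zero_add]
            by_cases h2 : β l = p
            · rw [auxState_cons_of_p hpq ((hswi β).trans h2),
                auxState_congr (c' := p) (hsws β) (hswD β) (by rw [hswl, hβi, h2])]
              module
            · rw [auxState_cons_of_ne (by rwa [hswi]) (by rwa [hswi]), auxState_of_ne h2]
              simp
    · have hb1 : bethe t y p q (i :: s) α = fun _ => 0 := by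
        funext S; simp [bethe, hp, hq]
      have hz : ∀ c', c' = p ∨ c' = q → (O * rho C M t l s) (crossOp M C c l i
          (auxState t y p q w ref D l c' (i :: s) S)) α = 0 := by
        intro c' hc'
        rw [hloc _ 0 α]
        · simp
        · intro β hβ
          have hβi := hrel β hβ
          rw [crossOp_apply, auxState_cons_of_ne (by rwa [hβi]) (by rwa [hβi]), auxState_of_ne]
          · simp
          · rw [hswl, hβi]
            rcases hc' with rfl | rfl <;> assumption
      rw [hz q (Or.inr rfl), hz p (Or.inl rfl), hb1]
      simp [diagAct]

/-- The product of the operators `O_l ∏←_{i ∈ s} R_{l i}(t_l - t_i)`, `l ∈ L`, applied to the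
reference state, at the colourings with colour `p` on `L`. -/
theorem listProd_monodromy [CharZero K] [Fintype ι] {O : ι → Module.End K ((ι → C) → M)} {d : ι → K}
    {L s : List ι}
    (hO : ∀ l ∈ L, IsBase t y p q w ref D l (d l) (O l))
    (ht : Function.Injective t) (hpq : p ≠ q) (hL : L.Nodup) (hs : s.Nodup)
    (hLD : ∀ l ∈ L, l ∉ D) (hLs : ∀ l ∈ L, l ∉ s) (hsD : ∀ i ∈ s, i ∉ D)
    (hrs : ∀ i ∈ s, ref i = p) (hrL : ∀ l ∈ L, ref l = q) {α : ι → C} (hα : ∀ l ∈ L, α l = p) :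
    (L.map fun l => O l * rho C M t l s).prod (Pi.single ref (w 0)) α =
      if ∀ x, x ∉ s → x ∉ L → α x = ref x then
        ((L.map d).prod * bethe t y p q s α L.toFinset) • w (L.length - excited q s α) else 0 := by
  induction L generalizing α with
  | nil =>
    simp only [List.map_nil, List.prod_nil, Module.End.one_apply, List.toFinset_nil,
      bethe_empty t y hpq, List.length_nil, Nat.zero_sub, one_mul, List.not_mem_nil,
      not_false_eq_true, true_imp_iff]
    have h : α = ref ↔ (∀ x, x ∉ s → α x = ref x) ∧ ∀ i ∈ s, α i = p := by
      constructor
      · rintro rfl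
        exact ⟨fun _ _ => rfl, hrs⟩
      · rintro ⟨h1, h2⟩
        funext x
        by_cases hx : x ∈ s
        · rw [h2 x hx, hrs x hx]
        · exact h1 x hx
    by_cases h1 : ∀ x, x ∉ s → α x = ref x <;> by_cases h2 : ∀ i ∈ s, α i = p
    · rw [if_pos h1, if_pos h2, h.2 ⟨h1, h2⟩]
      simp
    · rw [if_pos h1, if_neg h2, Pi.single_eq_of_ne fun e => h2 (h.1 e).2]
      simp
    all_goals rw [if_neg h1, Pi.single_eq_of_ne fun e => h1 (h.1 e).1]
  | cons l L ih =>
    rw [List.nodup_cons] at hL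
    have hb := hO l List.mem_cons_self
    have hlD := hLD l List.mem_cons_self
    have hls := hLs l List.mem_cons_self
    have hrl := hrL l List.mem_cons_self
    replace ih := fun {α : ι → C} => ih (α := α)
      (fun l hl => hO l (List.mem_cons_of_mem _ hl)) hL.2
      (fun l hl => hLD l (List.mem_cons_of_mem _ hl))
      (fun l hl => hLs l (List.mem_cons_of_mem _ hl))
      (fun l hl => hrL l (List.mem_cons_of_mem _ hl))
    rw [List.map_cons, List.prod_cons, Module.End.mul_apply]
    -- The labels of `L` already carry the final colour p, so by induction the state met by the next
    -- factor is a multiple of `auxState` with variables `L`. The scalar condition records the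
    -- labels that this factor does not touch.
    rw [hb.actsOn_rho s _ ((if ∀ x, x ∉ s → x ∉ L → x ≠ l → x ∉ D → α x = ref x then
      (L.map d).prod else 0) • auxState t y p q w ref D l q s L.toFinset) α]
    · rw [map_smul, Pi.smul_apply,
        (hb.monodromy ht hpq hlD hs hls hsD (by simpa using hL.1)
          (fun i hi h => hLs i (List.mem_cons_of_mem _ (List.mem_toFinset.1 h)) hi)
          (hα l List.mem_cons_self)).1]
      have h : (∀ x, x ∉ s → x ∉ l :: L → α x = ref x) ↔
          (∀ x, x ∉ s → x ∉ L → x ≠ l → x ∉ D → α x = ref x) ∧ ∀ x ∈ D, α x = ref x := by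
        constructor
        · intro h
          refine ⟨fun x h1 h2 h3 _ => h x h1 (by simp [h2, h3]), fun x hx => h x ?_ ?_⟩
          · exact fun h => hsD x h hx
          · exact fun h => hLD x h hx
        · rintro ⟨h1, h2⟩ x h3 h4
          simp only [List.mem_cons, not_or] at h4
          by_cases hx : x ∈ D
          · exact h2 x hx
          · exact h1 x h3 h4.2 h4.1 hx
      simp only [h]
      by_cases h1 : ∀ x, x ∉ s → x ∉ L → x ≠ l → x ∉ D → α x = ref x
      · by_cases h2 : ∀ x ∈ D, α x = ref x
        · rw [if_pos h1, if_pos h2, if_pos ⟨h1, h2⟩, smul_smul,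
            List.toFinset_card_of_nodup hL.2]
          simp only [List.map_cons, List.prod_cons, List.toFinset_cons, List.length_cons]
          congr 1
          ring
        · rw [if_neg h2, if_neg (not_and_of_not_right _ h2), smul_zero]
      · rw [if_neg h1, if_neg (not_and_of_not_left _ h1), zero_smul]
    · intro β hβ
      have hβL : ∀ x ∈ L, β x = p := fun x hx => by
        rw [hβ x, hα x (List.mem_cons_of_mem _ hx)]
        rintro (h | h | h)
        · exact hL.1 (h ▸ hx)
        · exact hLD x (List.mem_cons_of_mem _ hx) h
        · exact hLs x (List.mem_cons_of_mem _ hx) h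
      rw [ih hβL]
      have h : (∀ x, x ∉ s → x ∉ L → β x = ref x) ↔
          (∀ x, x ∉ s → x ∉ L → x ≠ l → x ∉ D → α x = ref x) ∧
            (β l = q ∧ ∀ x ∈ D, β x = ref x) := by
        constructor
        · intro h
          refine ⟨fun x h1 h2 h3 h4 => ?_, ?_, fun x hx => h x ?_ ?_⟩
          · rw [← hβ x (by simp [h1, h3, h4]), h x h1 h2]
          · rw [h l hls hL.1, hrl]
          · exact fun h => hsD x h hx
          · exact fun h => hLD x (List.mem_cons_of_mem _ h) hx
        · rintro ⟨h1, h2, h3⟩ x h4 h5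
          by_cases hxl : x = l
          · rw [hxl, h2, hrl]
          by_cases hx : x ∈ D
          · exact h3 x hx
          · rw [hβ x (by simp [h4, hxl, hx]), h1 x h4 h5 hxl hx]
      simp only [h, Pi.smul_apply, auxState, List.toFinset_card_of_nodup hL.2]
      by_cases h1 : ∀ x, x ∉ s → x ∉ L → x ≠ l → x ∉ D → α x = ref x
      · by_cases h2 : β l = q ∧ ∀ x ∈ D, β x = ref x
        · rw [if_pos h1, if_pos h2, if_pos ⟨h1, h2⟩, smul_smul]
        · rw [if_neg h2, if_neg (not_and_of_not_right _ h2), smul_zero]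
      · rw [if_neg h1, if_neg (not_and_of_not_left _ h1), zero_smul]

end Monodromy

/-! ### Transposition of scalar operators and products of one-site operators -/

section Transpose

variable {K : Type*} [Field K] {M : Type*} [AddCommGroup M] [Module K M]
  {ι : Type*} [DecidableEq ι] [Fintype ι] {C : Type*} [DecidableEq C] [Fintype C]

theorem eq_sum_single (f : (ι → C) → M) : f = ∑ β, Pi.single β (f β) := by
  funext α
  rw [Finset.sum_apply, Finset.sum_eq_single α]
  · simp
  · intro b _ hb
    exact Pi.single_eq_of_ne hb.symm _
  · simp

/-- `A` and `B` are given by scalar matrices that are transposed to each other. -/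
def IsTransposed (A B : Module.End K ((ι → C) → M)) : Prop :=
  ∀ α, ∃ c : (ι → C) → K, (∀ f, A f α = ∑ β, c β • f β) ∧
    ∀ u, B (Pi.single α u) = fun β => c β • u

theorem IsTransposed.one : IsTransposed (1 : Module.End K ((ι → C) → M)) 1 := by
  intro α
  refine ⟨Pi.single α 1, fun f => ?_, fun u => ?_⟩
  · rw [Finset.sum_eq_single α] <;> simp +contextual
  · funext β
    simp only [Module.End.one_apply, Pi.single_apply]
    split_ifs <;> simp

theorem IsTransposed.crossOp (c : K) (i j : ι) :
    IsTransposed (crossOp M C c i j) (crossOp M C c i j) := by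
  intro α
  have h : ∀ (u : M) β, (Pi.single α u : (ι → C) → M) (β ∘ Equiv.swap i j) =
      (Pi.single (α ∘ Equiv.swap i j) u : (ι → C) → M) β := by
    intro u β
    have hs : (β ∘ Equiv.swap i j) ∘ Equiv.swap i j = β := by ext; simp
    have hs' : (α ∘ Equiv.swap i j) ∘ Equiv.swap i j = α := by ext; simp
    have : β ∘ Equiv.swap i j = α ↔ β = α ∘ Equiv.swap i j :=
      ⟨fun e => by rw [← e, hs], fun e => by rw [e, hs']⟩
    simp [Pi.single_apply, this]
  refine ⟨fun β => (Pi.single α 1 : (ι → C) → K) β +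
    c * (Pi.single (α ∘ Equiv.swap i j) 1 : (ι → C) → K) β, fun f => ?_, fun u => ?_⟩
  · simp [add_smul, Finset.sum_add_distrib, Pi.single_apply]
  · funext β
    rw [crossOp_apply, h]
    simp only [Pi.single_apply]
    split_ifs <;> simp [add_smul]

theorem IsTransposed.mul {A A' B B' : Module.End K ((ι → C) → M)} (h : IsTransposed A B)
    (h' : IsTransposed A' B') : IsTransposed (A * A') (B' * B) := by
  intro α
  obtain ⟨c, hc, hc'⟩ := h α
  choose c' h1 h2 using h'
  refine ⟨fun γ => ∑ β, c β * c' β γ, fun f => ?_, fun u => ?_⟩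
  · simp only [Module.End.mul_apply, hc, h1, Finset.smul_sum, Finset.sum_smul, smul_smul]
    exact Finset.sum_comm
  · rw [Module.End.mul_apply, hc', eq_sum_single fun β => c β • u]
    simp only [map_sum, h2]
    funext γ
    simp only [Finset.sum_apply, Finset.sum_smul, smul_smul, mul_comm]

theorem IsTransposed.listProd {κ : Type*} {A B : κ → Module.End K ((ι → C) → M)} (a : List κ)
    (h : ∀ i ∈ a, IsTransposed (A i) (B i)) :
    IsTransposed (a.map A).prod (a.reverse.map B).prod := by
  induction a with
  | nil => exact IsTransposed.one
  | cons i a ih =>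
    simp only [List.map_cons, List.prod_cons, List.reverse_cons, List.map_append, List.prod_append,
      List.map_nil, List.prod_nil, mul_one]
    exact (h i List.mem_cons_self).mul (ih fun j hj => h j (List.mem_cons_of_mem _ hj))

/-- Distinct sites do not interfere, so in each factor only the colour prescribed by γ contributes,
and the operator entries multiply in the order of the list. -/
theorem listProd_siteOp_single {τ : ι → C → C → Module.End K M} {a : List ι} (ha : a.Nodup)
    (γ β : ι → C) (u : M) :
    (a.map fun i => siteOp i (τ i)).prod (Pi.single γ u) β =
      if ∀ x, x ∉ a → β x = γ x then (a.map fun i => τ i (β i) (γ i)).prod u else 0 := by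
  induction a generalizing β with
  | nil =>
    simp [Pi.single_apply, funext_iff]
  | cons i a ih =>
    rw [List.nodup_cons] at ha
    simp only [List.map_cons, List.prod_cons, Module.End.mul_apply, siteOp_apply, ih ha.2]
    rw [Finset.sum_eq_single (γ i)]
    · have h1 : (∀ x, x ∉ a → Function.update β i (γ i) x = γ x) ↔
          ∀ x, x ∉ i :: a → β x = γ x := by
        refine forall_congr' fun x => ?_
        by_cases hx : x = i
        · subst hx; simp
        · simp [hx]
      have h2 : (a.map fun j => τ j (Function.update β i (γ i) j) (γ j)) =
          a.map fun j => τ j (β j) (γ j) := by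
        refine List.map_congr_left fun j hj => ?_
        rw [Function.update_of_ne]
        rintro rfl
        exact ha.1 hj
      simp only [h1, h2]
      split_ifs <;> simp
    · intro b _ hb
      rw [if_neg, map_zero]
      intro h
      exact hb (by simpa using h i ha.1)
    · simp

end Transpose

/-! ### Separation of the gl_4 product into two gl_2 problems and a middle factor -/

section Nested

variable {K : Type*} [Field K] [CharZero K] {M : Type*} [AddCommGroup M] [Module K M]
  {ι : Type*} [DecidableEq ι]
  {e : Fin 4 → Fin 4 → Module.End K M} {t : ι → K} {x : K}

/-- The reciprocals `1 / (t_i - x)`. -/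
def recip (t : ι → K) (x : K) (i : ι) : K := 1 / (t i - x)

variable (e t x) in
/-- `T^{(i)}(t_i)` in the evaluation module. -/
def tOp (i : ι) : Module.End K ((ι → Fin 4) → M) := siteOp i (lMat e (recip t x i))

variable (M t) in
/-- `R^{(i j)}(t_i - t_j)`. -/
def rOp (i j : ι) : Module.End K ((ι → Fin 4) → M) := crossOp M (Fin 4) (1 / (t i - t j)) i j

/-- Moving all the dependence on the second group between those on the first and the third. -/
theorem nested_reorder (he : IsGlFamily e) (ht : Function.Injective t) (hx : ∀ i, t i ≠ x)
    {L1 L2 L3 : List ι} (h1 : L1.Nodup) (h2 : L2.Nodup) (h3 : L3.Nodup)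
    (h21 : ∀ i ∈ L2, i ∉ L1) (h31 : ∀ i ∈ L3, i ∉ L1) (h32 : ∀ i ∈ L3, i ∉ L2) :
    (L1.map (tOp e t x)).prod * (L2.map (tOp e t x)).prod * (L3.map (tOp e t x)).prod *
        (gridProd (rOp M t) L3 L2 * gridProd (rOp M t) L3 L1 * gridProd (rOp M t) L2 L1) =
      gridProd (rOp M t) L2 L1 * ((L2 ++ L1).map (tOp e t x)).prod *
        (L3.map fun l => tOp e t x l * rho (Fin 4) M t l L1 * rho (Fin 4) M t l L2).prod := by
  have hTR : ∀ i j k, i ≠ j → i ≠ k → Commute (tOp e t x i) (rOp M t j k) :=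
    fun i j k hij hik => siteOp_commute_crossOp hij hik _ _
  have hRR : ∀ i j k l, i ≠ k → i ≠ l → j ≠ k → j ≠ l → Commute (rOp M t i j) (rOp M t k l) :=
    fun i j k l h1 h2 h3 h4 => crossOp_commute _ _ h1 h2 h3 h4
  have hne : ∀ {i j}, i ≠ j → t i - t j ≠ 0 := fun h => sub_ne_zero.2 (ht.ne h)
  have hYB : ∀ i j k, i ≠ j → i ≠ k → j ≠ k →
      rOp M t i j * rOp M t i k * rOp M t j k = rOp M t j k * rOp M t i k * rOp M t i j := by
    intro i j k hij hik hjk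
    refine crossOp_yangBaxter ?_ hij hik hjk
    have n1 := hne hij
    have n2 := hne hik
    have n3 := hne hjk
    field_simp
    ring
  have hRTT : ∀ i j, i ≠ j → tOp e t x j * tOp e t x i * rOp M t i j =
      rOp M t i j * tOp e t x i * tOp e t x j := by
    intro i j hij
    refine siteOp_rtt he hij ?_
    have n1 := hne hij
    have n2 := sub_ne_zero.2 (hx i)
    have n3 := sub_ne_zero.2 (hx j)
    unfold recip
    field_simp
    ring
  have hc : Commute (L3.map (tOp e t x)).prod (gridProd (rOp M t) L2 L1) :=
    commute_gridProd fun i hi j hj => (commute_listProd fun k hk =>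
      (hTR k i j (fun e => h32 k hk (e ▸ hi)) (fun e => h31 k hk (e ▸ hj))).symm).symm
  have hex := prod_mul_gridProd_exchange (T := tOp e t x) (R := rOp M t) L2 L1 h21 h2 h1 hTR hRTT
  -- This brings R21 to the left end of the R-factors; it then commutes with T3 and reverses T1 T2.
  -- Interleaving afterwards attaches to each label of `L3` its own row of R-matrices.
  rw [gridProd_yangBaxter L3 L2 L1 h21 h32 h31 h2 h1 h3 hRR hYB]
  rw [← listProd_mul_interleave (fun l => tOp e t x l * rho (Fin 4) M t l L1),
    ← listProd_mul_interleave (tOp e t x), List.map_append, List.prod_append]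
  · change _ = gridProd (rOp M t) L2 L1 * _ * ((L3.map (tOp e t x)).prod *
      gridProd (rOp M t) L3 L1 * gridProd (rOp M t) L3 L2)
    calc _ = (L1.map (tOp e t x)).prod * (L2.map (tOp e t x)).prod *
          ((L3.map (tOp e t x)).prod * gridProd (rOp M t) L2 L1) *
            (gridProd (rOp M t) L3 L1 * gridProd (rOp M t) L3 L2) := by simp only [mul_assoc]
      _ = ((L1.map (tOp e t x)).prod * (L2.map (tOp e t x)).prod * gridProd (rOp M t) L2 L1) *
          (L3.map (tOp e t x)).prod *
            (gridProd (rOp M t) L3 L1 * gridProd (rOp M t) L3 L2) := by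
          rw [hc.eq]; simp only [mul_assoc]
      _ = _ := by rw [hex]; simp only [mul_assoc]
  · exact h3
  · intro i hi j hj hij
    exact commute_leftProd fun m hm => hTR i j m hij fun e => h31 i hi (e ▸ hm)
  · exact h3
  · intro i hi j hj hij
    refine commute_leftProd fun m hm => ?_
    refine (hTR i j m hij fun e => h32 i hi (e ▸ hm)).mul_left ?_
    refine (commute_leftProd fun k hk => ?_).symm
    exact hRR j m i k hij.symm (fun e => h31 j hj (e ▸ hk)) (fun e => h32 i hi (e ▸ hm))
      (fun e => h21 m hm (e ▸ hk))

theorem IsGlFamily.commute (he : IsGlFamily e) {a b c d : Fin 4} (hbc : b ≠ c) (hda : d ≠ a) :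
    Commute (e a b) (e c d) := by
  have := he a b c d
  rw [if_neg hbc, if_neg hda, sub_zero, sub_eq_zero] at this
  exact this

/-- `e_{ba}^m u`, `b ≠ a`, is a weight vector for `e_{bb}`, `e_{aa}`. -/
theorem IsGlFamily.diag_pow (he : IsGlFamily e) {a b c : Fin 4} (hba : b ≠ a) {u : M} {k : K}
    {s : K} (hs : (if c = b then 1 else 0) - (if a = c then 1 else 0) = s)
    (hu : e c c u = k • u) (m : ℕ) : e c c ((e b a ^ m) u) = (k + s * m) • (e b a ^ m) u := by
  induction m with
  | zero => simpa using hu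
  | succ m ih =>
    have h := LinearMap.congr_fun (he c c b a) ((e b a ^ m) u)
    simp only [LinearMap.sub_apply, Module.End.mul_apply, ih, map_smul] at h
    rw [pow_succ', Module.End.mul_apply, sub_eq_iff_eq_add.1 h, ← hs]
    split_ifs with h1 h2 h2
    · exact absurd (h1.symm.trans h2.symm) hba
    · subst h1; simp; module
    · subst h2; simp; module
    · simp

theorem tOp_mul_rho_actsOn (l : ι) (D : List ι) :
    ActsOn (tOp e t x l * rho (Fin 4) M t l D) fun x => x = l ∨ x ∈ D :=
  (siteOp_actsOn (A := fun x => x = l ∨ x ∈ D) _ (Or.inl rfl)).mul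
    (leftProd_crossOp_actsOn _ (Or.inl rfl) fun _ h => Or.inr h)

/-- The monodromy through inert labels of colour `1` acts trivially on the vectors annihilated by
the transition from colour `1`. -/
theorem tOp_mul_rho_inert {l : ι} {c : Fin 4} (hc : c ≠ 1) {ref α : ι → Fin 4} {u : M}
    (hu : lMat e (recip t x l) (α l) 1 u = 0) {D : List ι} (hlD : l ∉ D)
    (href : ∀ i ∈ D, ref i = 1) (hD : D.Nodup) :
    (tOp e t x l * rho (Fin 4) M t l D)
          (fun β => if β l = 1 ∧ ∀ i ∈ D, β i = ref i then u else 0) α = 0 ∧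
      (tOp e t x l * rho (Fin 4) M t l D)
          (fun β => if β l = c ∧ ∀ i ∈ D, β i = ref i then u else 0) α =
        if ∀ i ∈ D, α i = ref i then lMat e (recip t x l) (α l) c u else 0 := by
  induction D with
  | nil =>
    have h : ∀ c', siteOp l (lMat e (recip t x l))
        (fun β => if β l = c' then u else 0) α = lMat e (recip t x l) (α l) c' u := by
      intro c'
      rw [siteOp_apply, Finset.sum_eq_single c']
      · simp
      · intro b _ hb
        simp [hb]
      · simp
    simp [rho, tOp, h, hu]
  | cons i D ih =>
    rw [List.nodup_cons] at hD
    simp only [List.mem_cons, not_or] at hlD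
    replace ih := ih hlD.2 (fun j hj => href j (List.mem_cons_of_mem _ hj)) hD.2
    have hri := href i List.mem_cons_self
    have hloc := tOp_mul_rho_actsOn (e := e) (t := t) (x := x) l D
    have hrho : ∀ f, (tOp e t x l * rho (Fin 4) M t l (i :: D)) f =
        (tOp e t x l * rho (Fin 4) M t l D) (crossOp M (Fin 4) (1 / (t l - t i)) l i f) := by
      intro f
      rw [rho, leftProd_cons, ← mul_assoc]
      rfl
    have hrel : ∀ β : ι → Fin 4, (∀ x, ¬(x = l ∨ x ∈ D) → β x = α x) → β i = α i :=
      fun β hβ => hβ i fun h => h.elim (fun h => hlD.1 h.symm) hD.1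
    have hsw : ∀ β : ι → Fin 4, (∀ j ∈ D, β (Equiv.swap l i j) = ref j) ↔
        ∀ j ∈ D, β j = ref j := fun β => forall₂_congr fun j hj => by
      have hjl : j ≠ l := fun e => hlD.2 (e ▸ hj)
      have hji : j ≠ i := fun e => hD.1 (e ▸ hj)
      rw [Equiv.swap_apply_of_ne_of_ne hjl hji]
    rw [hrho, hrho]
    generalize 1 / (t l - t i) = k
    -- An inert label keeps colour 1 unless the R-matrix exchanges it with the auxiliary colour c;
    -- but then colour 1 enters the auxiliary entry, which annihilates `u` by the first half of the
    -- induction hypothesis.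
    by_cases hi : α i = 1
    · constructor
      · rw [hloc _ ((1 + k) • fun β => if β l = 1 ∧ ∀ i ∈ D, β i = ref i then u else 0) α]
        · rw [map_smul, Pi.smul_apply, ih.1, smul_zero]
        · intro β hβ
          have hβi := (hrel β hβ).trans hi
          simp only [crossOp_apply, List.forall_mem_cons, hsw, Function.comp_apply,
            Equiv.swap_apply_left, Equiv.swap_apply_right, hβi, hri, Pi.smul_apply, true_and]
          split_ifs <;> module
      · rw [hloc _ (fun β => if β l = c ∧ ∀ i ∈ D, β i = ref i then u else 0) α]
        · rw [ih.2]
          simp [hi, hri]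
        · intro β hβ
          have hβi := (hrel β hβ).trans hi
          simp [hsw, hβi, hri, hc.symm]
    · constructor
      · rw [hloc _ 0 α]
        · simp
        · intro β hβ
          have hβi := hrel β hβ
          simp [hri, hβi, hi]
      · rw [hloc _ ((if α i = c then k else 0) •
          fun β => if β l = 1 ∧ ∀ i ∈ D, β i = ref i then u else 0) α]
        · rw [map_smul, Pi.smul_apply, ih.1]
          simp [hri, hi]
        · intro β hβ
          have hβi := hrel β hβ
          by_cases h : α i = c <;> simp [hsw, hri, hβi, hi, h, hc]

variable [Fintype ι]

/-- The factor of the third group applied to the reference state. -/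
theorem third_group (he : IsGlFamily e) (ht : Function.Injective t) (hx : ∀ i, t i ≠ x)
    {L1 L2 L3 : List ι} (h1 : L1.Nodup) (h2 : L2.Nodup) (h3 : L3.Nodup)
    (h21 : ∀ i ∈ L2, i ∉ L1) (h31 : ∀ i ∈ L3, i ∉ L1) (h32 : ∀ i ∈ L3, i ∉ L2)
    (hcov : ∀ i, i ∈ L1 ∨ i ∈ L2 ∨ i ∈ L3) {col : ι → Fin 4} (hc1 : ∀ i ∈ L1, col i = 1)
    (hc2 : ∀ i ∈ L2, col i = 2) (hc3 : ∀ i ∈ L3, col i = 3) {v : M} {k : K}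
    (hv : e 1 2 v = 0) (hk : e 2 2 v = k • v) {γ : ι → Fin 4} (hγ : ∀ i ∈ L3, γ i = 2) :
    (L3.map fun l => tOp e t x l * rho (Fin 4) M t l L1 * rho (Fin 4) M t l L2).prod
        (Pi.single col v) γ =
      if ∀ i ∈ L1, γ i = 1 then
        ((L3.map (recip t x)).prod * bethe t (x - k) 2 3 L2 γ L3.toFinset) •
          (e 3 2 ^ (L3.length - excited 3 L2 γ)) v
      else 0 := by
  -- This makes the first group inert: the entry from colour 1 to colour 2 of each L-operator of the
  -- third group is a multiple of `e 1 2`.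
  have hw : ∀ m, e 1 2 ((e 3 2 ^ m) v) = 0 := by
    intro m
    have := ((he.commute (a := 1) (b := 2) (c := 3) (d := 2) (by decide) (by decide)).pow_right
      m).eq
    have := LinearMap.congr_fun this v
    simpa [hv] using this
  have hw2 := he.diag_pow (a := 2) (b := 3) (c := 2) (s := -1) (by decide) (by simp) hk
  -- The weight of `e 3 2 ^ m v` under `e 2 2` is k - m, and 1 + (k - m)/(t_l - x) = (t_l - (x - k)
  -- - m)/(t_l - x); hence y = x - k and d = 1/(t_l - x).
  have hO : ∀ l ∈ L3, IsBase t (x - k) 2 3 (fun m => (e 3 2 ^ m) v) col L1 l (recip t x l)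
      (tOp e t x l * rho (Fin 4) M t l L1) := by
    intro l hl
    have hxl := sub_ne_zero.2 (hx l)
    have hu : ∀ m (α : ι → Fin 4), α l = 2 → lMat e (recip t x l) (α l) 1 ((e 3 2 ^ m) v) = 0 := by
      intro m α hα
      simp [lMat, hα, hw]
    refine ⟨tOp_mul_rho_actsOn l L1, fun m α hα => ?_, fun m α hα => ?_⟩
    · rw [(tOp_mul_rho_inert (c := 2) (by decide) (hu m α hα) (h31 l hl) hc1 h1).2]
      congr 1
      simp only [lMat, hα, if_true, LinearMap.add_apply, Module.End.one_apply,
        LinearMap.smul_apply, hw2, recip]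
      rw [smul_smul]
      nth_rewrite 1 [← one_smul K ((e 3 2 ^ m) v)]
      rw [← add_smul]
      congr 1
      field_simp
      ring
    · rw [(tOp_mul_rho_inert (c := 3) (by decide) (hu m α hα) (h31 l hl) hc1 h1).2]
      congr 1
      simp [lMat, hα, pow_succ']
  have := listProd_monodromy hO ht (by decide) h3 h2 h31 h32 h21 hc2 hc3 hγ
  simp only [pow_zero, Module.End.one_apply] at this
  rw [this]
  refine if_congr ⟨fun h i hi => ?_, fun h i hi hi' => ?_⟩ rfl rfl
  · rw [h i (fun h' => h21 i h' hi) (fun h' => h31 i h' hi), hc1 i hi]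
  · have : i ∈ L1 := (hcov i).resolve_right (by tauto)
    rw [h i this, hc1 i this]

/-- The factors of the first two groups. -/
theorem first_groups (he : IsGlFamily e) (ht : Function.Injective t) (hx : ∀ i, t i ≠ x)
    {L1 L2 : List ι} (h1 : L1.Nodup) (h2 : L2.Nodup) (h21 : ∀ i ∈ L2, i ∉ L1)
    {row : ι → Fin 4} (hr1 : ∀ i ∈ L1, row i = 0)
    (hr2 : ∀ i ∈ L2, row i = 1) {u : M} {k : K} (hk : e 1 1 u = k • u)
    {γ : ι → Fin 4} (hγ1 : ∀ i ∈ L1, γ i = 1) (hγ : ∀ i, i ∉ L2 → i ∉ L1 → γ i = row i) :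
    (gridProd (rOp M t) L2 L1 * ((L2 ++ L1).map (tOp e t x)).prod) (Pi.single γ u) row =
      ∑ α : ι → Fin 4, if ∀ i, i ∉ L2 → α i = γ i then
        (L2.map fun i => lMat e (recip t x i) (α i) (γ i)).prod
          (((L1.map fun i => -recip t x i).prod *
              bethe (fun i => -t i) (-(x - k)) 1 0 L2 α L1.toFinset) •
            (-1 : K) ^ (L1.length - excited 0 L2 α) • (e 1 0 ^ (L1.length - excited 0 L2 α)) u)
      else 0 := by
  have ht' : Function.Injective fun i => -t i := fun i j h => ht (neg_injective h)
  -- The row is fixed here, so matrix indices are transposed in order to propagate from the row as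
  -- from a reference state; the operator entries are still composed in their original order.
  set τ : ι → Fin 4 → Fin 4 → Module.End K M := fun i a b => lMat e (recip t x i) b a with hτ
  have hw2 := he.diag_pow (a := 0) (b := 1) (c := 1) (s := 1) (by decide) (by simp) hk
  -- Now `e 1 0` raises the weight of `e 1 1`, giving 1 + (k + m)/(t_l - x). To fit the form d(t - y
  -- - m), the variables, y and d all change sign; the factor (-1)^m in the base vectors compensates
  -- the sign of d in the creation entry.
  have hO : ∀ l ∈ L1, IsBase (fun i => -t i) (-(x - k)) 1 0
      (fun m => (-1 : K) ^ m • (e 1 0 ^ m) u) row [] l (-recip t x l) (siteOp l (τ l)) := by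
    intro l hl
    have hxl := sub_ne_zero.2 (hx l)
    have h : ∀ c' (u : M) α, siteOp l (τ l) (fun β => if β l = c' then u else 0) α =
        lMat e (recip t x l) c' (α l) u := by
      intro c' u α
      rw [siteOp_apply, Finset.sum_eq_single c']
      · simp [hτ]
      · intro b _ hb
        simp [hb]
      · simp
    refine ⟨siteOp_actsOn _ (Or.inl rfl), fun m α hα => ?_, fun m α hα => ?_⟩
    · simp only [List.not_mem_nil, false_imp_iff, implies_true, and_true, if_true, h]
      simp only [lMat, hα, if_true, LinearMap.add_apply, Module.End.one_apply,
        LinearMap.smul_apply, map_smul, hw2, recip]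
      match_scalars
      field_simp
      ring
    · simp only [List.not_mem_nil, false_imp_iff, implies_true, and_true, if_true, h]
      simp only [lMat, hα, LinearMap.add_apply, LinearMap.smul_apply, map_smul,
        pow_succ', Module.End.mul_apply]
      simp
      module
  have hmon := fun α hα => listProd_monodromy (α := α) hO ht' (by decide) h1 h2 (by simp)
    (fun l hl hl' => h21 l hl' hl) (by simp) hr2 hr1 hα
  -- Transposition reverses the order of the R-factors, and the grid is then read column by column.
  -- The arguments t_i - t_l with i in the second group become (-t_l) - (-t_i), as the chain with
  -- negated variables requires.
  have htr : IsTransposed (gridProd (rOp M t) L2 L1)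
      (L1.map fun l => rho (Fin 4) M (fun i => -t i) l L2).prod := by
    have : (L1.map fun l => rho (Fin 4) M (fun i => -t i) l L2).prod =
        (L2.reverse.map fun i => (L1.reverse.reverse.map (rOp M t i)).prod).prod := by
      rw [List.reverse_reverse, listProd_comm (rOp M t)]
      · congr 1
        refine List.map_congr_left fun l _ => ?_
        rw [rho, leftProd]
        congr 1
        refine List.map_congr_left fun i _ => ?_
        rw [rOp, crossOp_symm]
        congr 2
        ring
      · exact List.nodup_reverse.2 h2
      · exact h1
      · intro i hi j hj l hl m hm hij hlm
        rw [List.mem_reverse] at hi hj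
        exact crossOp_commute _ _ hij (fun e => h21 i hi (e ▸ hm)) (fun e => h21 j hj (e ▸ hl))
          hlm
    rw [this]
    exact IsTransposed.listProd _ fun i _ => IsTransposed.listProd _ fun l _ =>
      IsTransposed.crossOp _ _ _
  obtain ⟨c, hc, hc'⟩ := htr row
  -- The Bethe coefficient is expanded over the intermediate colourings β reached from the row
  -- through R21, so that it can be matched term by term with the actual matrix entry.
  have hmon' : ∀ α, (∀ i ∈ L1, α i = 1) → (∀ i, i ∉ L2 → i ∉ L1 → α i = row i) →
      ((L1.map fun i => -recip t x i).prod *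
              bethe (fun i => -t i) (-(x - k)) 1 0 L2 α L1.toFinset) •
            (-1 : K) ^ (L1.length - excited 0 L2 α) • (e 1 0 ^ (L1.length - excited 0 L2 α)) u =
      ∑ β, if ∀ i, i ∉ L1 → α i = β i then
        c β • (L1.map fun i => lMat e (recip t x i) (β i) (α i)).prod u else 0 := by
    intro α hα hα'
    have := hmon α hα
    simp only [if_pos hα', pow_zero, Module.End.one_apply, one_smul] at this
    rw [← this, ← listProd_mul_interleave _ _ _ h1, Module.End.mul_apply, hc',
      eq_sum_single fun β => c β • u, map_sum, Finset.sum_apply]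
    · refine Finset.sum_congr rfl fun β _ => ?_
      rw [listProd_siteOp_single h1]
      simp [hτ]
    · intro i hi j hj hij
      refine commute_leftProd fun m hm => siteOp_commute_crossOp hij ?_ _ _
      rintro rfl
      exact h21 _ hm hi
  have hsum : ∀ α : ι → Fin 4, (if ∀ i, i ∉ L2 → α i = γ i then
        (L2.map fun i => lMat e (recip t x i) (α i) (γ i)).prod
          (((L1.map fun i => -recip t x i).prod *
              bethe (fun i => -t i) (-(x - k)) 1 0 L2 α L1.toFinset) •
            (-1 : K) ^ (L1.length - excited 0 L2 α) • (e 1 0 ^ (L1.length - excited 0 L2 α)) u)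
      else 0) = ∑ β : ι → Fin 4, if (∀ i, i ∉ L2 → α i = γ i) ∧ ∀ i, i ∉ L1 → α i = β i then
        c β • (L2.map fun i => lMat e (recip t x i) (α i) (γ i)).prod
          ((L1.map fun i => lMat e (recip t x i) (β i) (α i)).prod u) else 0 := by
    intro α
    split_ifs with h
    · rw [hmon' α (fun i hi => by rw [h i fun h' => h21 i h' hi, hγ1 i hi])
        (fun i hi hi' => by rw [h i hi, hγ i hi hi']), map_sum]
      refine Finset.sum_congr rfl fun β _ => ?_
      by_cases h' : ∀ i, i ∉ L1 → α i = β i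
      · rw [if_pos h', if_pos ⟨h, h'⟩, map_smul]
      · rw [if_neg h', if_neg fun h => h' h.2, map_zero]
    · refine (Finset.sum_eq_zero fun β _ => ?_).symm
      rw [if_neg fun h' => h h'.1]
  rw [Finset.sum_congr rfl fun α _ => hsum α, Finset.sum_comm, Module.End.mul_apply, hc]
  refine Finset.sum_congr rfl fun β _ => ?_
  rw [show (L2 ++ L1).map (tOp e t x) = (L2 ++ L1).map fun i => siteOp i (lMat e (recip t x i))
    from rfl, listProd_siteOp_single]
  -- The colouring between T2 and T1 is determined by its neighbours: T1 does not act on the second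
  -- group, nor T2 on the first.
  · rw [Finset.sum_eq_single fun i => if i ∈ L2 then β i else γ i]
    · have hiff : ((∀ i, i ∉ L2 → (if i ∈ L2 then β i else γ i) = γ i) ∧
          ∀ i, i ∉ L1 → (if i ∈ L2 then β i else γ i) = β i) ↔
          ∀ i, i ∉ L2 ++ L1 → β i = γ i := by
        constructor
        · rintro ⟨-, h⟩ i hi
          simp only [List.mem_append, not_or] at hi
          simpa [hi.1] using (h i hi.2).symm
        · intro h
          refine ⟨fun i hi => by simp [hi], fun i hi => ?_⟩
          by_cases hi2 : i ∈ L2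
          · simp [hi2]
          · simp [hi2, h i (by simp [hi, hi2])]
      simp only [hiff]
      split_ifs with h
      · rw [List.map_append, List.prod_append, Module.End.mul_apply]
        have e1 : (L2.map fun i => lMat e (recip t x i) (if i ∈ L2 then β i else γ i) (γ i)) =
            L2.map fun i => lMat e (recip t x i) (β i) (γ i) :=
          List.map_congr_left fun i hi => by rw [if_pos hi]
        have e2 : (L1.map fun i => lMat e (recip t x i) (β i) (if i ∈ L2 then β i else γ i)) =
            L1.map fun i => lMat e (recip t x i) (β i) (γ i) :=
          List.map_congr_left fun i hi => by rw [if_neg fun h' => h21 i h' hi]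
        rw [e1, e2]
      · simp
    · intro α _ hα
      rw [if_neg]
      rintro ⟨h3, h4⟩
      refine hα (funext fun i => ?_)
      split_ifs with hi
      · exact h4 i (h21 i hi)
      · exact h3 i hi
    · simp
  · exact List.nodup_append'.2 ⟨h2, h1, fun i hi hi' => h21 i hi hi'⟩

/-- The action of the nested product on a singular vector. -/
theorem nested_value (he : IsGlFamily e) (ht : Function.Injective t) (hx : ∀ i, t i ≠ x)
    {L1 L2 L3 : List ι} (h1 : L1.Nodup) (h2 : L2.Nodup) (h3 : L3.Nodup)
    (h21 : ∀ i ∈ L2, i ∉ L1) (h31 : ∀ i ∈ L3, i ∉ L1) (h32 : ∀ i ∈ L3, i ∉ L2)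
    (hcov : ∀ i, i ∈ L1 ∨ i ∈ L2 ∨ i ∈ L3) {col row : ι → Fin 4} (hc1 : ∀ i ∈ L1, col i = 1)
    (hc2 : ∀ i ∈ L2, col i = 2) (hc3 : ∀ i ∈ L3, col i = 3)
    (hr1 : ∀ i ∈ L1, row i = 0) (hr2 : ∀ i ∈ L2, row i = 1) (hr3 : ∀ i ∈ L3, row i = 2)
    {v : M} {k1 k2 : K}
    (hv : e 1 2 v = 0) (hk1 : e 1 1 v = k1 • v) (hk2 : e 2 2 v = k2 • v) :
    ((L1.map (tOp e t x)).prod * (L2.map (tOp e t x)).prod * (L3.map (tOp e t x)).prod *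
        (gridProd (rOp M t) L3 L2 * gridProd (rOp M t) L3 L1 * gridProd (rOp M t) L2 L1))
          (Pi.single col v) row =
      ∑ γ : ι → Fin 4, if (∀ i ∈ L1, γ i = 1) ∧ ∀ i ∈ L3, γ i = 2 then
        ∑ α : ι → Fin 4, if ∀ i, i ∉ L2 → α i = γ i then
          (L2.map fun i => lMat e (recip t x i) (α i) (γ i)).prod
            (((L1.map fun i => -recip t x i).prod *
              bethe (fun i => -t i) (-(x - k1)) 1 0 L2 α L1.toFinset) •
              (-1 : K) ^ (L1.length - excited 0 L2 α) • (e 1 0 ^ (L1.length - excited 0 L2 α))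
                (((L3.map (recip t x)).prod * bethe t (x - k2) 2 3 L2 γ L3.toFinset) •
                  (e 3 2 ^ (L3.length - excited 3 L2 γ)) v))
          else 0
        else 0 := by
  rw [nested_reorder he ht hx h1 h2 h3 h21 h31 h32, Module.End.mul_apply]
  set g := (L3.map fun l => tOp e t x l * rho (Fin 4) M t l L1 * rho (Fin 4) M t l L2).prod
    (Pi.single col v) with hg
  have hg' := fun (γ : ι → Fin 4) (hγ : ∀ i ∈ L3, γ i = 2) => third_group he ht hx h1 h2 h3 h21 h31 h32 hcov
    hc1 hc2 hc3 hv hk2 hγ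
  have hloc : ActsOn (gridProd (rOp M t) L2 L1 * ((L2 ++ L1).map (tOp e t x)).prod)
      fun i => i ∈ L2 ++ L1 := by
    refine ActsOn.mul (ActsOn.listProd fun O hO => ?_) (ActsOn.listProd fun O hO => ?_)
    · obtain ⟨i, hi, rfl⟩ := List.mem_map.1 hO
      exact leftProd_crossOp_actsOn _ (List.mem_append_left _ hi)
        fun j hj => List.mem_append_right _ hj
    · obtain ⟨i, hi, rfl⟩ := List.mem_map.1 hO
      exact siteOp_actsOn _ hi
  -- The left factors do not touch the third group, so its colours are those of the row, all equal
  -- to 2; with these, `third_group` leaves only colour 1 on the first group.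
  rw [hloc g (∑ γ : ι → Fin 4, if (∀ i ∈ L1, γ i = 1) ∧ ∀ i ∈ L3, γ i = 2 then
    Pi.single γ (g γ) else 0) row, map_sum, Finset.sum_apply]
  · refine Finset.sum_congr rfl fun γ _ => ?_
    split_ifs with hγ
    · have hk : e 1 1 (g γ) = k1 • g γ := by
        have hco : Commute (e 1 1) (e 3 2) := he.commute (by decide) (by decide)
        have := LinearMap.congr_fun (hco.pow_right (L3.length - excited 3 L2 γ)).eq v
        simp only [Module.End.mul_apply, hk1, map_smul] at this
        rw [hg, hg' γ hγ.2, if_pos hγ.1, map_smul, this, smul_comm]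
      rw [first_groups he ht hx h1 h2 h21 hr1 hr2 hk hγ.1]
      · rw [hg, hg' γ hγ.2, if_pos hγ.1]
      · intro i hi hi'
        have : i ∈ L3 := by have := hcov i; tauto
        rw [hγ.2 i this, hr3 i this]
    · simp
  · intro β hβ
    have hβ3 : ∀ i ∈ L3, β i = 2 := fun i hi => by
      rw [hβ i, hr3 i hi]
      simp only [List.mem_append, not_or]
      exact ⟨h32 i hi, h31 i hi⟩
    rw [Finset.sum_apply, Finset.sum_eq_single β]
    · by_cases h : ∀ i ∈ L1, β i = 1
      · rw [if_pos ⟨h, hβ3⟩, Pi.single_eq_same]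
      · rw [if_neg fun h' => h h'.1, hg, hg' β hβ3, if_neg h]
        rfl
    · intro γ _ hγ
      split_ifs
      · exact Pi.single_eq_of_ne hγ.symm _
      · rfl
    · simp

end Nested

/-! ### The coefficient functions by recursion -/

section Symmetrization

variable {K : Type*} [Field K]

theorem qFun_succ {m : ℕ} (t : Fin (m + 1) → K) :
    qFun t = (∏ j : Fin m, (t 0 - t j.succ - 1) / (t 0 - t j.succ)) * qFun (t ∘ Fin.succ) := by
  simp only [qFun, Fin.prod_univ_succ (n := m), Fin.prod_Ioi_zero, Fin.prod_Ioi_succ,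
    Function.comp_apply]

/-- The tuple obtained from `t` by moving `t_p` to the front and deleting it. -/
def deleteAt {A : Type*} {m : ℕ} (t : Fin (m + 1) → A) (p : Fin (m + 1)) : Fin m → A :=
  t ∘ Equiv.swap 0 p ∘ Fin.succ

/-- Permutations are sorted by the variable t_p placed first. Its factors in Q run over all the
other variables, so their product is independent of the order of the rest. -/
theorem symBar_succ {m : ℕ} {f : (Fin (m + 1) → K) → K} {f' : (Fin m → K) → K} {g : K → K}
    (hf : ∀ s, f s = g (s 0) * f' (s ∘ Fin.succ)) (t : Fin (m + 1) → K) :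
    symBar f t = ∑ p, g (t p) *
      (∏ j, (t p - deleteAt t p j - 1) / (t p - deleteAt t p j)) * symBar f' (deleteAt t p) := by
  rw [symBar, ← Equiv.Perm.decomposeFin.symm.sum_comp, Fintype.sum_prod_type]
  refine Finset.sum_congr rfl fun p _ => ?_
  rw [symBar, Finset.mul_sum]
  refine Finset.sum_congr rfl fun σ _ => ?_
  have h0 : (t ∘ Equiv.Perm.decomposeFin.symm (p, σ)) 0 = t p := by simp
  have h1 : (t ∘ Equiv.Perm.decomposeFin.symm (p, σ)) ∘ Fin.succ = deleteAt t p ∘ σ := by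
    funext j
    simp [deleteAt]
  have h2 : ∀ j : Fin m, (t ∘ Equiv.Perm.decomposeFin.symm (p, σ)) j.succ =
      (deleteAt t p) (σ j) := fun j => congrFun h1 j
  rw [hf, qFun_succ, h0, h1]
  simp only [h2]
  rw [Equiv.prod_comp σ fun j => (t p - deleteAt t p j - 1) / (t p - deleteAt t p j)]
  ring

theorem fFun_eq {ξ k n : ℕ} (I : Finset (Fin k)) (hn : I.card = n) (t : Fin ξ → K)
    (z : Fin k → K) :
    fFun I t z = ∏ a : Fin ξ, if h : a.val < n then
      1 / (t a - z (I.orderEmbOfFin hn ⟨a.val, h⟩)) *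
        ∏ l ∈ Finset.Ioi (I.orderEmbOfFin hn ⟨a.val, h⟩), (t a - z l + 1) / (t a - z l)
    else 1 := by
  subst hn
  rfl

/-- The subset of `{2, …, k + 1}` in `I`, renumbered. -/
def tailSet {k : ℕ} (I : Finset (Fin (k + 1))) : Finset (Fin k) := {j | j.succ ∈ I}

theorem card_tailSet_of_mem {k : ℕ} {I : Finset (Fin (k + 1))} (h : 0 ∈ I) :
    I.card = (tailSet I).card + 1 := by
  have : I = insert 0 ((tailSet I).map (Fin.succEmb k)) := by
    ext j
    refine Fin.cases ?_ (fun j => ?_) j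
    · simp [h]
    · simp [tailSet, Fin.succ_ne_zero]
  conv_lhs => rw [this]
  rw [Finset.card_insert_of_notMem (by simp [Fin.succ_ne_zero]), Finset.card_map]

theorem card_tailSet_of_notMem {k : ℕ} {I : Finset (Fin (k + 1))} (h : 0 ∉ I) :
    I.card = (tailSet I).card := by
  have : I = (tailSet I).map (Fin.succEmb k) := by
    ext j
    refine Fin.cases ?_ (fun j => ?_) j
    · simp [h, Fin.succ_ne_zero]
    · simp [tailSet]
  conv_lhs => rw [this]
  rw [Finset.card_map]

/-- When 0 lies in I it is its least element, so the first variable is paired with it and the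
product over later sites includes all of them. -/
theorem fFun_of_mem {ξ k : ℕ} {I : Finset (Fin (k + 1))} (h0 : 0 ∈ I) (t : Fin (ξ + 1) → K)
    (z : Fin (k + 1) → K) :
    fFun I t z = (1 / (t 0 - z 0) * ∏ l : Fin k, (t 0 - z l.succ + 1) / (t 0 - z l.succ)) *
      fFun (tailSet I) (t ∘ Fin.succ) (z ∘ Fin.succ) := by
  have hcard := card_tailSet_of_mem h0
  have hu : (Fin.cons 0 (Fin.succ ∘ (tailSet I).orderEmbOfFin rfl) : Fin _ → Fin (k + 1)) =
      I.orderEmbOfFin hcard := by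
    refine Finset.orderEmbOfFin_unique hcard (fun j => ?_) ?_
    · refine Fin.cases ?_ (fun j => ?_) j
      · simpa using h0
      · exact (Finset.mem_filter.1 (Finset.orderEmbOfFin_mem (tailSet I) rfl j)).2
    · intro a b
      refine Fin.cases ?_ (fun b => ?_) b
      · exact fun h => absurd h (Fin.not_lt_zero _)
      · refine Fin.cases (fun _ => ?_) (fun a hab => ?_) a
        · exact Fin.succ_pos _
        · exact Fin.succ_lt_succ_iff.2
            (((tailSet I).orderEmbOfFin rfl).strictMono (Fin.succ_lt_succ_iff.1 hab))
  rw [fFun_eq I hcard, Fin.prod_univ_succ, fFun]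
  congr 1
  · rw [dif_pos (by simp)]
    have : I.orderEmbOfFin hcard ⟨((0 : Fin (ξ + 1)) : ℕ), by simp⟩ = 0 := by
      rw [← hu]; rfl
    rw [this, Fin.prod_Ioi_zero]
  · refine Finset.prod_congr rfl fun a _ => ?_
    by_cases ha : a.val < (tailSet I).card
    · have hv : ((a.succ : Fin (ξ + 1)) : ℕ) < (tailSet I).card + 1 := by simpa using ha
      have : I.orderEmbOfFin hcard ⟨((a.succ : Fin (ξ + 1)) : ℕ), hv⟩ =
          ((tailSet I).orderEmbOfFin rfl ⟨a.val, ha⟩).succ := by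
        rw [← hu]; rfl
      rw [dif_pos ha, dif_pos hv, this, Fin.prod_Ioi_succ]
      rfl
    · rw [dif_neg ha, dif_neg (by simpa using ha)]

theorem fFun_of_notMem {ξ k : ℕ} {I : Finset (Fin (k + 1))} (h0 : 0 ∉ I) (t : Fin ξ → K)
    (z : Fin (k + 1) → K) : fFun I t z = fFun (tailSet I) t (z ∘ Fin.succ) := by
  have hcard := card_tailSet_of_notMem h0
  have hu : (Fin.succ ∘ (tailSet I).orderEmbOfFin rfl : Fin _ → Fin (k + 1)) =
      I.orderEmbOfFin hcard := by
    refine Finset.orderEmbOfFin_unique hcard (fun j => ?_) ?_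
    · exact (Finset.mem_filter.1 (Finset.orderEmbOfFin_mem (tailSet I) rfl j)).2
    · exact (Fin.strictMono_succ).comp (OrderEmbedding.strictMono _)
  rw [fFun_eq I hcard, fFun]
  refine Finset.prod_congr rfl fun a _ => ?_
  by_cases ha : a.val < (tailSet I).card
  · have : I.orderEmbOfFin hcard ⟨a.val, ha⟩ =
        ((tailSet I).orderEmbOfFin rfl ⟨a.val, ha⟩).succ := by
      rw [← hu]; rfl
    rw [dif_pos ha, dif_pos ha, this, Fin.prod_Ioi_succ]
    rfl
  · rw [dif_neg ha, dif_neg ha]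

theorem vFun_of_notMem {ξ k : ℕ} {I : Finset (Fin (k + 1))} (h0 : 0 ∉ I) (t : Fin ξ → K)
    (z : Fin (k + 1) → K) (y : K) : vFun I t z y = vFun (tailSet I) t (z ∘ Fin.succ) y := by
  simp only [vFun, fFun_of_notMem h0, card_tailSet_of_notMem h0]

theorem vFun_of_mem {ξ k : ℕ} {I : Finset (Fin (k + 1))} (h0 : 0 ∈ I) (t : Fin (ξ + 1) → K)
    (z : Fin (k + 1) → K) (y : K) :
    vFun I t z y = ∑ p, ((t p - y) * (∏ l : Fin k, (t p - z l.succ + 1) / (t p - z l.succ)) /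
        (t p - z 0)) * (∏ j, (t p - deleteAt t p j - 1) / (t p - deleteAt t p j)) *
          vFun (tailSet I) (deleteAt t p) (z ∘ Fin.succ) y := by
  have hcard := card_tailSet_of_mem h0
  rw [vFun, hcard, symBar_succ (f' := fun s => fFun (tailSet I) s (z ∘ Fin.succ) *
      ∏ a : Fin ξ with a.val < (tailSet I).card, (s a - y))
    (g := fun a => (a - y) * (∏ l : Fin k, (a - z l.succ + 1) / (a - z l.succ)) / (a - z 0)),
    Finset.mul_sum]
  · refine Finset.sum_congr rfl fun p _ => ?_
    rw [vFun, Nat.add_sub_add_right]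
    ring
  · intro s
    rw [fFun_of_mem h0, Finset.prod_filter, Fin.prod_univ_succ, Finset.prod_filter]
    simp only [Fin.val_zero, Nat.zero_lt_succ, if_true, Fin.val_succ, Nat.add_lt_add_iff_right,
      Function.comp_apply]
    ring

theorem image_deleteAt {A : Type*} [DecidableEq A] {m : ℕ} {s : Fin (m + 1) → A}
    (hs : Function.Injective s) (p : Fin (m + 1)) :
    Finset.univ.image (deleteAt s p) = (Finset.univ.image s).erase (s p) := by
  ext x
  simp only [Finset.mem_image, Finset.mem_univ, true_and, Finset.mem_erase, deleteAt,
    Function.comp_apply]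
  constructor
  · rintro ⟨j, rfl⟩
    refine ⟨fun h => ?_, _, rfl⟩
    have := hs h
    rw [Equiv.swap_apply_eq_iff, Equiv.swap_apply_right] at this
    exact Fin.succ_ne_zero _ this
  · rintro ⟨h, a, rfl⟩
    have : Equiv.swap 0 p a ≠ 0 := by
      rw [Ne, Equiv.swap_apply_eq_iff, Equiv.swap_apply_left]
      exact fun e => h (e ▸ rfl)
    obtain ⟨j, hj⟩ := Fin.exists_succ_eq.2 this
    exact ⟨j, by rw [hj, Equiv.swap_apply_self]⟩

theorem deleteAt_injective {A : Type*} {m : ℕ} {s : Fin (m + 1) → A}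
    (hs : Function.Injective s) (p : Fin (m + 1)) : Function.Injective (deleteAt s p) :=
  hs.comp ((Equiv.injective _).comp (Fin.succ_injective _))

theorem prod_deleteAt {ι : Type*} [DecidableEq ι] {t : ι → K} (ht : Function.Injective t) {m : ℕ}
    {s : Fin (m + 1) → ι} (hs : Function.Injective s) (p : Fin (m + 1)) :
    ∏ j, (t (s p) - deleteAt (t ∘ s) p j - 1) / (t (s p) - deleteAt (t ∘ s) p j) =
      cross t (s p) ((Finset.univ.image s).erase (s p)) := by
  rw [cross, ← image_deleteAt hs, Finset.prod_image fun a _ b _ h => deleteAt_injective hs p h]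
  refine Finset.prod_congr rfl fun j _ => ?_
  have hne : deleteAt s p j ≠ s p := by
    have : deleteAt s p j ∈ (Finset.univ.image s).erase (s p) := by
      rw [← image_deleteAt hs]
      simp
    exact (Finset.mem_erase.1 this).1
  have h := sub_ne_zero.2 (ht.ne hne.symm)
  change (t (s p) - t (deleteAt s p j) - 1) / (t (s p) - t (deleteAt s p j)) = _
  rw [sub_div, div_self h]

/-- Splitting off the first variable reduces this to `sum_cross`. It explains the normalization 1/(ξ
- |I|)! of V_I: the variables attached to no site contribute this factorial. -/
theorem symBar_one {ι : Type*} [DecidableEq ι] {t : ι → K} (ht : Function.Injective t) {m : ℕ}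
    {s : Fin m → ι} (hs : Function.Injective s) : symBar (fun _ => 1) (t ∘ s) = (m ! : K) := by
  induction m with
  | zero => simp [symBar, qFun]
  | succ m ih =>
    rw [symBar_succ (f' := fun _ => 1) (g := fun _ => 1) (by simp)]
    have h : ∀ p, symBar (fun _ => 1) (deleteAt (t ∘ s) p) = (m ! : K) := fun p =>
      ih (deleteAt_injective hs p)
    simp only [h, Function.comp_apply, one_mul]
    rw [← Finset.sum_mul]
    simp only [← Function.comp_apply (f := t) (g := s)]
    have := sum_cross ht (Finset.univ.image s)
    rw [Finset.sum_image fun a _ b _ h => hs h, Finset.card_image_of_injective _ hs] at this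
    simp only [Function.comp_apply, prod_deleteAt ht hs, this]
    simp [Nat.factorial_succ]

/-- The coefficients of Bethe vectors are the functions `V_I`. -/
theorem bethe_eq_vFun [CharZero K] {ι C : Type*} [DecidableEq ι] [DecidableEq C] {t : ι → K}
    (ht : Function.Injective t) (y : K) {p q : C} {α : ι → C} {k m : ℕ}
    {σ : Fin k → ι} {s : Fin m → ι} (hs : Function.Injective s) (hsσ : ∀ a j, s a ≠ σ j)
    (hα : ∀ j, α (σ j) = p ∨ α (σ j) = q) {I : Finset (Fin k)} (hI : ∀ j, j ∈ I ↔ α (σ j) = q)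
    (hcard : I.card ≤ m) :
    bethe t y p q ((List.finRange k).map σ) α (Finset.univ.image s) =
      vFun I (t ∘ s) (t ∘ σ) y := by
  induction k generalizing m with
  | zero =>
    have : I = ∅ := Subsingleton.elim _ _
    subst this
    have hf : (fun r : Fin m → K => fFun (∅ : Finset (Fin 0)) r (t ∘ σ) *
        ∏ a : Fin m with a.val < (∅ : Finset (Fin 0)).card, (r a - y)) = fun _ => 1 := by
      funext r
      simp [fFun]
    rw [vFun, hf, symBar_one ht hs]
    simp only [List.finRange_zero, List.map_nil, bethe, Finset.card_empty, Nat.sub_zero]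
    rw [one_div, inv_mul_cancel₀]
    exact_mod_cast m.factorial_ne_zero
  | succ k ih =>
    rw [List.finRange_succ, List.map_cons, List.map_map]
    have hI' : ∀ j, j ∈ tailSet I ↔ α ((σ ∘ Fin.succ) j) = q := fun j => by
      simp [tailSet, hI]
    replace ih := fun {m} {s : Fin m → ι} (hs : Function.Injective s) hsσ =>
      ih (m := m) (s := s) (σ := σ ∘ Fin.succ) (I := tailSet I) hs hsσ (fun j => hα j.succ) hI'
    by_cases h0 : 0 ∈ I
    · have hq := (hI 0).1 h0
      have hc := card_tailSet_of_mem h0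
      obtain ⟨m, rfl⟩ : ∃ m', m = m' + 1 := ⟨m - 1, by omega⟩
      rw [vFun_of_mem h0, bethe, if_pos hq, attach, Finset.sum_image fun a _ b _ h => hs h]
      refine Finset.sum_congr rfl fun a _ => ?_
      rw [Function.comp_apply, prod_deleteAt ht hs, ← image_deleteAt hs,
        ih (deleteAt_injective hs a) (fun b j => hsσ _ _) (by omega)]
      congr 3
      -- The eigenvalue for the sites after the current one is the product over m > i_a in V_I.
      rw [diagEigen, List.map_map, ← List.ofFn_eq_map, List.prod_ofFn]
      congr 1
      refine Finset.prod_congr rfl fun l _ => ?_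
      have h := sub_ne_zero.2 (ht.ne (hsσ a l.succ))
      simp only [Function.comp_apply]
      rw [add_div, div_self h]
    · have hq : α (σ 0) ≠ q := fun h => h0 ((hI 0).2 h)
      have hc := card_tailSet_of_notMem h0
      rw [vFun_of_notMem h0, bethe, if_neg hq, if_pos ((hα 0).resolve_right hq),
        ih hs (fun a j => hsσ _ _) (by omega)]
      rfl

/-- Negation changes the sign of the differences and reversal exchanges the two members of each
pair, so the two effects cancel. -/
theorem qFun_neg_rev {m : ℕ} (t : Fin m → K) : qFun (fun a => -t a.rev) = qFun t := by
  have h : ∀ i : Fin m, ∏ j ∈ Finset.Ioi i, (-t i.rev - -t j.rev - 1) / (-t i.rev - -t j.rev) =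
      ∏ j ∈ Finset.Iio i.rev, (t j - t i.rev - 1) / (t j - t i.rev) := by
    intro i
    refine Finset.prod_nbij' Fin.rev Fin.rev ?_ ?_ ?_ ?_ ?_
    · intro j hj; simpa using hj
    · intro j hj
      simp only [Finset.mem_Iio, Finset.mem_Ioi] at hj ⊢
      rwa [← Fin.rev_lt_rev, Fin.rev_rev]
    · intro j _; exact Fin.rev_rev j
    · intro j _; exact Fin.rev_rev j
    · intro j _
      rw [neg_sub_neg]
  simp only [qFun, h]
  rw [← Equiv.prod_comp Fin.revPerm]
  simp only [Fin.revPerm_apply, Fin.rev_rev]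
  refine Finset.prod_comm' fun i j => ?_
  simp

/-- Differences z - t are unchanged when both variables are negated and exchanged, so the sign comes
only from the |I| factors t - y. -/
theorem vTilde_eq {ξ k : ℕ} {I : Finset (Fin k)} (hI : I.card ≤ ξ) (t : Fin ξ → K)
    (z : Fin k → K) (y : K) :
    vTilde I t z y = (-1) ^ I.card * vFun I (fun a => -t a) (fun j => -z j) (-y) := by
  have hf : ∀ s : Fin ξ → K, fTilde I s z = fFun I (fun a => -s a.rev) (fun j => -z j) := by
    intro s
    simp only [fTilde, fFun, neg_sub_neg]
  have hp : ∀ s : Fin ξ → K, (∏ a : Fin ξ with a.val < I.card, (s a.rev - y)) =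
      (-1) ^ I.card * ∏ a : Fin ξ with a.val < I.card, (-s a.rev - -y) := by
    intro s
    have hc : (Finset.univ.filter fun a : Fin ξ => a.val < I.card).card = I.card := by
      rw [Fin.card_filter_val_lt, min_eq_right hI]
    have hone : (-1 : K) ^ I.card = ∏ a : Fin ξ with a.val < I.card, (-1) := by
      rw [Finset.prod_const, hc]
    rw [hone, ← Finset.prod_mul_distrib]
    refine Finset.prod_congr rfl fun a _ => ?_
    ring
  rw [vTilde, vFun, symBar, symBar, mul_left_comm]
  congr 1
  -- The reversed indexing in Ṽ is absorbed by reindexing the symmetrization with the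
  -- order-reversing permutation.
  rw [Finset.mul_sum, ← Equiv.sum_comp (Equiv.mulRight (Fin.revPerm : Equiv.Perm (Fin ξ)))]
  refine Finset.sum_congr rfl fun σ _ => ?_
  rw [hf, hp, ← qFun_neg_rev]
  have : (fun a : Fin ξ => -(t ∘ (Equiv.mulRight (Fin.revPerm : Equiv.Perm (Fin ξ)) σ)) a.rev) =
      (fun a => -t a) ∘ σ := by
    funext a
    simp
  simp only [fun a => congrFun this a]
  ring

end Symmetrization

/-! ### Series with coefficients in an algebra -/

section Series

variable {Γ : Type*} [AddCommMonoid Γ] [LinearOrder Γ] [IsOrderedCancelAddMonoid Γ]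

/-- Coefficientwise application of a ring homomorphism. -/
def serMap {A B : Type*} [Ring A] [Ring B] (f : A →+* B) : HahnSeries Γ A →+* HahnSeries Γ B where
  toFun x := x.map f
  map_zero' := by ext; simp
  map_one' := HahnSeries.map_one f.toMonoidWithZeroHom
  map_add' _ _ := HahnSeries.map_add f.toAddMonoidHom
  map_mul' _ _ := HahnSeries.map_mul f.toNonUnitalRingHom

theorem commute_serMap_algebraMap {A : Type*} [Ring A] [Algebra ℂ A] (f : HahnSeries Γ ℂ)
    (g : HahnSeries Γ A) :
    serMap (algebraMap ℂ A) f * g = g * serMap (algebraMap ℂ A) f := by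
  ext a
  rw [HahnSeries.coeff_mul, HahnSeries.coeff_mul]
  exact Finset.sum_equiv (Equiv.prodComm _ _)
    (fun _ => Finset.swap_mem_antidiagonal.symm) fun ij _ => Algebra.commutes _ _

end Series

/-! ### The variables in the field of series and substitution into power series -/

section Substitution

variable {m : ℕ} {ξ : Fin m → ℕ}

theorem charZero_ser : CharZero (Ser ξ ℂ) :=
  charZero_of_injective_ringHom (f := (HahnSeries.C : ℂ →+* Ser ξ ℂ)) HahnSeries.C_injective

/-- Together with `tVar_ne_C`, this makes the denominators t_i - t_j and t_i - x nonzero, as the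
rational identities require. -/
theorem tVar_injective : Function.Injective (tVar : Label ξ → Ser ξ ℂ) := by
  intro i j h
  have h1 := congrArg (fun f : Ser ξ ℂ => f.coeff (expo i (-1))) h
  by_contra hij
  simp only [tVar, HahnSeries.coeff_single_same] at h1
  rw [HahnSeries.coeff_single_of_ne] at h1
  · exact one_ne_zero h1
  · intro h2
    have := congrFun (congrArg ofLex h2) i
    simp [expo, Pi.single_eq_of_ne hij] at this

theorem tVar_ne_C (i : Label ξ) (x : ℂ) : tVar i ≠ HahnSeries.C x := by
  intro h
  have h1 := congrArg (fun f : Ser ξ ℂ => f.coeff (expo i (-1))) h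
  simp only [tVar, HahnSeries.coeff_single_same] at h1
  rw [HahnSeries.C_apply, HahnSeries.coeff_single_of_ne] at h1
  · exact one_ne_zero h1
  · intro h2
    have := congrFun (congrArg ofLex h2) i
    simp [expo] at this

/-- Substitution `u = t_i` as a ring homomorphism. -/
def substHom (A : Type*) [Ring A] (i : Label ξ) : PowerSeries A →+* Ser ξ A :=
  (HahnSeries.embDomainRingHom
    { toFun := fun k : ℕ => expo i (k : ℤ)
      map_zero' := by simp [expo]
      map_add' := fun k l => by
        simp only [expo, Nat.cast_add, Pi.single_add]; rfl }
    (expo_strictMono i).injective fun k l => (expo_strictMono i).le_iff_le).comp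
    HahnSeries.toPowerSeries.symm.toRingHom

theorem substHom_apply {A : Type*} [Ring A] (i : Label ξ) (f : PowerSeries A) :
    substHom A i f = substVar i f := rfl

theorem substHom_C {A : Type*} [Ring A] (i : Label ξ) (a : A) :
    substHom A i (PowerSeries.C a) = HahnSeries.C a := by
  have : HahnSeries.toPowerSeries.symm (PowerSeries.C a) = HahnSeries.C a := by
    ext n
    rw [HahnSeries.coeff_toPowerSeries_symm, PowerSeries.coeff_C, HahnSeries.C_apply,
      HahnSeries.coeff_single]
    congr
  show HahnSeries.embDomainRingHom _ _ _ (HahnSeries.toPowerSeries.symm (PowerSeries.C a)) = _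
  rw [this, HahnSeries.embDomainRingHom_C]

theorem substHom_X {A : Type*} [Ring A] (i : Label ξ) :
    substHom A i PowerSeries.X = HahnSeries.single (expo i 1) 1 := by
  have : HahnSeries.toPowerSeries.symm (PowerSeries.X : PowerSeries A) =
      HahnSeries.single 1 1 := by
    ext n
    rw [HahnSeries.coeff_toPowerSeries_symm, PowerSeries.coeff_X, HahnSeries.coeff_single]
    congr
  show HahnSeries.embDomain _ (HahnSeries.toPowerSeries.symm PowerSeries.X) = _
  rw [this, HahnSeries.embDomain_single]
  rfl

theorem coeff_substVar {A : Type*} [Ring A] (i : Label ξ) (g : PowerSeries A) (k : ℕ) :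
    (substVar i g).coeff (expo i (k : ℤ)) = g.coeff k :=
  HahnSeries.embDomain_coeff (f := OrderEmbedding.ofStrictMono _ (expo_strictMono i))

theorem coeff_substVar_of_ne {A : Type*} [Ring A] (i : Label ξ) (g : PowerSeries A) {a : Expo ξ}
    (h : ∀ k : ℕ, expo i (k : ℤ) ≠ a) : (substVar i g).coeff a = 0 :=
  HahnSeries.embDomain_of_notMem_range fun ⟨k, hk⟩ => h k hk

theorem serMap_substVar {A B : Type*} [Ring A] [Ring B] (F : A →+* B) (i : Label ξ)
    (f : PowerSeries A) : serMap F (substVar i f) = substVar i (PowerSeries.map F f) := by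
  ext a
  change F _ = _
  by_cases h : ∃ k : ℕ, expo i (k : ℤ) = a
  · obtain ⟨k, rfl⟩ := h
    rw [coeff_substVar, coeff_substVar, PowerSeries.coeff_map]
  · push Not at h
    rw [coeff_substVar_of_ne i _ h, coeff_substVar_of_ne i _ h, map_zero]

/-- The expansion of `(t_i - x)⁻¹`. -/
theorem substVar_geom (i : Label ξ) (x : ℂ) :
    substVar i (PowerSeries.X * PowerSeries.mk fun s => x ^ s) = 1 / (tVar i - HahnSeries.C x) := by
  have ht : tVar i * substHom ℂ i PowerSeries.X = 1 := by
    rw [substHom_X, tVar, HahnSeries.single_mul_single, mul_one]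
    have : expo i (-1) + expo i 1 = (0 : Expo ξ) := by
      show toLex ((Pi.single i (-1) : Label ξ → ℤ) + Pi.single i 1) = _
      rw [← Pi.single_add]
      simp
    rw [this]
    rfl
  have hg : (PowerSeries.mk fun s => x ^ s) * (1 - PowerSeries.C x * PowerSeries.X) = 1 := by
    ext s
    rcases s with _ | s
    · simp
    · rw [mul_sub, mul_one, map_sub, ← mul_assoc, PowerSeries.coeff_succ_mul_X,
        mul_comm, PowerSeries.coeff_C_mul]
      simp [pow_succ, mul_comm]
  rw [eq_div_iff (sub_ne_zero.2 (tVar_ne_C i x)), ← substHom_apply]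
  replace hg := congrArg (substHom ℂ i) hg
  simp only [map_mul, map_sub, map_one, substHom_C] at hg ⊢
  linear_combination hg + substHom ℂ i (PowerSeries.mk fun s => x ^ s) * ht

end Substitution

/-! ### Series of operators acting on a vector -/

section Evaluation

variable {V : Type*} [AddCommGroup V] [Module ℂ V]
  [LieRingModule (Matrix (Fin 4) (Fin 4) ℂ) V] [LieModule ℂ (Matrix (Fin 4) (Fin 4) ℂ) V]

theorem evalHom_T {n : ℕ} (a b : Fin n) (s : ℕ) : evalHom n (yangianT a b s) = evalT a b s :=
  yangianLift_T _ _ _ _ _ _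

theorem evalModule_T_zero (x : ℂ) (a b : Fin 4) :
    evalModule V x (yangianT a b 0) = if a = b then 1 else 0 := by
  rw [yangianT_zero]
  split_ifs <;> simp

/-- Evaluation kills the coefficients beyond the first, so only the summand j = 1 of the shift
survives, with coefficient x^s; these are the coefficients of (u - x)⁻¹. -/
theorem evalModule_T_succ (x : ℂ) (a b : Fin 4) (s : ℕ) :
    evalModule V x (yangianT a b (s + 1)) = x ^ s • eOp 4 V b a := by
  have h : shiftHom 4 x (yangianT a b (s + 1)) = shiftT x a b (s + 1) := yangianLift_T _ _ _ _ _ _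
  have h' : evalHom 4 (shiftT x a b (s + 1)) = x ^ s • UniversalEnvelopingAlgebra.ι ℂ (e b a) := by
    rw [shiftT, map_sum]
    simp only [map_smul, evalHom_T]
    rw [Finset.sum_eq_single 1]
    · simp [shiftCoeff, evalT]
    · rintro (_ | _ | j) _ hj
      · simp [shiftCoeff]
      · exact absurd rfl hj
      · simp [evalT]
    · intro hs
      simp at hs
  rw [evalModule, AlgHom.comp_apply, AlgHom.comp_apply, h, h', map_smul,
    UniversalEnvelopingAlgebra.lift_ι_apply]
  rfl

theorem isGlFamily_eOp : IsGlFamily (K := ℂ) (eOp 4 V) := by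
  intro a b c d
  have h : ⁅(e a b : Matrix (Fin 4) (Fin 4) ℂ), e c d⁆ =
      (if b = c then e a d else 0) - (if d = a then e c b else 0) := by
    rw [Ring.lie_def]
    unfold e
    congr 1 <;> split_ifs with h
    · subst h; simp
    · simp [h]
    · subst h; simp
    · simp [h]
  have h' := congrArg (LieModule.toEnd ℂ (Matrix (Fin 4) (Fin 4) ℂ) V) h
  rw [LieHom.map_lie, Ring.lie_def] at h'
  refine h'.trans ?_
  rw [map_sub]
  congr 1 <;> split_ifs <;> first | rfl | exact map_zero _

variable {m : ℕ} {ξ : Fin m → ℕ}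

theorem serMap_evalModule (x : ℂ) (i : Label ξ) (a b : Fin 4) :
    serMap (evalModule (n := 4) V x).toRingHom (substVar i (yangianSeries a b)) =
      (if a = b then 1 else 0) +
        scalarSer _ (1 / (tVar i - HahnSeries.C x)) * HahnSeries.C (eOp 4 V b a) := by
  have h : PowerSeries.map (evalModule (n := 4) V x).toRingHom (yangianSeries a b) =
      (if a = b then 1 else 0) + PowerSeries.map (algebraMap ℂ (Module.End ℂ V))
        (PowerSeries.X * PowerSeries.mk fun s => x ^ s) * PowerSeries.C (eOp 4 V b a) := by
    ext1 s
    rw [map_add, PowerSeries.coeff_mul_C, PowerSeries.coeff_map, PowerSeries.coeff_map,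
      yangianSeries, PowerSeries.coeff_mk, AlgHom.toRingHom_eq_coe, RingHom.coe_coe]
    rcases s with _ | s
    · rw [evalModule_T_zero]
      split_ifs <;> simp
    · rw [evalModule_T_succ, PowerSeries.coeff_succ_X_mul, PowerSeries.coeff_mk,
        ← Algebra.smul_def]
      split_ifs <;> simp [PowerSeries.coeff_one]
  rw [serMap_substVar, h, ← substVar_geom]
  change _ = _ + serMap (algebraMap ℂ (Module.End ℂ V)) _ * _
  rw [serMap_substVar, ← substHom_apply, ← substHom_apply, map_add, map_mul, substHom_C]
  split_ifs <;> simp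

end Evaluation

/-! ### The module of series of operators applied to a vector -/

section Quotient

variable {V : Type*} [AddCommGroup V] [Module ℂ V] {m : ℕ} {ξ : Fin m → ℕ}

/-- Series of operators as an algebra over the field of scalar series. -/
@[reducible] def serAlgebra (ξ : Fin m → ℕ) (V : Type*) [AddCommGroup V] [Module ℂ V] :
    Algebra (Ser ξ ℂ) (Ser ξ (Module.End ℂ V)) :=
  RingHom.toAlgebra' (serMap (algebraMap ℂ (Module.End ℂ V)) : Ser ξ ℂ →+* Ser ξ (Module.End ℂ V))
    fun c f => commute_serMap_algebraMap c f

attribute [local instance] serAlgebra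

/-- The left ideal of the series of operators that kill `v`. -/
def annihilator (ξ : Fin m → ℕ) (v : V) : Ideal (Ser ξ (Module.End ℂ V)) where
  carrier := {f | ∀ a, f.coeff a v = 0}
  zero_mem' _ := rfl
  add_mem' hf hg a := by
    rw [HahnSeries.coeff_add, LinearMap.add_apply, hf, hg, add_zero]
  smul_mem' c f hf a := by
    rw [smul_eq_mul, HahnSeries.coeff_mul, LinearMap.sum_apply]
    refine Finset.sum_eq_zero fun ij _ => ?_
    rw [Module.End.mul_apply, hf, map_zero]

/-- The module of series `f v`, where `f` is a series of operators. -/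
abbrev SerOrbit (ξ : Fin m → ℕ) (v : V) : Type _ := Ser ξ (Module.End ℂ V) ⧸ annihilator ξ v

/-- The action of series of operators. -/
def orbitAction (ξ : Fin m → ℕ) (v : V) :
    Ser ξ (Module.End ℂ V) →ₐ[Ser ξ ℂ] Module.End (Ser ξ ℂ) (SerOrbit ξ v) :=
  Algebra.lsmul (Ser ξ ℂ) (Ser ξ ℂ) (SerOrbit ξ v)

/-- The class `f v` of a series of operators `f`. -/
def orbitMk (ξ : Fin m → ℕ) (v : V) (f : Ser ξ (Module.End ℂ V)) : SerOrbit ξ v :=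
  (annihilator ξ v).mkQ f

theorem orbitAction_mk (v : V) (f g : Ser ξ (Module.End ℂ V)) :
    orbitAction ξ v f (orbitMk ξ v g) = orbitMk ξ v (f * g) := rfl

theorem smul_orbitMk (v : V) (c : Ser ξ ℂ) (g : Ser ξ (Module.End ℂ V)) :
    c • orbitMk ξ v g = orbitMk ξ v (scalarSer _ c * g) := rfl

theorem orbitAction_scalarSer (v : V) (c : Ser ξ ℂ) : orbitAction ξ v (scalarSer _ c) = c • 1 :=
  Algebra.algebraMap_eq_smul_one (A := Module.End (Ser ξ ℂ) (SerOrbit ξ v)) c ▸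
    (orbitAction ξ v).commutes c

/-- This converts identities over the field of series back into identities of V-valued series. -/
theorem orbitMk_eq_iff (v : V) (f g : Ser ξ (Module.End ℂ V)) :
    orbitMk ξ v f = orbitMk ξ v g ↔ ∀ a, f.coeff a v = g.coeff a v := by
  refine (Submodule.Quotient.eq _).trans (forall_congr' fun a => ?_)
  rw [HahnSeries.coeff_sub, LinearMap.sub_apply, sub_eq_zero]

end Quotient

/-! ### Matrices as operators on vector-valued functions of colourings -/

section MatrixOp

variable {K : Type*} [Field K] {M : Type*} [AddCommGroup M] [Module K M] {Y : Type*} [Ring Y]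

/-- The action on `I → M` of matrices with entries in a ring that acts on `M`. -/
def matOp {I : Type*} [Fintype I] [DecidableEq I] (F : Y →+* Module.End K M) :
    Matrix I I Y →+* Module.End K (I → M) where
  toFun A :=
    { toFun := fun f α => ∑ β, F (A α β) (f β)
      map_add' := fun f g => by
        funext α
        simp only [Pi.add_apply, map_add, Finset.sum_add_distrib]
      map_smul' := fun c f => by
        funext α
        simp only [Pi.smul_apply, map_smul, RingHom.id_apply, Finset.smul_sum] }
  map_zero' := by
    ext f α
    simp
  map_one' := by
    refine LinearMap.ext fun f => funext fun α => ?_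
    change ∑ β, F ((1 : Matrix I I Y) α β) (f β) = f α
    rw [Finset.sum_eq_single α]
    · simp
    · intro β _ h
      rw [Matrix.one_apply_ne h.symm, map_zero, LinearMap.zero_apply]
    · simp
  map_add' A B := by
    refine LinearMap.ext fun f => funext fun α => ?_
    change ∑ β, F ((A + B) α β) (f β) = ∑ β, F (A α β) (f β) + ∑ β, F (B α β) (f β)
    simp only [Matrix.add_apply, map_add, LinearMap.add_apply, Finset.sum_add_distrib]
  map_mul' A B := by
    refine LinearMap.ext fun f => funext fun α => ?_
    change ∑ β, F ((A * B) α β) (f β) = ∑ γ, F (A α γ) (∑ β, F (B γ β) (f β))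
    simp only [Matrix.mul_apply, map_sum, map_mul, LinearMap.sum_apply, Module.End.mul_apply]
    rw [Finset.sum_comm]

theorem matOp_apply {I : Type*} [Fintype I] [DecidableEq I] (F : Y →+* Module.End K M)
    (A : Matrix I I Y) (f : I → M) (α : I) : matOp F A f α = ∑ β, F (A α β) (f β) := rfl

theorem matOp_single {I : Type*} [Fintype I] [DecidableEq I] (F : Y →+* Module.End K M)
    (A : Matrix I I Y) (α β : I) (w : M) : matOp F A (Pi.single β w) α = F (A α β) w := by
  rw [matOp_apply, Finset.sum_eq_single β]
  · rw [Pi.single_eq_same]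
  · intro γ _ h
    rw [Pi.single_eq_of_ne h, map_zero]
  · simp

variable {ι : Type*} [DecidableEq ι] [Fintype ι] {C : Type*} [DecidableEq C] [Fintype C]

theorem matOp_site (F : Y →+* Module.End K M) (i : ι) (τ : C → C → Y)
    {A : Matrix (ι → C) (ι → C) Y}
    (hA : ∀ α β, A α β = if ∀ l, l ≠ i → α l = β l then τ (α i) (β i) else 0) :
    matOp F A = siteOp i fun a b => F (τ a b) := by
  refine LinearMap.ext fun f => funext fun α => ?_
  rw [matOp_apply, siteOp_apply]
  have h : ∀ β : ι → C, F (if ∀ l, l ≠ i → α l = β l then τ (α i) (β i) else 0) (f β) =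
      if ∀ l, l ≠ i → α l = β l then F (τ (α i) (β i)) (f β) else 0 := by
    intro β
    split_ifs <;> simp
  simp only [hA, h]
  rw [← Finset.sum_filter]
  refine Finset.sum_nbij' (fun β => β i) (fun b => Function.update α i b) ?_ ?_ ?_ ?_ ?_
  · simp
  · intro b _
    simp +contextual [Function.update_of_ne]
  · intro β hβ
    have hβ := (Finset.mem_filter.1 hβ).2
    funext l
    by_cases hl : l = i
    · subst hl; simp
    · simp [Function.update_of_ne hl, hβ l hl]
  · simp
  · intro β hβ
    have hβ := (Finset.mem_filter.1 hβ).2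
    congr 2
    funext l
    by_cases hl : l = i
    · subst hl; simp
    · simp [Function.update_of_ne hl, hβ l hl]

theorem matOp_cross (F : Y →+* Module.End K M) {i j : ι} (hij : i ≠ j) (c : K)
    (s : C × C → C × C → Y) (hs : ∀ a b, F (s a b) =
      ((if a = b then 1 else 0) + c * if a = b.swap then 1 else 0) • 1)
    {A : Matrix (ι → C) (ι → C) Y} (hA : ∀ α β, A α β =
      if ∀ l, l ≠ i → l ≠ j → α l = β l then s (α i, α j) (β i, β j) else 0) :
    matOp F A = crossOp M C c i j := by
  refine LinearMap.ext fun f => funext fun α => ?_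
  rw [matOp_apply, crossOp_apply]
  have h1 : ∀ β : ι → C, (∀ l, l ≠ i → l ≠ j → α l = β l) ∧ (α i, α j) = (β i, β j) ↔ β = α := by
    intro β
    constructor
    · rintro ⟨h, h'⟩
      funext l
      by_cases hi : l = i
      · subst hi; exact (congrArg Prod.fst h').symm
      by_cases hj : l = j
      · subst hj; exact (congrArg Prod.snd h').symm
      exact (h l hi hj).symm
    · rintro rfl
      simp
  have h2 : ∀ β : ι → C, (∀ l, l ≠ i → l ≠ j → α l = β l) ∧ (α i, α j) = (β i, β j).swap ↔
      β = α ∘ Equiv.swap i j := by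
    intro β
    constructor
    · rintro ⟨h, h'⟩
      funext l
      rw [Function.comp_apply]
      by_cases hi : l = i
      · subst hi; rw [Equiv.swap_apply_left]; exact (congrArg Prod.snd h').symm
      by_cases hj : l = j
      · subst hj; rw [Equiv.swap_apply_right]; exact (congrArg Prod.fst h').symm
      rw [Equiv.swap_apply_of_ne_of_ne hi hj]
      exact (h l hi hj).symm
    · rintro rfl
      refine ⟨fun l hi hj => ?_, ?_⟩
      · rw [Function.comp_apply, Equiv.swap_apply_of_ne_of_ne hi hj]
      · simp
  have h : ∀ β : ι → C,
      F (if ∀ l, l ≠ i → l ≠ j → α l = β l then s (α i, α j) (β i, β j) else 0) (f β) =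
        (if β = α then f α else 0) +
          if β = α ∘ Equiv.swap i j then c • f (α ∘ Equiv.swap i j) else 0 := by
    intro β
    by_cases h : ∀ l, l ≠ i → l ≠ j → α l = β l
    · have e1 := h1 β
      have e2 := h2 β
      rw [and_iff_right h] at e1 e2
      rw [if_pos h, hs, add_smul, LinearMap.add_apply]
      simp only [← e1, ← e2]
      congr 1
      · split_ifs with h'
        · rw [one_smul, Module.End.one_apply, e1.1 h']
        · rw [zero_smul, LinearMap.zero_apply]
      · split_ifs with h'
        · rw [mul_one, LinearMap.smul_apply, Module.End.one_apply, ← e2.1 h']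
        · rw [mul_zero, zero_smul, LinearMap.zero_apply]
    · rw [if_neg h, if_neg fun h' => h ((h1 β).2 h').1, if_neg fun h' => h ((h2 β).2 h').1, map_zero,
        LinearMap.zero_apply, add_zero]
  simp only [hA, h, Finset.sum_add_distrib, Finset.sum_ite_eq', Finset.mem_univ, if_true]

end MatrixOp

theorem rMatrix_apply (n : ℕ) {K : Type*} [Field K] (u : K) (a b : Fin n × Fin n) :
    rMatrix n u a b = (if a = b then 1 else 0) + u⁻¹ * if a = b.swap then 1 else 0 := by
  rw [rMatrix, Matrix.add_apply, Matrix.one_apply, Matrix.smul_apply, smul_eq_mul]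
  congr 2
  simp only [Matrix.sum_apply, Matrix.kroneckerMap_apply, Matrix.single_apply]
  rw [Finset.sum_eq_single a.1, Finset.sum_eq_single a.2]
  · obtain ⟨a1, a2⟩ := a
    obtain ⟨b1, b2⟩ := b
    simp only [Prod.swap, Prod.mk.injEq]
    split_ifs <;> simp_all
  · intro c _ h
    simp [h]
  · simp
  · intro c _ h
    simp [h]
  · simp

/-! ### The weight function as an operator -/

section WeightFunction

attribute [local instance] serAlgebra

variable {V : Type*} [AddCommGroup V] [Module ℂ V]
  [LieRingModule (Matrix (Fin 4) (Fin 4) ℂ) V] [LieModule ℂ (Matrix (Fin 4) (Fin 4) ℂ) V]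
  {ξ : Fin 3 → ℕ}

/-- The action of `e_{ab}` on series. -/
def orbitGl (ξ : Fin 3 → ℕ) (v : V) (a b : Fin 4) : Module.End (Ser ξ ℂ) (SerOrbit ξ v) :=
  orbitAction ξ v (HahnSeries.C (eOp 4 V a b))

theorem isGlFamily_orbitGl (v : V) : IsGlFamily (orbitGl ξ v) := by
  intro a b c d
  have h := congrArg (fun f => orbitAction ξ v (HahnSeries.C f)) (isGlFamily_eOp (V := V) a b c d)
  simp only [map_sub, map_mul] at h
  refine h.trans ?_
  congr 1 <;> split_ifs <;> first | rfl | simp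

theorem smul_one_mul_end {K M : Type*} [CommSemiring K] [AddCommMonoid M] [Module K M] (c : K)
    (A : Module.End K M) : (c • 1 : Module.End K M) * A = c • A := by
  rw [smul_mul_assoc, one_mul]

/-- The action of series with coefficients in the Yangian. -/
def orbitYangian (ξ : Fin 3 → ℕ) (v : V) (x : ℂ) :
    Ser ξ (Yangian 4) →+* Module.End (Ser ξ ℂ) (SerOrbit ξ v) :=
  (orbitAction ξ v).toRingHom.comp (serMap (evalModule (n := 4) V x).toRingHom)

theorem orbitYangian_series (v : V) (x : ℂ) (i : Label ξ) (a b : Fin 4) :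
    orbitYangian ξ v x (substVar i (yangianSeries a b)) =
      lMat (orbitGl ξ v) (recip tVar (HahnSeries.C x) i) a b := by
  change orbitAction ξ v (serMap _ _) = _
  rw [serMap_evalModule, map_add, map_mul, orbitAction_scalarSer, smul_one_mul_end]
  unfold lMat
  congr 1
  split_ifs <;> simp

theorem orbitYangian_scalarSer (v : V) (x : ℂ) (c : Ser ξ ℂ) :
    orbitYangian ξ v x (scalarSer _ c) = c • 1 := by
  rw [← orbitAction_scalarSer]
  change orbitAction ξ v (serMap _ (scalarSer _ c)) = _
  congr 1
  ext a
  simp [serMap, scalarSer]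

theorem matOp_tFactor (v : V) (x : ℂ) (i : Label ξ) :
    matOp (orbitYangian ξ v x) (tFactor ξ i) = tOp (orbitGl ξ v) tVar (HahnSeries.C x) i := by
  rw [matOp_site (orbitYangian ξ v x) i (fun a b => substVar i (yangianSeries a b))
    (A := tFactor ξ i) fun α β => rfl]
  simp only [orbitYangian_series]
  rfl

theorem matOp_rFactor (v : V) (x : ℂ) {i j : Label ξ} (hij : i ≠ j) :
    matOp (orbitYangian ξ v x) (rFactor ξ i j) = rOp (SerOrbit ξ v) tVar i j := by
  rw [matOp_cross (orbitYangian ξ v x) hij (1 / (tVar i - tVar j))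
    (fun a b => scalarSer (Yangian 4) (rMatrix 4 (tVar i - tVar j) a b)) (fun a b => ?_)
    (A := rFactor ξ i j) fun α β => rfl]
  · rfl
  · rw [orbitYangian_scalarSer, rMatrix_apply, one_div]

theorem lab_ne {a b : Fin 3} (h : a ≠ b) (i : Fin (ξ a)) (j : Fin (ξ b)) : lab a i ≠ lab b j :=
  fun h' => h (congrArg (fun l : Label ξ => (ofLex l).1) h')

theorem lab_injective (a : Fin 3) : Function.Injective (lab (ξ := ξ) a) := by
  intro i j h
  have := congrArg ofLex h
  simpa [lab] using this

/-- The labels of the group `a`. -/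
def group (ξ : Fin 3 → ℕ) (a : Fin 3) : List (Label ξ) := (List.finRange (ξ a)).map (lab a)

theorem mem_group {a : Fin 3} {l : Label ξ} : l ∈ group ξ a ↔ (ofLex l).1 = a := by
  rw [group, List.mem_map]
  constructor
  · rintro ⟨i, _, rfl⟩
    rfl
  · rintro rfl
    exact ⟨(ofLex l).2, List.mem_finRange _, rfl⟩

theorem nodup_group (a : Fin 3) : (group ξ a).Nodup :=
  (List.nodup_finRange _).map (lab_injective a)

theorem matOp_tGroup (v : V) (x : ℂ) (a : Fin 3) :
    matOp (orbitYangian ξ v x) (tGroup ξ a) =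
      ((group ξ a).map (tOp (orbitGl ξ v) tVar (HahnSeries.C x))).prod := by
  rw [tGroup, map_list_prod, group, List.map_map, List.map_map]
  simp only [Function.comp_def, matOp_tFactor]

theorem matOp_rGroup (v : V) (x : ℂ) {a b : Fin 3} (h : a ≠ b) :
    matOp (orbitYangian ξ v x) (rGroup ξ a b) =
      gridProd (rOp (SerOrbit ξ v) tVar) (group ξ a) (group ξ b) := by
  rw [rGroup, gridProd, map_list_prod, List.map_map,
    show group ξ a = (List.finRange (ξ a)).map (lab a) from rfl, List.map_map]
  congr 1
  refine List.map_congr_left fun i _ => ?_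
  rw [Function.comp_apply, Function.comp_apply, map_list_prod, leftProd, List.map_map, group, ← List.map_reverse,
    List.map_map]
  congr 1
  exact List.map_congr_left fun j _ => matOp_rFactor v x (lab_ne h i j)

theorem matOp_tHat (v : V) (x : ℂ) :
    matOp (orbitYangian ξ v x) (tHat ξ) =
      ((group ξ 0).map (tOp (orbitGl ξ v) tVar (HahnSeries.C x))).prod *
        ((group ξ 1).map (tOp (orbitGl ξ v) tVar (HahnSeries.C x))).prod *
        ((group ξ 2).map (tOp (orbitGl ξ v) tVar (HahnSeries.C x))).prod *
        (gridProd (rOp (SerOrbit ξ v) tVar) (group ξ 2) (group ξ 1) *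
          gridProd (rOp (SerOrbit ξ v) tVar) (group ξ 2) (group ξ 0) *
          gridProd (rOp (SerOrbit ξ v) tVar) (group ξ 1) (group ξ 0)) := by
  have h3 : List.finRange 3 = [0, 1, 2] := rfl
  have f2 : ([0, 1, 2] : List (Fin 3)).filter (fun b => b < 2) = [0, 1] := rfl
  have h : tHat ξ = tGroup ξ 0 * tGroup ξ 1 * tGroup ξ 2 *
      (rGroup ξ 2 1 * rGroup ξ 2 0 * rGroup ξ 1 0) := by
    rw [tHat, h3]
    simp [f2, mul_assoc]
  rw [h]
  simp only [map_mul, matOp_tGroup]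
  rw [matOp_rGroup v x (show (2 : Fin 3) ≠ 1 by decide),
    matOp_rGroup v x (show (2 : Fin 3) ≠ 0 by decide),
    matOp_rGroup v x (show (1 : Fin 3) ≠ 0 by decide)]

/-- The class of 1 plays the role of `v`. A matrix entry is read off by applying the matrix to a
function supported at the column and evaluating at the row, which puts `betheB` in the form treated
by `nested_value`. -/
theorem orbitMk_betheB {Λ : Fin 4 → ℂ} {v : V} (hv : IsSingularVector Λ v) (x : ℂ) :
    orbitMk ξ v (serMap (evalModule (n := 4) V x).toRingHom (betheB ξ)) =
      ∑ γ : Label ξ → Fin 4, if (∀ i ∈ group ξ 0, γ i = 1) ∧ ∀ i ∈ group ξ 2, γ i = 2 then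
        ∑ α : Label ξ → Fin 4, if ∀ i, i ∉ group ξ 1 → α i = γ i then
          ((group ξ 1).map fun i =>
            lMat (orbitGl ξ v) (recip tVar (HahnSeries.C x) i) (α i) (γ i)).prod
            ((((group ξ 0).map fun i => -recip tVar (HahnSeries.C x) i).prod *
              bethe (fun i => -tVar i) (-(HahnSeries.C x - HahnSeries.C (Λ 1))) 1 0 (group ξ 1) α
                (group ξ 0).toFinset) •
              (-1 : Ser ξ ℂ) ^ ((group ξ 0).length - excited 0 (group ξ 1) α) •
                (orbitGl ξ v 1 0 ^ ((group ξ 0).length - excited 0 (group ξ 1) α))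
                (((((group ξ 2).map (recip tVar (HahnSeries.C x))).prod *
                  bethe tVar (HahnSeries.C x - HahnSeries.C (Λ 2)) 2 3 (group ξ 1) γ
                    (group ξ 2).toFinset) •
                  (orbitGl ξ v 3 2 ^ ((group ξ 2).length - excited 3 (group ξ 1) γ))
                    (orbitMk ξ v 1))))
          else 0
        else 0 := by
  have := charZero_ser (ξ := ξ)
  have hC : ∀ (f : Module.End ℂ V) (c : ℂ), f v = c • v →
      orbitAction ξ v (HahnSeries.C f) (orbitMk ξ v 1) =
        (HahnSeries.C c : Ser ξ ℂ) • orbitMk ξ v 1 := by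
    intro f c hf
    rw [orbitAction_mk, smul_orbitMk, mul_one, mul_one, orbitMk_eq_iff]
    intro a
    simp only [scalarSer, HahnSeries.C_apply, HahnSeries.map_coeff, HahnSeries.coeff_single]
    split_ifs
    · simpa using hf
    · simp
  have hm := fun {i : Label ξ} {a : Fin 3} => (mem_group (ξ := ξ) (a := a) (l := i))
  have hk1 := hC (eOp 4 V 1 1) _ (hv.2 1)
  have hk2 := hC (eOp 4 V 2 2) _ (hv.2 2)
  have h12 := hC (eOp 4 V 1 2) 0 (by rw [zero_smul]; exact hv.1 1 2 (by decide))
  rw [map_zero] at h12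
  replace h12 := h12.trans (zero_smul (Ser ξ ℂ) (orbitMk ξ v 1))
  have key := nested_value (isGlFamily_orbitGl v) tVar_injective (fun i => tVar_ne_C i x)
    (nodup_group 0) (nodup_group 1) (nodup_group 2) (by simp +contextual [hm])
    (by simp +contextual [hm]) (by simp +contextual [hm])
    (fun i => by simp only [hm]; generalize (ofLex i).1 = a; fin_cases a <;> simp)
    (col := fun l => (ofLex l).1.succ) (row := fun l => (ofLex l).1.castSucc)
    (fun i hi => by simp [hm.1 hi]) (fun i hi => by simp [hm.1 hi])
    (fun i hi => by simp [hm.1 hi]) (fun i hi => by simp [hm.1 hi])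
    (fun i hi => by simp [hm.1 hi]) (fun i hi => by simp [hm.1 hi])
    h12 hk1 hk2
  rw [← matOp_tHat v x, matOp_single] at key
  refine Eq.trans ?_ key
  rw [← mul_one (serMap _ _), ← orbitAction_mk]
  rfl

end WeightFunction

/-! ### Colourings as subsets -/

section Recolour

variable {ι : Type*} [DecidableEq ι] {C : Type*} [DecidableEq C] {k : ℕ}

/-- The colouring that takes the value `q` at `s j` for `j ∈ I`, the value `p` at `s j` for
`j ∉ I`, and that agrees with `base` elsewhere. -/
def recolour (s : Fin k → ι) (base : ι → C) (p q : C) (I : Finset (Fin k)) (l : ι) : C :=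
  if ∃ j ∈ I, s j = l then q else if ∃ j, s j = l then p else base l

variable {s : Fin k → ι} (hs : Function.Injective s) {base : ι → C} {p q : C}
include hs

theorem recolour_apply (I : Finset (Fin k)) (j : Fin k) :
    recolour s base p q I (s j) = if j ∈ I then q else p := by
  simp [recolour, hs.eq_iff]

theorem recolour_of_ne (I : Finset (Fin k)) {l : ι} (h : ∀ j, s j ≠ l) :
    recolour s base p q I l = base l := by
  simp [recolour, h]

/-- A colouring prescribed off the sites and using only p and q on them is determined by the set of
sites of colour q. -/
theorem sum_recolour [Fintype ι] [Fintype C] {N : Type*} [AddCommMonoid N] (hpq : p ≠ q)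
    (P : (ι → C) → Prop) [DecidablePred P] (hP : ∀ γ, P γ ↔ ∀ l, (∀ j, s j ≠ l) → γ l = base l)
    (F : (ι → C) → N) (hF : ∀ γ, (∃ j, γ (s j) ≠ p ∧ γ (s j) ≠ q) → F γ = 0) :
    ∑ γ, (if P γ then F γ else 0) = ∑ I, F (recolour s base p q I) := by
  rw [← Finset.sum_filter]
  symm
  refine Finset.sum_of_injOn (recolour s base p q) ?_ ?_ ?_ fun _ _ => rfl
  · intro I _ J _ h
    ext j
    have := congrFun h (s j)
    rw [recolour_apply hs, recolour_apply hs] at this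
    by_cases hI : j ∈ I <;> by_cases hJ : j ∈ J <;> simp_all
  · intro I _
    simp only [Finset.coe_filter, Finset.mem_univ, true_and, Set.mem_ofPred_eq, hP]
    exact fun l hl => recolour_of_ne hs I hl
  · intro γ hγ h
    have hγ := (hP γ).1 (Finset.mem_filter.1 hγ).2
    refine hF γ ?_
    by_contra! hne
    refine h ⟨({j | γ (s j) = q} : Finset (Fin k)), by simp, ?_⟩
    funext l
    by_cases hl : ∃ j, s j = l
    · obtain ⟨j, rfl⟩ := hl
      rw [recolour_apply hs]
      by_cases hj : γ (s j) = q
      · simp [hj]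
      · have : γ (s j) = p := by_contra fun h' => hj (hne j h')
        simp [this, hpq]
    · push Not at hl
      rw [recolour_of_ne hs _ hl, hγ l hl]

end Recolour

theorem countP_finRange {k : ℕ} (P : Fin k → Prop) [DecidablePred P] :
    (List.finRange k).countP (fun j => P j) = (Finset.univ.filter P).card := by
  rw [List.countP_eq_length_filter]
  rfl

/-! ### Colourings with vanishing Bethe coefficient -/

section BetheVanishing

variable {K : Type*} [Field K] {ι : Type*} [DecidableEq ι] {C : Type*} [DecidableEq C]

theorem bethe_eq_zero_of_ne (t : ι → K) (y : K) {p q : C} {s : List ι} {α : ι → C}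
    (h : ∃ i ∈ s, α i ≠ p ∧ α i ≠ q) (S : Finset ι) : bethe t y p q s α S = 0 := by
  induction s generalizing S with
  | nil => simp at h
  | cons i s ih =>
    rw [bethe]
    by_cases hi : α i ≠ p ∧ α i ≠ q
    · rw [if_neg hi.2, if_neg hi.1]
    · have ih := ih (by simpa [hi] using h)
      split_ifs <;> simp [attach, ih]

/-- Each excited site consumes one variable, and the recursion reaches an empty sum once they run
out. -/
theorem bethe_eq_zero_of_card_lt (t : ι → K) (y : K) {p q : C} {s : List ι} {α : ι → C}
    {S : Finset ι} (h : S.card < excited q s α) : bethe t y p q s α S = 0 := by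
  induction s generalizing S with
  | nil => simp [excited] at h
  | cons i s ih =>
    rw [excited_cons] at h
    rw [bethe]
    split_ifs at h ⊢ with h1 h2
    · refine Finset.sum_eq_zero fun b hb => ?_
      rw [ih, mul_zero]
      have := Finset.card_erase_add_one hb
      omega
    · exact ih h
    · rfl

end BetheVanishing

/-! ### The middle factor as a product of commuting operators -/

section Lowering

variable {K : Type*} [Field K] [CharZero K] {M : Type*} [AddCommGroup M] [Module K M]
  {e : Fin 4 → Fin 4 → Module.End K M}

/-- The row colours lie in {0, 1} and the column colours in {2, 3}, so the Kronecker delta in `lMat`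
drops out and commuting lowering operators remain. They are sorted by membership of the site in I
and in J. -/
theorem IsGlFamily.prod_lowering (he : IsGlFamily e) {k : ℕ} (d : Fin k → K)
    (I J : Finset (Fin k)) :
    ((List.finRange k).map fun j =>
      lMat e (d j) (if j ∈ J then 0 else 1) (if j ∈ I then 3 else 2)).prod =
      ((List.finRange k).map d).prod • (e 2 1 ^ (k + (I ∩ J).card - I.card - J.card) *
        e 2 0 ^ (J.card - (I ∩ J).card) * e 3 1 ^ (I.card - (I ∩ J).card) *
        e 3 0 ^ (I ∩ J).card) := by
  have key : ∀ l : List (Fin k), (l.map fun j =>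
      lMat e (d j) (if j ∈ J then 0 else 1) (if j ∈ I then 3 else 2)).prod =
      (l.map d).prod • (e 2 1 ^ (l.countP fun j => j ∉ I ∧ j ∉ J) *
        e 2 0 ^ (l.countP fun j => j ∉ I ∧ j ∈ J) * e 3 1 ^ (l.countP fun j => j ∈ I ∧ j ∉ J) *
        e 3 0 ^ (l.countP fun j => j ∈ I ∧ j ∈ J)) := by
    intro l
    induction l with
    | nil => simp
    | cons j l ih =>
      rw [List.map_cons, List.prod_cons, ih, List.map_cons, List.prod_cons]
      simp only [List.countP_cons]
      have c1 : Commute (e 2 0) (e 2 1) := he.commute (by decide) (by decide)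
      have c2 : Commute (e 3 1) (e 2 1) := he.commute (by decide) (by decide)
      have c3 : Commute (e 3 1) (e 2 0) := he.commute (by decide) (by decide)
      have c4 : Commute (e 3 0) (e 2 1) := he.commute (by decide) (by decide)
      have c5 : Commute (e 3 0) (e 2 0) := he.commute (by decide) (by decide)
      have c6 : Commute (e 3 0) (e 3 1) := he.commute (by decide) (by decide)
      generalize (l.countP fun j => decide (j ∉ I ∧ j ∉ J)) = n1
      generalize (l.countP fun j => decide (j ∉ I ∧ j ∈ J)) = n2
      generalize (l.countP fun j => decide (j ∈ I ∧ j ∉ J)) = n3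
      generalize (l.countP fun j => decide (j ∈ I ∧ j ∈ J)) = n4
      by_cases hI : j ∈ I <;> by_cases hJ : j ∈ J
      · simp only [hI, hJ, lMat, if_true, not_true, and_self, and_false, false_and, decide_true,
          decide_false, Bool.false_eq_true, if_false, add_zero]
        rw [if_neg (by decide), zero_add, smul_mul_smul_comm, pow_succ', ← mul_assoc,
          (c4.pow_right n1).mul_right (c5.pow_right n2) |>.mul_right (c6.pow_right n3) |>.eq]
        simp only [mul_assoc]
      · simp only [hI, hJ, lMat, if_true, not_true, and_self, and_false, false_and, decide_true,
          decide_false, Bool.false_eq_true, if_false, add_zero, not_false_eq_true]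
        rw [if_neg (by decide), zero_add, smul_mul_smul_comm, pow_succ', ← mul_assoc, ← mul_assoc,
          ((c2.pow_right n1).mul_right (c3.pow_right n2)).eq]
        simp only [mul_assoc]
      · simp only [hI, hJ, lMat, if_true, not_true, and_self, and_false, false_and, decide_true,
          decide_false, Bool.false_eq_true, if_false, add_zero, not_false_eq_true]
        rw [if_neg (by decide), zero_add, smul_mul_smul_comm, pow_succ', ← mul_assoc, ← mul_assoc,
          ← mul_assoc, (c1.pow_right n1).eq]
        simp only [mul_assoc]
      · simp only [hI, hJ, lMat, if_true, and_self, and_false, false_and, decide_true,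
          decide_false, Bool.false_eq_true, if_false, add_zero, not_false_eq_true]
        rw [if_neg (by decide), zero_add, smul_mul_smul_comm, pow_succ']
        simp only [mul_assoc]
  rw [key]
  simp only [countP_finRange]
  have f1 : ({j | j ∈ I ∧ j ∈ J} : Finset (Fin k)) = I ∩ J := by ext; simp
  have f2 : ({j | j ∈ I ∧ j ∉ J} : Finset (Fin k)) = I \ J := by ext; simp
  have f3 : ({j | j ∉ I ∧ j ∈ J} : Finset (Fin k)) = J \ I := by ext; simp [and_comm]
  have f4 : ({j | j ∉ I ∧ j ∉ J} : Finset (Fin k)) = (I ∪ J)ᶜ := by ext; simp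
  -- The natural subtraction in the exponent is exact: it counts the complement of I ∪ J.
  have g1 := Finset.card_union_add_card_inter I J
  have g2 := Finset.card_le_univ (I ∪ J)
  rw [Fintype.card_fin] at g2
  rw [f1, f2, f3, f4, Finset.card_sdiff, Finset.card_sdiff, Finset.inter_comm J I,
    Finset.card_compl, Fintype.card_fin,
    show k - (I ∪ J).card = k + (I ∩ J).card - I.card - J.card by omega]

end Lowering

/-! ### From intermediate colourings to pairs of subsets -/

section Assembly

variable {K : Type*} [Field K] [CharZero K] {M : Type*} [AddCommGroup M] [Module K M]
  {e : Fin 4 → Fin 4 → Module.End K M} {ι : Type*} [DecidableEq ι] [Fintype ι] {t : ι → K}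

/-- The nested sum over colourings as a sum over pairs of subsets. -/
theorem sum_colourings_eq_sum_subsets (he : IsGlFamily e) (ht : Function.Injective t) (x k1 k2 : K)
    (v : M) {m1 k m3 : ℕ} {s1 : Fin m1 → ι} {s2 : Fin k → ι} {s3 : Fin m3 → ι}
    (h1 : Function.Injective s1) (h2 : Function.Injective s2) (h3 : Function.Injective s3)
    (h12 : ∀ a j, s1 a ≠ s2 j) (h13 : ∀ a j, s1 a ≠ s3 j) (h32 : ∀ a j, s3 a ≠ s2 j)
    (hcov : ∀ l, (∃ a, s1 a = l) ∨ (∃ j, s2 j = l) ∨ ∃ a, s3 a = l)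
    {L1 L2 L3 : List ι} (hL1 : L1 = (List.finRange m1).map s1)
    (hL2 : L2 = (List.finRange k).map s2) (hL3 : L3 = (List.finRange m3).map s3) :
    (∑ γ : ι → Fin 4, if (∀ i ∈ L1, γ i = 1) ∧ ∀ i ∈ L3, γ i = 2 then
        ∑ α : ι → Fin 4, if ∀ i, i ∉ L2 → α i = γ i then
          (L2.map fun i => lMat e (recip t x i) (α i) (γ i)).prod
            (((L1.map fun i => -recip t x i).prod *
              bethe (fun i => -t i) (-(x - k1)) 1 0 L2 α L1.toFinset) •
              (-1 : K) ^ (L1.length - excited 0 L2 α) • (e 1 0 ^ (L1.length - excited 0 L2 α))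
                (((L3.map (recip t x)).prod * bethe t (x - k2) 2 3 L2 γ L3.toFinset) •
                  (e 3 2 ^ (L3.length - excited 3 L2 γ)) v))
          else 0
        else 0) =
      ∑ IJ : Finset (Fin k) × Finset (Fin k), if IJ.1.card ≤ m3 ∧ IJ.2.card ≤ m1 then
        ((L1.map (recip t x)).prod * (L2.map (recip t x)).prod * (L3.map (recip t x)).prod *
          (vTilde IJ.2 (t ∘ s1) (t ∘ s2) (x - k1) * vFun IJ.1 (t ∘ s3) (t ∘ s2) (x - k2))) •
        (e 2 1 ^ (k + (IJ.1 ∩ IJ.2).card - IJ.1.card - IJ.2.card) *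
          e 2 0 ^ (IJ.2.card - (IJ.1 ∩ IJ.2).card) * e 3 1 ^ (IJ.1.card - (IJ.1 ∩ IJ.2).card) *
          e 3 0 ^ (IJ.1 ∩ IJ.2).card * e 1 0 ^ (m1 - IJ.2.card) * e 3 2 ^ (m3 - IJ.1.card)) v
      else 0 := by
  have hF1 : L1.toFinset = Finset.univ.image s1 := by subst hL1; ext; simp
  have hF3 : L3.toFinset = Finset.univ.image s3 := by subst hL3; ext; simp
  have hl1 : L1.length = m1 := by subst hL1; simp
  have hl3 : L3.length = m3 := by subst hL3; simp
  have m1L : ∀ l, l ∈ L1 ↔ ∃ a, s1 a = l := by subst hL1; simp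
  have m2L : ∀ l, l ∈ L2 ↔ ∃ a, s2 a = l := by subst hL2; simp
  have m3L : ∀ l, l ∈ L3 ↔ ∃ a, s3 a = l := by subst hL3; simp
  have hneg : (L1.map fun i => -recip t x i).prod = (-1) ^ m1 * (L1.map (recip t x)).prod := by
    rw [← hl1]
    generalize L1 = L
    induction L with
    | nil => simp
    | cons a L ih =>
      simp only [List.map_cons, List.prod_cons, ih, List.length_cons, pow_succ]
      ring
  -- Off the second group γ is forced, 1 on the first group and 2 on the third; I is its set of
  -- sites of colour 3. Then α agrees with γ there, and J is its set of sites of colour 0.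
  rw [sum_recolour h2 (base := fun l => if l ∈ L1 then 1 else 2) (show (2 : Fin 4) ≠ 3 by decide),
    Fintype.sum_prod_type]
  · refine Finset.sum_congr rfl fun I _ => ?_
    set γ := recolour s2 (fun l => if l ∈ L1 then 1 else 2) (2 : Fin 4) 3 I with hγ
    have hγs : ∀ j, γ (s2 j) = if j ∈ I then 3 else 2 := recolour_apply h2 I
    rw [sum_recolour h2 (base := γ) (show (1 : Fin 4) ≠ 0 by decide)]
    · refine Finset.sum_congr rfl fun J _ => ?_
      set α := recolour s2 γ (1 : Fin 4) 0 J with hα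
      have hαs : ∀ j, α (s2 j) = if j ∈ J then 0 else 1 := recolour_apply h2 J
      have hp : (L2.map fun i => lMat e (recip t x i) (α i) (γ i)).prod =
          (L2.map (recip t x)).prod • (e 2 1 ^ (k + (I ∩ J).card - I.card - J.card) *
            e 2 0 ^ (J.card - (I ∩ J).card) * e 3 1 ^ (I.card - (I ∩ J).card) *
            e 3 0 ^ (I ∩ J).card) := by
        rw [hL2, List.map_map, List.map_map, ← he.prod_lowering]
        simp only [Function.comp_def, hαs, hγs]
      have hxJ : excited 0 L2 α = J.card := by
        rw [excited, hL2, List.countP_map, Function.comp_def, countP_finRange]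
        congr 1
        ext j
        simp [hαs]
      have hxI : excited 3 L2 γ = I.card := by
        rw [excited, hL2, List.countP_map, Function.comp_def, countP_finRange]
        congr 1
        ext j
        simp [hγs]
      rw [hp, hxJ, hxI, hl1, hl3]
      -- Subsets larger than the number of available variables give a zero coefficient, so
      -- truncation in the exponents and in the factorials plays no role.
      by_cases hI : I.card ≤ m3
      swap
      · rw [if_neg fun h => hI h.1, bethe_eq_zero_of_card_lt (S := L3.toFinset)]
        · simp
        · rw [hxI, hF3, Finset.card_image_of_injective _ h3, Finset.card_univ, Fintype.card_fin]
          omega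
      by_cases hJ : J.card ≤ m1
      swap
      · rw [if_neg fun h => hJ h.2, bethe_eq_zero_of_card_lt (S := L1.toFinset)]
        · simp
        · rw [hxJ, hF1, Finset.card_image_of_injective _ h1, Finset.card_univ, Fintype.card_fin]
          omega
      rw [if_pos ⟨hI, hJ⟩, hF1, hF3, hneg]
      have b1 : bethe (fun i => -t i) (-(x - k1)) 1 0 L2 α (Finset.univ.image s1) =
          vFun J (fun a => -(t ∘ s1) a) (fun j => -(t ∘ s2) j) (-(x - k1)) := by
        rw [hL2, bethe_eq_vFun (I := J) (fun a b h => ht (neg_injective h)) _ h1 h12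
          (fun j => by rw [hαs]; split_ifs <;> simp) (fun j => by rw [hαs]; split_ifs with h <;> simp [h]) hJ]
        rfl
      have b3 : bethe t (x - k2) 2 3 L2 γ (Finset.univ.image s3) =
          vFun I (t ∘ s3) (t ∘ s2) (x - k2) := by
        rw [hL2, bethe_eq_vFun (I := I) ht _ h3 h32
          (fun j => by rw [hγs]; split_ifs <;> simp) (fun j => by rw [hγs]; split_ifs with h <;> simp [h]) hI]
      rw [b1, b3, vTilde_eq hJ]
      simp only [LinearMap.smul_apply, map_smul, smul_smul, Module.End.mul_apply]
      congr 1
      -- The signs of the negated reciprocals and of the rescaled base vectors leave (-1)^|J|, which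
      -- is the sign in `vTilde_eq`.
      have hsq : ((-1 : K) ^ m1) * (-1) ^ (m1 - J.card) = (-1) ^ J.card := by
        obtain ⟨n, rfl⟩ := Nat.exists_eq_add_of_le hJ
        rw [Nat.add_sub_cancel_left, pow_add, mul_assoc, ← mul_pow]
        simp
      rw [← hsq]
      ring
    · intro α
      refine forall_congr' fun l => ?_
      rw [m2L, not_exists]
    · rintro α ⟨j, hj⟩
      rw [bethe_eq_zero_of_ne (s := L2) (α := α)]
      · simp
      · exact ⟨s2 j, (m2L _).2 ⟨j, rfl⟩, hj⟩
  · intro γ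
    constructor
    · rintro ⟨ha, hb⟩ l hl
      rcases hcov l with h | h | h
      · rw [if_pos ((m1L l).2 h), ha l ((m1L l).2 h)]
      · exact absurd h (by push Not; exact hl)
      · rw [if_neg, hb l ((m3L l).2 h)]
        rw [m1L]
        rintro ⟨a, rfl⟩
        obtain ⟨b, hb⟩ := h
        exact h13 a b hb.symm
    · intro h
      refine ⟨fun l hl => ?_, fun l hl => ?_⟩
      · obtain ⟨a, ha⟩ := (m1L l).1 hl
        rw [h l fun j hj => h12 a j (ha.trans hj.symm), if_pos hl]
      · obtain ⟨a, ha⟩ := (m3L l).1 hl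
        rw [h l fun j hj => h32 a j (ha.trans hj.symm), if_neg]
        rw [m1L]
        rintro ⟨b, hb⟩
        exact h13 b a (hb.trans ha.symm)
  · rintro γ ⟨j, hj⟩
    refine Finset.sum_eq_zero fun α _ => ?_
    rw [bethe_eq_zero_of_ne (s := L2) (α := γ)]
    · simp
    · exact ⟨s2 j, (m2L _).2 ⟨j, rfl⟩, hj⟩

end Assembly

/-- The lower limit for r is |I ∪ J| ≤ k rewritten; truncated subtraction supplies the maximum with
0. -/
theorem sum_pairs {N : Type*} [AddCommMonoid N] (k m1 m3 : ℕ)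
    (f : Finset (Fin k) × Finset (Fin k) → N) :
    (∑ IJ, if IJ.1.card ≤ m3 ∧ IJ.2.card ≤ m1 then f IJ else 0) =
      ∑ p ∈ Finset.range (min k m3 + 1), ∑ q ∈ Finset.range (min k m1 + 1),
        ∑ r ∈ Finset.Icc (p + q - k) (min p q), ∑ IJ ∈ pairs p q r k, f IJ := by
  have h : ∀ p q r, ∑ IJ ∈ pairs p q r k, f IJ = ∑ IJ, if IJ.1.card = p then
      if IJ.2.card = q then if (IJ.1 ∩ IJ.2).card = r then f IJ else 0 else 0 else 0 := by
    intro p q r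
    rw [pairs, Finset.sum_filter]
    refine Finset.sum_congr rfl fun IJ _ => ?_
    split_ifs <;> simp_all
  simp only [h]
  refine Eq.trans ?_ (Finset.sum_comm.trans (Finset.sum_congr rfl fun p _ => Finset.sum_comm.trans
    (Finset.sum_congr rfl fun q _ => Finset.sum_comm)))
  refine Finset.sum_congr rfl fun IJ _ => ?_
  have g1 := Finset.card_union_add_card_inter IJ.1 IJ.2
  have g2 := Finset.card_le_univ (IJ.1 ∪ IJ.2)
  have g3 := Finset.card_le_card (Finset.inter_subset_left (s₁ := IJ.1) (s₂ := IJ.2))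
  have g4 := Finset.card_le_card (Finset.inter_subset_right (s₁ := IJ.1) (s₂ := IJ.2))
  have g5 := Finset.card_le_univ IJ.1
  have g6 := Finset.card_le_univ IJ.2
  rw [Fintype.card_fin] at g2 g5 g6
  symm
  by_cases hp : IJ.1.card ≤ m3
  swap
  · rw [if_neg fun h => hp h.1]
    refine Finset.sum_eq_zero fun p hp' => Finset.sum_eq_zero fun q _ =>
      Finset.sum_eq_zero fun r _ => if_neg ?_
    rw [Finset.mem_range] at hp'
    omega
  by_cases hq : IJ.2.card ≤ m1
  swap
  · rw [if_neg fun h => hq h.2]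
    refine Finset.sum_eq_zero fun p _ => Finset.sum_eq_zero fun q hq' =>
      Finset.sum_eq_zero fun r _ => ?_
    rw [Finset.mem_range] at hq'
    rw [if_neg (show ¬ IJ.2.card = q by omega), ite_self]
  rw [if_pos ⟨hp, hq⟩, Finset.sum_eq_single IJ.1.card, Finset.sum_eq_single IJ.2.card,
    Finset.sum_eq_single (IJ.1 ∩ IJ.2).card, if_pos rfl, if_pos rfl, if_pos rfl]
  · intro r _ hr
    rw [if_pos rfl, if_pos rfl, if_neg hr.symm]
  · intro h
    exact absurd (Finset.mem_Icc.2 (by omega)) h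
  · intro q _ hq
    simp [hq.symm]
  · intro h
    exact absurd (Finset.mem_range.2 (by omega)) h
  · intro p _ hp
    simp [hp.symm]
  · intro h
    exact absurd (Finset.mem_range.2 (by omega)) h

/-! ### The action on a singular vector -/

section SingularVector

attribute [local instance] serAlgebra

section SeriesAction

variable {V : Type*} [AddCommGroup V] [Module ℂ V] {ξ : Fin 3 → ℕ}

theorem orbitMk_sum (v : V) {κ : Type*} (s : Finset κ) (f : κ → Ser ξ (Module.End ℂ V)) :
    orbitMk ξ v (∑ i ∈ s, f i) = ∑ i ∈ s, orbitMk ξ v (f i) :=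
  map_sum (annihilator ξ v).mkQ f s

theorem smul_orbitAction_C (v : V) (h : Ser ξ ℂ) (W : Module.End ℂ V) :
    h • orbitAction ξ v (HahnSeries.C W) (orbitMk ξ v 1) =
      orbitMk ξ v (scalarSer _ h * HahnSeries.C W) := by
  rw [orbitAction_mk, smul_orbitMk, mul_one]

theorem coeff_serSMul (v : V) (h : Ser ξ ℂ) (W : Module.End ℂ V) (a : Expo ξ) :
    (serSMul h (W v)).coeff a = (scalarSer (Module.End ℂ V) h * HahnSeries.C W).coeff a v := by
  rw [HahnSeries.C_apply, HahnSeries.coeff_mul_single_zero]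
  simp [serSMul, scalarSer, Module.algebraMap_end_eq_smul_id]

theorem prod_group {K : Type*} [CommMonoid K] (a : Fin 3) (f : Label ξ → K) :
    ((group ξ a).map f).prod = ∏ i, f (lab a i) := by
  rw [group, List.map_map, ← List.ofFn_eq_map, List.prod_ofFn]
  rfl

end SeriesAction

theorem serAct_betheB {V : Type*} [AddCommGroup V] [Module ℂ V]
    [LieRingModule (Matrix (Fin 4) (Fin 4) ℂ) V] [LieModule ℂ (Matrix (Fin 4) (Fin 4) ℂ) V]
    (Λ : Fin 4 → ℂ) (v : V) (hv : IsSingularVector Λ v) (x : ℂ) (ξ : Fin 3 → ℕ) :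
    serAct (evalModule V x) (betheB ξ) v =
      ∑ p ∈ Finset.range (min (ξ 1) (ξ 2) + 1),
        ∑ q ∈ Finset.range (min (ξ 1) (ξ 0) + 1),
          ∑ r ∈ Finset.Icc (p + q - ξ 1) (min p q),
            serSMul
              ((∏ a : Fin 3, ∏ i : Fin (ξ a), 1 / (tVars ξ a i - HahnSeries.C x)) *
                ∑ IJ ∈ pairs p q r (ξ 1),
                  vTilde IJ.2 (tVars ξ 0) (tVars ξ 1) (HahnSeries.C (x - Λ 1)) *
                    vFun IJ.1 (tVars ξ 2) (tVars ξ 1) (HahnSeries.C (x - Λ 2)))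
              ((eOp 4 V 2 1 ^ (ξ 1 + r - p - q) * eOp 4 V 2 0 ^ (q - r) * eOp 4 V 3 1 ^ (p - r) *
                eOp 4 V 3 0 ^ r * eOp 4 V 1 0 ^ (ξ 0 - q) * eOp 4 V 3 2 ^ (ξ 2 - p)) v) := by
  have := charZero_ser (ξ := ξ)
  have hcov : ∀ l : Label ξ, (∃ a, lab 0 a = l) ∨ (∃ j, lab 1 j = l) ∨ ∃ a, lab 2 a = l := by
    rintro ⟨a, i⟩
    fin_cases a
    · exact Or.inl ⟨i, rfl⟩
    · exact Or.inr (Or.inl ⟨i, rfl⟩)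
    · exact Or.inr (Or.inr ⟨i, rfl⟩)
  have key := (orbitMk_betheB (ξ := ξ) hv x).trans
    (sum_colourings_eq_sum_subsets (isGlFamily_orbitGl v) tVar_injective (HahnSeries.C x)
      (HahnSeries.C (Λ 1)) (HahnSeries.C (Λ 2)) (orbitMk ξ v 1) (lab_injective 0)
      (lab_injective 1) (lab_injective 2) (lab_ne (by decide)) (lab_ne (by decide))
      (lab_ne (by decide)) hcov rfl rfl rfl)
  rw [sum_pairs] at key
  have hterm : ∀ p q r, (∑ IJ ∈ pairs p q r (ξ 1),
      (((group ξ 0).map (recip tVar (HahnSeries.C x))).prod *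
        ((group ξ 1).map (recip tVar (HahnSeries.C x))).prod *
        ((group ξ 2).map (recip tVar (HahnSeries.C x))).prod *
          (vTilde IJ.2 (tVar ∘ lab 0) (tVar ∘ lab 1) (HahnSeries.C x - HahnSeries.C (Λ 1)) *
            vFun IJ.1 (tVar ∘ lab 2) (tVar ∘ lab 1) (HahnSeries.C x - HahnSeries.C (Λ 2)))) •
        (orbitGl ξ v 2 1 ^ (ξ 1 + (IJ.1 ∩ IJ.2).card - IJ.1.card - IJ.2.card) *
          orbitGl ξ v 2 0 ^ (IJ.2.card - (IJ.1 ∩ IJ.2).card) *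
          orbitGl ξ v 3 1 ^ (IJ.1.card - (IJ.1 ∩ IJ.2).card) *
          orbitGl ξ v 3 0 ^ (IJ.1 ∩ IJ.2).card * orbitGl ξ v 1 0 ^ (ξ 0 - IJ.2.card) *
          orbitGl ξ v 3 2 ^ (ξ 2 - IJ.1.card)) (orbitMk ξ v 1)) =
      orbitMk ξ v (scalarSer _ ((∏ a : Fin 3, ∏ i : Fin (ξ a), 1 / (tVars ξ a i - HahnSeries.C x)) *
        ∑ IJ ∈ pairs p q r (ξ 1),
          vTilde IJ.2 (tVars ξ 0) (tVars ξ 1) (HahnSeries.C (x - Λ 1)) *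
            vFun IJ.1 (tVars ξ 2) (tVars ξ 1) (HahnSeries.C (x - Λ 2))) *
        HahnSeries.C (eOp 4 V 2 1 ^ (ξ 1 + r - p - q) * eOp 4 V 2 0 ^ (q - r) *
          eOp 4 V 3 1 ^ (p - r) * eOp 4 V 3 0 ^ r * eOp 4 V 1 0 ^ (ξ 0 - q) *
          eOp 4 V 3 2 ^ (ξ 2 - p))) := by
    intro p q r
    rw [← smul_orbitAction_C, Finset.mul_sum]
    refine Eq.trans ?_ (Finset.sum_smul (R := Ser ξ ℂ) (M := SerOrbit ξ v)).symm
    refine Finset.sum_congr rfl fun IJ hIJ => ?_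
    obtain ⟨hp, hq, hr⟩ := (Finset.mem_filter.1 hIJ).2
    rw [hp, hq, hr, map_sub, map_sub]
    simp only [map_mul, map_pow, prod_group, Fin.prod_univ_three]
    rfl
  simp only [hterm, ← orbitMk_sum] at key
  -- Equality of classes in `SerOrbit` is now compared one coefficient at a time after application
  -- to `v`.
  ext a
  have h := (orbitMk_eq_iff v _ _).1 key a
  refine Eq.trans ?_ (h.trans ?_)
  · rfl
  · simp only [HahnSeries.coeff_sum, LinearMap.sum_apply, coeff_serSMul]

end SingularVector

end YangianGl

end

theorem proposition5p5 {V : Type*} [AddCommGroup V] [Module ℂ V]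
    [LieRingModule (Matrix (Fin 4) (Fin 4) ℂ) V] [LieModule ℂ (Matrix (Fin 4) (Fin 4) ℂ) V]
    (Λ : Fin 4 → ℂ) (v : V) (hv : IsSingularVector Λ v) (x : ℂ) (ξ : Fin 3 → ℕ) :
    serAct (evalModule V x) (betheB ξ) v =
      ∑ p ∈ Finset.range (min (ξ 1) (ξ 2) + 1),
        ∑ q ∈ Finset.range (min (ξ 1) (ξ 0) + 1),
          ∑ r ∈ Finset.Icc (p + q - ξ 1) (min p q),
            serSMul
              ((∏ a : Fin 3, ∏ i : Fin (ξ a), 1 / (tVars ξ a i - HahnSeries.C x)) *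
                ∑ IJ ∈ pairs p q r (ξ 1),
                  vTilde IJ.2 (tVars ξ 0) (tVars ξ 1) (HahnSeries.C (x - Λ 1)) *
                    vFun IJ.1 (tVars ξ 2) (tVars ξ 1) (HahnSeries.C (x - Λ 2)))
              ((eOp 4 V 2 1 ^ (ξ 1 + r - p - q) * eOp 4 V 2 0 ^ (q - r) * eOp 4 V 3 1 ^ (p - r) *
                eOp 4 V 3 0 ^ r * eOp 4 V 1 0 ^ (ξ 0 - q) * eOp 4 V 3 2 ^ (ξ 2 - p)) v) :=
  serAct_betheB Λ v hv x ξ
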